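/- Let $n\ge 1$, $0<c<1$, and let $a_1<\dots<a_p$ and $b_1<\dots<b_q$ ($p,q\ge 0$) be real numbers. Let $J_1$ be a nonempty finite union of intervals whose finite endpoints are exactly $a_1,\dots,a_p$ (each $a_i$ separates a part of the line inside $J_1$ from a part outside it; unbounded intervals are allowed), and let $J_2$ be likewise with finite endpoints $b_1,\dots,b_q$; the combinatorial type of $J_1,J_2$ (whether they contain a neighbourhood of $-\infty$) is fixed while the endpoints and $c$ vary. For $m\ge 0$ put $$\tau_m[K_1,K_2]=\frac{1}{m!\,\pi^{m/2}}\,c^{-m(m-1)/2}\int_{K_1^m}dx\int_{K_2^m}dy\; e^{-\sum_i x_i^2-\sum_i y_i^2+2c\sum_i x_iy_i}\,\Delta(x)\Delta(y),\qquad \Delta(x)=\prod_{i<j}(x_i-x_j),$$ the eigenvalue form of the integral $\iint e^{-\mathrm{Tr}M_1^2-\mathrm{Tr}M_2^2+2c\,\mathrm{Tr}M_1M_2}\,dM_1dM_2$ over $m\times m$ Hermitian matrices with spectra in $K_1$ and $K_2$, and, in the variables of the Gaussian Dyson process, $$\tau_m^J=\tau_m^J(c,a,b)=\tau_m\big[J_1/\sqrt{1-c^2},\,J_2/\sqrt{1-c^2}\big],\qquad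 \tau_m=\tau_m[\mathbb R,\mathbb R].$$ Set $$T=\ln\tau_n^J,\qquad U=(1-c^2)^{n+1/2}\,\frac{\tau_{n+1}^J}{\tau_n^J},\qquad W=(1-c^2)^{-(n-1/2)}\,\frac{\tau_{n-1}^J}{\tau_n^J},$$ $$\mathcal B_k=\sum_{i=1}^p a_i^{k+1}\partial_{a_i},\qquad \tilde{\mathcal B}_k=\sum_{i=1}^q b_i^{k+1}\partial_{b_i},\qquad \mathcal D_c=(1-c^2)c\,\partial_c,$$ $$\mathcal A=\mathcal B_{-1}+c\tilde{\mathcal B}_{-1},\quad \tilde{\mathcal A}=c\mathcal B_{-1}+\tilde{\mathcal B}_{-1},\quad \mathcal A_0=\mathcal B_0+c^2\tilde{\mathcal B}_0-\mathcal D_c,\quad \tilde{\mathcal A}_0=\tilde{\mathcal B}_0+c^2\mathcal B_0-\mathcal D_c .$$ Then all $\tau_m^J$ and $\tau_n$ are positive, $T$, $U$, $W$ are $C^2$ functions of $(c,a,b)$, and they satisfy $$\mathcal A\tilde{\mathcal A}T=4c\,(UW-n/2),$$ $$\mathcal A^2U=-2\mathcal A_0U-2(\mathcal A^2T)\,U,\qquad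 \mathcal A^2W=2\mathcal A_0W-2(\mathcal A^2T)\,W,$$ $$\tilde{\mathcal A}^2U=-2\tilde{\mathcal A}_0U-2(\tilde{\mathcal A}^2T)\,U,\qquad \tilde{\mathcal A}^2W=2\tilde{\mathcal A}_0W-2(\tilde{\mathcal A}^2T)\,W.$$ The same holds when $T$ is replaced by the logarithm $\ln(\tau_n^J/\tau_n)$ of the normalized joint probability. -/

import Mathlib

open scoped Nat

noncomputable section

namespace CoupledGUE

/-- Vandermonde product `∏_{i<j} (x_i - x_j)`. -/
def vandermonde {n : ℕ} (x : Fin n → ℝ) : ℝ :=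
  ∏ i : Fin n, ∏ j ∈ Finset.Ioi i, (x i - x j)

/-- The two-matrix integral with coupling `c`, over pairs of matrices whose spectra lie in `J₁` and
`J₂`, reduced to eigenvalues:
`c^{-n(n-1)/2} ∫_{J₁ⁿ} dx ∫_{J₂ⁿ} dy exp(-∑ xᵢ² - ∑ yᵢ² + 2c ∑ xᵢ yᵢ) Δ(x) Δ(y)`.
The constant `1 / (n! π^{n/2})` normalizes it so that for `J₁ = J₂ = ℝ` it equals
`(1-c²)^{-n²/2} π^{n/2} 2^{-n(n-1)/2} ∏_{j<n} j!`. -/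
def matrixIntegral (n : ℕ) (c : ℝ) (J₁ J₂ : Set ℝ) : ℝ :=
  1 / ((n ! : ℝ) * √Real.pi ^ n) * (1 / c) ^ (n * (n - 1) / 2) *
    ∫ x in {x : Fin n → ℝ | ∀ i, x i ∈ J₁}, ∫ y in {y : Fin n → ℝ | ∀ i, y i ∈ J₂},
      Real.exp (-∑ i, x i ^ 2 - ∑ i, y i ^ 2 + 2 * c * ∑ i, x i * y i) *
        vandermonde x * vandermonde y

/-- The finite union of intervals whose finite endpoints are `a 0 < a 1 < ⋯ < a (p-1)`: crossing an
endpoint enters or leaves the set, and `e` says whether the set contains a neighbourhood of `-∞`.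
For `p = 1` and `e = true` it is `(-∞, a 0)`; for `p = 2` and `e = false` it is `[a 0, a 1)`. -/
def spectralSet {p : ℕ} (e : Bool) (a : Fin p → ℝ) : Set ℝ :=
  {x | Even (Finset.univ.filter fun i => a i ≤ x).card ↔ e = true}

/-- The independent variables `(c, a, b)`: the coupling and the finite spectral endpoints of the
first and of the second matrix. -/
abbrev Vars (p q : ℕ) : Type := ℝ × (Fin p → ℝ) × (Fin q → ℝ)

/-- `τ_n^J` in the variables of the Dyson process: all endpoints of the two-matrix integral are
rescaled by `1 / √(1-c²)`. -/
def tau {p q : ℕ} (e₁ e₂ : Bool) (n : ℕ) (z : Vars p q) : ℝ :=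
  matrixIntegral n z.1
    (spectralSet e₁ fun i => z.2.1 i / √(1 - z.1 ^ 2))
    (spectralSet e₂ fun i => z.2.2 i / √(1 - z.1 ^ 2))

/-- `ln τ_n^J`. -/
def logTau {p q : ℕ} (e₁ e₂ : Bool) (n : ℕ) (z : Vars p q) : ℝ :=
  Real.log (tau e₁ e₂ n z)

/-- Logarithm of the normalized joint probability `τ_n^J / τ_n`, with `τ_n` the integral over the
whole line for both matrices. -/
def logProb {p q : ℕ} (e₁ e₂ : Bool) (n : ℕ) (z : Vars p q) : ℝ :=
  Real.log (tau e₁ e₂ n z / matrixIntegral n z.1 Set.univ Set.univ)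

/-- `U = (1-c²)^{n+1/2} τ_{n+1}^J / τ_n^J`. -/
def U {p q : ℕ} (e₁ e₂ : Bool) (n : ℕ) (z : Vars p q) : ℝ :=
  tau e₁ e₂ (n + 1) z / tau e₁ e₂ n z * (1 - z.1 ^ 2) ^ ((n : ℝ) + 1 / 2)

/-- `W = (1-c²)^{-(n-1/2)} τ_{n-1}^J / τ_n^J` (used for `n ≥ 1`). -/
def W {p q : ℕ} (e₁ e₂ : Bool) (n : ℕ) (z : Vars p q) : ℝ :=
  tau e₁ e₂ (n - 1) z / tau e₁ e₂ n z * (1 - z.1 ^ 2) ^ (-((n : ℝ) - 1 / 2))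

/-- `ℬ_k = ∑ a_i^{k+1} ∂/∂a_i` over the endpoints of the first matrix. -/
def B {p q : ℕ} (k : ℤ) (f : Vars p q → ℝ) (z : Vars p q) : ℝ :=
  ∑ i, z.2.1 i ^ (k + 1) * fderiv ℝ f z (0, Pi.single i 1, 0)

/-- `ℬ̃_k = ∑ b_i^{k+1} ∂/∂b_i` over the endpoints of the second matrix. -/
def Bt {p q : ℕ} (k : ℤ) (f : Vars p q → ℝ) (z : Vars p q) : ℝ :=
  ∑ i, z.2.2 i ^ (k + 1) * fderiv ℝ f z (0, 0, Pi.single i 1)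

/-- `𝒟_c = (1-c²) c ∂/∂c`, at fixed endpoints. -/
def Dc {p q : ℕ} (f : Vars p q → ℝ) (z : Vars p q) : ℝ :=
  (1 - z.1 ^ 2) * z.1 * fderiv ℝ f z (1, 0, 0)

/-- `𝒜 = ℬ₋₁ + c ℬ̃₋₁`. -/
def A {p q : ℕ} (f : Vars p q → ℝ) (z : Vars p q) : ℝ :=
  B (-1) f z + z.1 * Bt (-1) f z

/-- `𝒜̃ = c ℬ₋₁ + ℬ̃₋₁`. -/
def At {p q : ℕ} (f : Vars p q → ℝ) (z : Vars p q) : ℝ :=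
  z.1 * B (-1) f z + Bt (-1) f z

/-- `𝒜₀ = ℬ₀ + c² ℬ̃₀ - 𝒟_c`. -/
def A₀ {p q : ℕ} (f : Vars p q → ℝ) (z : Vars p q) : ℝ :=
  B 0 f z + z.1 ^ 2 * Bt 0 f z - Dc f z

/-- `𝒜̃₀ = ℬ̃₀ + c² ℬ₀ - 𝒟_c`. -/
def At₀ {p q : ℕ} (f : Vars p q → ℝ) (z : Vars p q) : ℝ :=
  Bt 0 f z + z.1 ^ 2 * B 0 f z - Dc f z

end CoupledGUE

end

noncomputable section

namespace CoupledGUE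

/-! ### Minors of an infinite matrix -/

section Minors

/-! Andréief's identity turns `τ_n^J` into an explicit function of `c` times the determinant `D_n`
of the moments `m_ij`, `i, j < n`, of `x^i y^j exp(-(x² + y² - 2cxy)/(1 - c²))` over `J₁ × J₂`
(`tau_eq`). Everything then follows from how these moments depend on the endpoints and on `c`.

Moving the endpoints by `(1, c)` amounts to translating the integrand, and the exponent then changes
at the rate `-2x` exactly. Scaling the endpoints by `(1, c²)` while `c` moves along `-𝒟_c` changes
it at the rate `-2x²`. So, up to the terms that come from the monomial and the volume element, `𝒜`
and `𝒜₀` raise the row index of `m_ij` by one and by two, with factor `-2` (`momentFlow`). The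
tilded operators do the same to the column index (`momentFlow_transpose`). In `D_n` the terms
lowering an index repeat a row or a column and vanish; in a once-raised minor they give back a
multiple of `D_n`. Hence the derivatives of `D_n` are minors with raised indices.

Between such minors there are two universal identities. The equations for `U` and `W` are the
bilinear modified KP equation for `D_{n+1}` and `D_n`, which is a three-term Plücker relation
(`hirota`). The equation for `𝒜𝒜̃T` is the Toda equation, which is the Desnanot–Jacobi identity
(`toda`). Both become trivial after passing to the Schur complement of a leading block
(`exists_schur`). What `hirota` leaves over is a scalar `n(1 - c²) - c²` depending on `c` alone, and
the powers of `1 - c²` in `U` and `W` are chosen so that their prefactors absorb it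
(`lieOn_cFactor`). Adding a function of `c` to `T` changes nothing, since `𝒜` and `𝒜̃` do not
differentiate in `c`; this covers the normalized probability.

Divisions and logarithms are justified by positivity of all `τ_m^J`: symmetrizing the integrand in
`y` produces `det(exp(2c x_i y_j)) Δ(x) Δ(y)`, which is positive at points with distinct coordinates
because the exponential kernel is strictly totally positive (`det_exp_pos`,
`integral_vandermonde_pos`). -/

/-- The minor of the infinite matrix `m` with rows `r` and columns `s`. -/
def minor {ι : Type*} [Fintype ι] [DecidableEq ι] (m : ℕ → ℕ → ℝ) (r s : ι → ℕ) : ℝ :=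
  (Matrix.of fun i j => m (r i) (s j)).det

/-- The leading principal minor of size `n`. -/
def leadingMinor (m : ℕ → ℕ → ℝ) (n : ℕ) : ℝ :=
  minor m (Fin.val : Fin n → ℕ) Fin.val

/-- The indices `0, …, k - 1, x`. -/
def extend (k x : ℕ) : Fin (k + 1) → ℕ := fun i => if i.val < k then i.val else x

/-- The indices `0, …, k - 1, x, y`. -/
def extend₂ (k x y : ℕ) : Fin (k + 2) → ℕ :=
  fun i => if i.val < k then i.val else if i.val = k then x else y

variable {ι κ : Type*} [Fintype ι] [DecidableEq ι] [Fintype κ] [DecidableEq κ]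

lemma minor_transpose (m : ℕ → ℕ → ℝ) (r s : ι → ℕ) :
    minor (fun i j => m j i) r s = minor m s r := by
  rw [minor, minor, ← Matrix.det_transpose]
  rfl

lemma leadingMinor_transpose (m : ℕ → ℕ → ℝ) (n : ℕ) :
    leadingMinor (fun i j => m j i) n = leadingMinor m n :=
  minor_transpose _ _ _

lemma minor_comp_equiv (m : ℕ → ℕ → ℝ) (e : κ ≃ ι) (r s : ι → ℕ) :
    minor m (r ∘ e) (s ∘ e) = minor m r s :=
  Matrix.det_submatrix_equiv_self e (Matrix.of fun i j => m (r i) (s j))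

lemma minor_comp_swap (m : ℕ → ℕ → ℝ) (r s : ι → ℕ) {i j : ι} (h : i ≠ j) :
    minor m (r ∘ Equiv.swap i j) s = -minor m r s := by
  have := Matrix.det_permute (Equiv.swap i j) (Matrix.of fun i j => m (r i) (s j))
  rw [Equiv.Perm.sign_swap h] at this
  simpa [minor, Matrix.submatrix] using this

lemma minor_eq_zero_of_row_eq (m : ℕ → ℕ → ℝ) {r : ι → ℕ} (s : ι → ℕ) {i j : ι} (h : i ≠ j)
    (hr : r i = r j) : minor m r s = 0 :=
  Matrix.det_zero_of_row_eq h (by ext l; simp [hr])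

lemma minor_eq_zero_of_col_eq (m : ℕ → ℕ → ℝ) (r : ι → ℕ) {s : ι → ℕ} {i j : ι} (h : i ≠ j)
    (hs : s i = s j) : minor m r s = 0 := by
  rw [← minor_transpose]
  exact minor_eq_zero_of_row_eq _ _ h hs

lemma extend_self (k : ℕ) : extend k k = Fin.val := by
  ext i
  simp only [extend]
  split_ifs <;> omega

lemma extend_self_apply (k : ℕ) (i : Fin (k + 1)) : extend k k i = i.val :=
  congrFun (extend_self k) i

lemma extend₂_self (k : ℕ) : extend₂ k k (k + 1) = Fin.val := by
  ext i
  simp only [extend₂]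
  split_ifs <;> omega

lemma extend₂_left (k x : ℕ) : extend₂ k k x = extend (k + 1) x := by
  ext i
  simp only [extend₂, extend]
  split_ifs <;> omega

/-- Minors containing an invertible leading block factor through the Schur complement. -/
lemma exists_schur (m : ℕ → ℕ → ℝ) (k : ℕ) (hk : leadingMinor m k ≠ 0) :
    ∃ S : ℕ → ℕ → ℝ,
      (∀ x y, minor m (extend k x) (extend k y) = leadingMinor m k * S x y) ∧
      ∀ x x' y y', minor m (extend₂ k x x') (extend₂ k y y') =
        leadingMinor m k * (S x y * S x' y' - S x y' * S x' y) := by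
  set A : Matrix (Fin k) (Fin k) ℝ := Matrix.of fun i j => m i j with hA
  have hdet : A.det = leadingMinor m k := rfl
  have : Invertible A := Matrix.invertibleOfIsUnitDet A (by rw [hdet]; exact hk.isUnit)
  refine ⟨fun x y => m x y -
    ∑ i : Fin k, ∑ j : Fin k, m x i * (⅟A) i j * m j y, fun x y => ?_, fun x x' y y' => ?_⟩
  · rw [← minor_comp_equiv m (finSumFinEquiv (m := k) (n := 1)), minor, ← hdet]
    have h : (Matrix.of fun i j : Fin k ⊕ Fin 1 =>
        m ((extend k x ∘ finSumFinEquiv) i) ((extend k y ∘ finSumFinEquiv) j)) =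
        Matrix.fromBlocks A (Matrix.of fun i _ => m i y) (Matrix.of fun _ j => m x j)
          (Matrix.of fun _ _ => m x y) := by
      ext i j
      rcases i with i | i <;> rcases j with j | j <;> simp [extend, hA]
    rw [h, Matrix.det_fromBlocks₁₁]
    congr 1
    rw [Matrix.det_unique]
    simp only [Matrix.sub_apply, Matrix.mul_apply, Matrix.of_apply, Finset.sum_mul]
    rw [Finset.sum_comm]
  · rw [← minor_comp_equiv m (finSumFinEquiv (m := k) (n := 2)), minor, ← hdet]
    have h : (Matrix.of fun i j : Fin k ⊕ Fin 2 =>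
        m ((extend₂ k x x' ∘ finSumFinEquiv) i) ((extend₂ k y y' ∘ finSumFinEquiv) j)) =
        Matrix.fromBlocks A (Matrix.of fun i j => m i (![y, y'] j))
          (Matrix.of fun i j => m (![x, x'] i) j)
          (Matrix.of fun i j => m (![x, x'] i) (![y, y'] j)) := by
      ext i j
      rcases i with i | i <;> rcases j with j | j
      · simp [extend₂, hA]
      · fin_cases j <;> simp [extend₂]
      · fin_cases i <;> simp [extend₂]
      · fin_cases i <;> fin_cases j <;> simp [extend₂]
    rw [h, Matrix.det_fromBlocks₁₁]
    congr 1
    have hS : ∀ u w, ∑ j : Fin k, (∑ i : Fin k, m u i * (⅟A) i j) * m j w =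
        ∑ i : Fin k, ∑ j : Fin k, m u i * (⅟A) i j * m j w := fun u w => by
      simp only [Finset.sum_mul]
      rw [Finset.sum_comm]
    rw [Matrix.det_fin_two]
    simp [Matrix.mul_apply, hS, -Matrix.invOf_eq_nonsing_inv]

lemma trace_adjugate_mul_eq_sum_updateCol (M X : Matrix ι ι ℝ) :
    (M.adjugate * X).trace = ∑ i, (M.updateCol i fun l => X l i).det := by
  simp only [Matrix.trace, Matrix.diag_apply]
  refine Finset.sum_congr rfl fun i _ => ?_
  rw [← Matrix.cramer_apply, Matrix.cramer_eq_adjugate_mulVec]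
  rfl

lemma trace_adjugate_mul_eq_sum_updateRow (M X : Matrix ι ι ℝ) :
    (M.adjugate * X).trace = ∑ i, (M.updateRow i (X i)).det := by
  rw [Matrix.trace_mul_comm, ← Matrix.trace_transpose, Matrix.transpose_mul,
    Matrix.adjugate_transpose, trace_adjugate_mul_eq_sum_updateCol]
  refine Finset.sum_congr rfl fun i _ => ?_
  rw [← Matrix.det_transpose, Matrix.updateCol_transpose, Matrix.transpose_transpose]
  rfl

/-- When the derivative of the matrix only relabels and weights rows, Jacobi's formula yields a sum
of minors with one row index replaced. This transfers a flow on moments to a flow on minors. -/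
lemma trace_adjugate_mul_rows (m : ℕ → ℕ → ℝ) (r s : ι → ℕ) (w : ι → ℝ) (r' : ι → ℕ) :
    ((Matrix.of fun i j => m (r i) (s j)).adjugate *
      Matrix.of fun i j => w i * m (r' i) (s j)).trace =
      ∑ i, w i * minor m (Function.update r i (r' i)) s := by
  rw [trace_adjugate_mul_eq_sum_updateRow]
  refine Finset.sum_congr rfl fun i _ => ?_
  have : (Matrix.of fun i j => w i * m (r' i) (s j)) i = w i • fun j => m (r' i) (s j) := rfl
  rw [this, Matrix.det_updateRow_smul, minor]
  congr 2
  ext a b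
  by_cases h : a = i
  · subst h; simp
  · simp [h]

lemma trace_adjugate_mul_cols (m : ℕ → ℕ → ℝ) (r s : ι → ℕ) (w : ι → ℝ) (s' : ι → ℕ) :
    ((Matrix.of fun i j => m (r i) (s j)).adjugate *
      Matrix.of fun i j => w j * m (r i) (s' j)).trace =
      ∑ j, w j * minor m r (Function.update s j (s' j)) := by
  rw [trace_adjugate_mul_eq_sum_updateCol]
  refine Finset.sum_congr rfl fun i _ => ?_
  have : (fun l => (Matrix.of fun i j => w j * m (r i) (s' j)) l i) =
    w i • fun l => m (r l) (s' i) := rfl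
  rw [this, Matrix.det_updateCol_smul, minor]
  congr 2
  ext a b
  by_cases h : b = i
  · subst h; simp
  · simp [h]

end Minors

/-! ### Lie derivatives -/

section Lie

variable {E : Type*} [NormedAddCommGroup E] [NormedSpace ℝ E]

/-- On `Ω` the function `f` is differentiable, with derivative `f'` along the vector field `v`. -/
def LieOn (Ω : Set E) (v : E → E) (f f' : E → ℝ) : Prop :=
  ∀ z ∈ Ω, ∃ L : E →L[ℝ] ℝ, HasFDerivAt f L z ∧ L (v z) = f' z

namespace LieOn

variable {Ω : Set E} {v : E → E} {f g f' g' : E → ℝ}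

lemma fderiv_eq (h : LieOn Ω v f f') {z : E} (hz : z ∈ Ω) : fderiv ℝ f z (v z) = f' z := by
  obtain ⟨L, hL, h'⟩ := h z hz
  rw [hL.fderiv, h']

lemma congr (h : LieOn Ω v f f') (hf : ∀ z ∈ Ω, f' z = g' z) : LieOn Ω v f g' := by
  intro z hz
  obtain ⟨L, hL, h'⟩ := h z hz
  exact ⟨L, hL, h'.trans (hf z hz)⟩

lemma congr_left (hΩ : IsOpen Ω) (h : LieOn Ω v f f') (hf : ∀ z ∈ Ω, g z = f z) :
    LieOn Ω v g f' := by
  intro z hz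
  obtain ⟨L, hL, h'⟩ := h z hz
  refine ⟨L, hL.congr_of_eventuallyEq ?_, h'⟩
  filter_upwards [hΩ.mem_nhds hz] with y hy using hf y hy

lemma mono {Ω' : Set E} (h : LieOn Ω v f f') (hs : Ω' ⊆ Ω) : LieOn Ω' v f f' :=
  fun z hz => h z (hs hz)

lemma const (a : ℝ) : LieOn Ω v (fun _ => a) (fun _ => 0) :=
  fun z _ => ⟨0, hasFDerivAt_const a z, by simp⟩

lemma add (hf : LieOn Ω v f f') (hg : LieOn Ω v g g') :
    LieOn Ω v (fun z => f z + g z) (fun z => f' z + g' z) := by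
  intro z hz
  obtain ⟨L, hL, h'⟩ := hf z hz
  obtain ⟨K, hK, k'⟩ := hg z hz
  exact ⟨L + K, hL.add hK, by simp [h', k']⟩

lemma mul (hf : LieOn Ω v f f') (hg : LieOn Ω v g g') :
    LieOn Ω v (fun z => f z * g z) (fun z => f' z * g z + f z * g' z) := by
  intro z hz
  obtain ⟨L, hL, h'⟩ := hf z hz
  obtain ⟨K, hK, k'⟩ := hg z hz
  exact ⟨_, hL.mul hK, by simp [h', k']; ring⟩

lemma const_mul (a : ℝ) (hf : LieOn Ω v f f') :
    LieOn Ω v (fun z => a * f z) (fun z => a * f' z) :=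
  ((const a).mul hf).congr fun z _ => by ring

lemma sum {α : Type*} (s : Finset α) {f f' : α → E → ℝ} (h : ∀ i ∈ s, LieOn Ω v (f i) (f' i)) :
    LieOn Ω v (fun z => ∑ i ∈ s, f i z) (fun z => ∑ i ∈ s, f' i z) := by
  classical
  induction s using Finset.induction_on with
  | empty => simpa using const (Ω := Ω) (v := v) 0
  | insert a s ha ih =>
    simp only [Finset.sum_insert ha]
    exact (h a (by simp)).add (ih fun i hi => h i (by simp [hi]))

lemma comp_real {θ θ' : ℝ → ℝ} (hf : LieOn Ω v f f')
    (hθ : ∀ z ∈ Ω, HasDerivAt θ (θ' (f z)) (f z)) :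
    LieOn Ω v (fun z => θ (f z)) (fun z => θ' (f z) * f' z) := by
  intro z hz
  obtain ⟨L, hL, h'⟩ := hf z hz
  exact ⟨_, (hθ z hz).comp_hasFDerivAt z hL, by simp [h']⟩

lemma inv (hf : LieOn Ω v f f') (h0 : ∀ z ∈ Ω, f z ≠ 0) :
    LieOn Ω v (fun z => (f z)⁻¹) (fun z => -f' z / f z ^ 2) :=
  (hf.comp_real (θ := fun x => x⁻¹) (θ' := fun x => -(x ^ 2)⁻¹)
    fun z hz => hasDerivAt_inv (h0 z hz)).congr fun z _ => by ring

lemma div (hf : LieOn Ω v f f') (hg : LieOn Ω v g g') (h0 : ∀ z ∈ Ω, g z ≠ 0) :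
    LieOn Ω v (fun z => f z / g z) (fun z => (f' z * g z - f z * g' z) / g z ^ 2) := by
  simp only [div_eq_mul_inv (f _)]
  refine (hf.mul (hg.inv h0)).congr fun z hz => ?_
  have := h0 z hz
  field_simp
  ring

lemma log (hf : LieOn Ω v f f') (h0 : ∀ z ∈ Ω, f z ≠ 0) :
    LieOn Ω v (fun z => Real.log (f z)) (fun z => f' z / f z) :=
  (hf.comp_real (θ := Real.log) (θ' := fun x => x⁻¹)
    fun z hz => Real.hasDerivAt_log (h0 z hz)).congr fun z _ => by ring

/-- Jacobi's formula: the product rule in the Leibniz expansion differentiates one column at a time.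
-/
lemma det {ι : Type*} [Fintype ι] [DecidableEq ι] {M X : E → Matrix ι ι ℝ}
    (h : ∀ i j, LieOn Ω v (fun z => M z i j) fun z => X z i j) :
    LieOn Ω v (fun z => (M z).det) fun z => ((M z).adjugate * X z).trace := by
  intro z hz
  choose L hL hv using fun i j => h i j z hz
  simp only [Matrix.det_apply']
  refine ⟨_, HasFDerivAt.fun_sum fun σ _ => (HasFDerivAt.finsetProd
    (fun i _ => hL (σ i) i)).const_mul (((Equiv.Perm.sign σ : ℤ) : ℝ)), ?_⟩
  rw [trace_adjugate_mul_eq_sum_updateCol]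
  simp only [Matrix.det_apply']
  rw [Finset.sum_comm]
  simp only [sum_apply, smul_apply, smul_eq_mul, hv,
    Finset.mul_sum]
  refine Finset.sum_congr rfl fun σ _ => Finset.sum_congr rfl fun i _ => ?_
  congr 1
  rw [← Finset.mul_prod_erase Finset.univ _ (Finset.mem_univ i), mul_comm]
  congr 1
  · simp
  · refine Finset.prod_congr rfl fun j hj => ?_
    rw [Matrix.updateCol_ne (Finset.ne_of_mem_erase hj)]

end LieOn

end Lie

/-! ### Flows on moment matrices -/

section Flow

variable {E : Type*} [NormedAddCommGroup E] [NormedSpace ℝ E]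

/-- The moments `m i j` evolve along `v` and `v₀` as the moments of a weight `w` on the plane do
when `w` is multiplied by the first and by the second power of the first coordinate. -/
structure MomentFlow (Ω : Set E) (v v₀ : E → E) (γ : E → ℝ) (m : E → ℕ → ℕ → ℝ) : Prop where
  first : ∀ i j : ℕ, LieOn Ω v (fun z => m z i j) fun z =>
    i * m z (i - 1) j + γ z * (j * m z i (j - 1)) - 2 * m z (i + 1) j
  second : ∀ i j : ℕ, LieOn Ω v₀ (fun z => m z i j) fun z =>
    ((i + 1) + γ z ^ 2 * (j + 1)) * m z i j - 2 * m z (i + 2) j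

variable {Ω : Set E} {v v₀ : E → E} {γ : E → ℝ} {m : E → ℕ → ℕ → ℝ}

/-- Lowering the index `j` repeats the column `j - 1`. The one exception `j = 0`, where `j - 1` is
truncated, carries weight zero. -/
lemma sum_mul_minor_lower_cols {k : ℕ} (m : ℕ → ℕ → ℝ) (r : Fin k → ℕ) :
    ∑ j : Fin k, (j.val : ℝ) * minor m r (Function.update Fin.val j (j.val - 1)) = 0 := by
  refine Finset.sum_eq_zero fun j _ => ?_
  rcases Nat.eq_zero_or_pos j.val with h | h
  · simp [h]
  · have hne : j ≠ ⟨j.val - 1, by omega⟩ := by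
      intro h'
      have := congrArg Fin.val h'
      simp only at this
      omega
    rw [minor_eq_zero_of_col_eq m r hne, mul_zero]
    rw [Function.update_self, Function.update_of_ne hne.symm]

lemma sum_mul_minor_lower_rows {k : ℕ} (m : ℕ → ℕ → ℝ) (s : Fin k → ℕ) :
    ∑ j : Fin k, (j.val : ℝ) * minor m (Function.update Fin.val j (j.val - 1)) s = 0 := by
  rw [← sum_mul_minor_lower_cols (fun i j => m j i) s]
  exact Finset.sum_congr rfl fun j _ => by rw [minor_transpose]

lemma update_castSucc_extend (k x t : ℕ) (i : Fin k) (j : Fin (k + 1)) :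
    Function.update (extend k x) i.castSucc t j =
      if j.val = i.val then t else if j.val < k then j.val else x := by
  by_cases h : j = i.castSucc
  · subst h; simp
  · have : j.val ≠ i.val := fun h' => h (Fin.ext h')
    simp [h, this, extend]

lemma update_last_extend (k x t : ℕ) :
    Function.update (extend k x) (Fin.last k) t = extend k t := by
  ext j
  by_cases h : j = Fin.last k
  · subst h; simp [extend]
  · have h2 : j.val ≠ k := fun h' => h (Fin.ext h')
    have h3 : j.val < k := by omega
    simp [h, extend, h3]

lemma minor_update_castSucc_extend_eq_zero (m : ℕ → ℕ → ℝ) (k x t : ℕ) (s : Fin (k + 1) → ℕ)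
    (i : Fin k) (ht : t < k) (hti : t ≠ i) :
    minor m (Function.update (extend k x) i.castSucc t) s = 0 := by
  refine minor_eq_zero_of_row_eq m s (i := i.castSucc) (j := ⟨t, by omega⟩) ?_ ?_
  · intro h
    exact hti (by simpa using (congrArg Fin.val h).symm)
  · rw [update_castSucc_extend, update_castSucc_extend]
    simp [ht, hti]

/-- Raising any row but the last repeats the next one, so a single term survives. -/
lemma sum_minor_raise_rows (m : ℕ → ℕ → ℝ) (k : ℕ) (s : Fin (k + 1) → ℕ) :
    ∑ i : Fin (k + 1), minor m (Function.update Fin.val i (i.val + 1)) s =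
      minor m (extend k (k + 1)) s := by
  rw [← extend_self]
  simp only [extend_self_apply]
  rw [Fin.sum_univ_castSucc, Fin.val_last, update_last_extend, Finset.sum_eq_zero, zero_add]
  intro i _
  rcases lt_or_eq_of_le (Nat.succ_le_of_lt i.isLt) with h | h
  · exact minor_update_castSucc_extend_eq_zero m k k _ s i h (by simp)
  · refine minor_eq_zero_of_row_eq m s (i := i.castSucc) (j := Fin.last k) ?_ ?_
    · exact i.castSucc_lt_last.ne
    · rw [update_castSucc_extend, update_castSucc_extend]
      have : k ≠ i := by omega
      have h' : i.val + 1 = k := h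
      simp [this, h']

/-- Only the last index `k + 1` has a free place below it; lowering it restores the leading minor
with weight `k + 1`. -/
lemma sum_minor_lower_extend_rows (m : ℕ → ℕ → ℝ) (k : ℕ) (s : Fin (k + 1) → ℕ) :
    ∑ i : Fin (k + 1), (extend k (k + 1) i : ℝ) *
        minor m (Function.update (extend k (k + 1)) i (extend k (k + 1) i - 1)) s =
      (k + 1) * minor m Fin.val s := by
  rw [Fin.sum_univ_castSucc, Finset.sum_eq_zero, zero_add]
  · have : extend k (k + 1) (Fin.last k) = k + 1 := by simp [extend]
    rw [this, update_last_extend, Nat.add_sub_cancel, extend_self]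
    push_cast
    rfl
  · intro i _
    have : extend k (k + 1) i.castSucc = i := by simp [extend]
    rw [this]
    rcases Nat.eq_zero_or_pos i.val with h | h
    · simp [h]
    · rw [minor_update_castSucc_extend_eq_zero m k _ _ s i (by omega) (by omega), mul_zero]

/-- Both sides vanish by a repeated row unless `i = k - 1`. In that case the rows end in `k, k + 1`
on one side and in `k + 1, k` on the other, which is the sign. -/
lemma minor_raise_extend_eq_neg (m : ℕ → ℕ → ℝ) (k : ℕ) (s : Fin (k + 1) → ℕ) (i : Fin k) :
    minor m (Function.update (extend k (k + 1)) i.castSucc (i.val + 1)) s =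
      -minor m (Function.update (extend k k) i.castSucc (i.val + 2)) s := by
  rcases lt_or_eq_of_le (Nat.succ_le_of_lt i.isLt) with h | h
  · rw [minor_update_castSucc_extend_eq_zero m k _ _ s i h (by simp)]
    rcases lt_or_eq_of_le (Nat.succ_le_of_lt h) with h' | h'
    · rw [minor_update_castSucc_extend_eq_zero m k _ _ s i h' (by omega), neg_zero]
    · rw [minor_eq_zero_of_row_eq m s (i := i.castSucc) (j := Fin.last k), neg_zero]
      · exact i.castSucc_lt_last.ne
      · rw [update_castSucc_extend, update_castSucc_extend]
        have h1 : k ≠ i := by omega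
        have h2 : i.val + 2 = k := h'
        simp [h1, h2]
  · have hne : i.castSucc ≠ Fin.last k := i.castSucc_lt_last.ne
    rw [← minor_comp_swap m _ s hne]
    congr 1
    ext j
    have h' : i.val + 1 = k := h
    simp only [Function.comp]
    by_cases h1 : j = i.castSucc
    · subst h1
      rw [Equiv.swap_apply_left, update_castSucc_extend, update_castSucc_extend]
      have h1 : k ≠ i := by omega
      simp [h1, h']
    · by_cases h2 : j = Fin.last k
      · subst h2
        rw [Equiv.swap_apply_right, update_castSucc_extend, update_castSucc_extend]
        have h1 : k ≠ i := by omega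
        simp [h1]
        omega
      · rw [Equiv.swap_apply_of_ne_of_ne h1 h2, update_castSucc_extend, update_castSucc_extend]
        have h3 : j.val ≠ k := fun h' => h2 (Fin.ext h')
        have h4 : j.val < k := by omega
        have h5 : j.val ≠ i.val := fun h' => h1 (Fin.ext h')
        simp [h4, h5]

/-- First raising of the leading rows. -/
def raise₁ (m : ℕ → ℕ → ℝ) : ℕ → ℝ
  | 0 => 0
  | k + 1 => minor m (extend k (k + 1)) Fin.val

/-- Second power of the first raising of the leading rows. -/
def raise₁₁ (m : ℕ → ℕ → ℝ) : ℕ → ℝ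
  | 0 => 0
  | k + 1 => ∑ i : Fin (k + 1), minor m
      (Function.update (extend k (k + 1)) i (extend k (k + 1) i + 1)) Fin.val

/-- Raising of the leading rows by two. -/
def raise₂ (m : ℕ → ℕ → ℝ) (n : ℕ) : ℝ :=
  ∑ i : Fin n, minor m (Function.update Fin.val i (i.val + 2)) Fin.val

/-- The analogue of `p₁² + p₂ = 2h₂` for symmetric functions: the contributions of all rows but the
last cancel by `minor_raise_extend_eq_neg`. -/
lemma raise₁₁_add_raise₂ (m : ℕ → ℕ → ℝ) (k : ℕ) :
    raise₁₁ m (k + 1) + raise₂ m (k + 1) = 2 * minor m (extend k (k + 2)) Fin.val := by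
  have h1 : ∀ i : Fin k, extend k (k + 1) i.castSucc = i := fun i => by simp [extend]
  have h2 : extend k (k + 1) (Fin.last k) = k + 1 := by simp [extend]
  simp only [raise₁₁, raise₂]
  rw [← extend_self]
  simp only [extend_self_apply]
  rw [Fin.sum_univ_castSucc, Fin.sum_univ_castSucc]
  simp only [h1, h2, update_last_extend, minor_raise_extend_eq_neg, Fin.val_castSucc, Fin.val_last,
    Finset.sum_neg_distrib]
  ring

/-- The analogue of `p₁² - p₂ = 2e₂`: now the last row cancels, and only the row before it
contributes. -/
lemma raise₁₁_sub_raise₂ (m : ℕ → ℕ → ℝ) (k : ℕ) :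
    raise₁₁ m (k + 2) - raise₂ m (k + 2) =
      2 * minor m (extend₂ k (k + 1) (k + 2)) Fin.val := by
  have h1 : ∀ i : Fin (k + 1), extend (k + 1) (k + 2) i.castSucc = i := fun i => by
    simp [extend, Nat.lt_succ_iff.1 i.isLt]
  have h2 : extend (k + 1) (k + 2) (Fin.last (k + 1)) = k + 2 := by simp [extend]
  simp only [raise₁₁, raise₂]
  rw [← extend_self]
  simp only [extend_self_apply]
  rw [Fin.sum_univ_castSucc (n := k + 1), Fin.sum_univ_castSucc (n := k + 1)]
  have h3 : ∀ i : Fin (k + 1), minor m (Function.update (extend (k + 1) (k + 1)) i.castSucc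
      (i.val + 2)) (extend (k + 1) (k + 1)) = -minor m (Function.update (extend (k + 1) (k + 1 + 1))
        i.castSucc (i.val + 1)) (extend (k + 1) (k + 1)) := fun i => by
    rw [minor_raise_extend_eq_neg, neg_neg]
  simp only [h1, h2, update_last_extend, h3, Fin.val_castSucc, Fin.val_last,
    Finset.sum_neg_distrib]
  rw [Fin.sum_univ_castSucc, Finset.sum_eq_zero]
  · have h4 : Function.update (extend (k + 1) (k + 1 + 1)) (Fin.last k).castSucc
        ((Fin.last k).val + 1) = extend₂ k (k + 1) (k + 2) := by
      ext j
      rw [update_castSucc_extend]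
      simp only [extend₂, Fin.val_last]
      split_ifs <;> omega
    rw [h4]
    ring
  · intro i _
    refine minor_update_castSucc_extend_eq_zero m (k + 1) _ _ _ i.castSucc ?_ ?_
    · simp
    · simp

lemma raise₁₁_sub_raise₂_one (m : ℕ → ℕ → ℝ) : raise₁₁ m 1 - raise₂ m 1 = 0 := by
  have h1 : ∀ i : Fin 1, Function.update (extend 0 1) i (extend 0 1 i + 1) =
      Function.update Fin.val i (i.val + 2) := fun i => by
    ext j
    obtain rfl : j = i := Fin.ext (by omega)
    simp [extend]
  simp only [raise₁₁, raise₂, zero_add, h1, sub_self]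

/-- Bilinear identity of the first modified KP equation. -/
lemma hirota (m : ℕ → ℕ → ℝ) (n : ℕ) (h0 : ∀ k, leadingMinor m k ≠ 0) :
    (raise₁₁ m (n + 1) - raise₂ m (n + 1)) * leadingMinor m n
      - 2 * raise₁ m (n + 1) * raise₁ m n
      + leadingMinor m (n + 1) * (raise₁₁ m n + raise₂ m n) = 0 := by
  cases n with
  | zero =>
    have h := raise₁₁_sub_raise₂_one m
    simp only [zero_add, h]
    simp [raise₁, raise₂, raise₁₁]
  | succ k =>
    obtain ⟨S, hS, hS₂⟩ := exists_schur m k (h0 k)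
    rw [raise₁₁_sub_raise₂, raise₁₁_add_raise₂]
    simp only [raise₁, leadingMinor]
    -- In terms of the Schur complement of the leading `k × k` block, with rows `k, k + 1, k + 2`
    -- and columns `k, k + 1`, this is the three-term Plücker relation: the vanishing expansion of a
    -- 3×3 determinant whose column `k` is repeated.
    rw [← extend_self k, ← extend₂_self k, ← extend₂_left, hS₂, hS, hS₂, hS, hS₂, hS]
    ring

/-- The Toda lattice equation in determinantal form. -/
lemma toda (m : ℕ → ℕ → ℝ) (k : ℕ) (h0 : ∀ k, leadingMinor m k ≠ 0) :
    leadingMinor m (k + 1) * minor m (extend k (k + 1)) (extend k (k + 1))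
      - minor m (extend k (k + 1)) Fin.val * minor m Fin.val (extend k (k + 1))
      = leadingMinor m (k + 2) * leadingMinor m k := by
  obtain ⟨S, hS, hS₂⟩ := exists_schur m k (h0 k)
  have h1 : leadingMinor m (k + 1) = minor m (extend k k) (extend k k) := by
    rw [extend_self]; rfl
  have h2 : leadingMinor m (k + 2) = minor m (extend₂ k k (k + 1)) (extend₂ k k (k + 1)) := by
    rw [extend₂_self]; rfl
  -- The identity now says that a 2×2 minor of the Schur complement is its own expansion.
  rw [h1, h2, ← extend_self k, hS₂, hS, hS, hS, hS]
  ring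

namespace MomentFlow

variable {ι : Type*} [Fintype ι] [DecidableEq ι]

/-- Each term of the flow changes one row index or one column index of the entries, so Jacobi's
formula keeps the derivative within sums of minors. -/
lemma lieOn_minor (hm : MomentFlow Ω v v₀ γ m) (r s : ι → ℕ) :
    LieOn Ω v (fun z => minor (m z) r s) fun z =>
      (∑ i, (r i : ℝ) * minor (m z) (Function.update r i (r i - 1)) s)
      + γ z * (∑ j, (s j : ℝ) * minor (m z) r (Function.update s j (s j - 1)))
      - 2 * ∑ i, minor (m z) (Function.update r i (r i + 1)) s := by
  have key : ∀ z, ∀ M X : Matrix ι ι ℝ, M = Matrix.of (fun i j => m z (r i) (s j)) →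
      X = Matrix.of (fun i j => (r i : ℝ) * m z (r i - 1) (s j))
        + γ z • Matrix.of (fun i j => (s j : ℝ) * m z (r i) (s j - 1))
        - (2 : ℝ) • Matrix.of (fun i j => 1 * m z (r i + 1) (s j)) →
      (M.adjugate * X).trace = (∑ i, (r i : ℝ) * minor (m z) (Function.update r i (r i - 1)) s)
        + γ z * (∑ j, (s j : ℝ) * minor (m z) r (Function.update s j (s j - 1)))
        - 2 * ∑ i, minor (m z) (Function.update r i (r i + 1)) s := by
    rintro z M X rfl rfl
    rw [Matrix.mul_sub, Matrix.mul_add, Matrix.mul_smul, Matrix.mul_smul, Matrix.trace_sub,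
      Matrix.trace_add, Matrix.trace_smul, Matrix.trace_smul, trace_adjugate_mul_rows,
      trace_adjugate_mul_cols, trace_adjugate_mul_rows]
    simp
  refine (LieOn.det fun i j => hm.first (r i) (s j)).congr fun z _ => key z _ _ rfl ?_
  ext i j
  simp

lemma lieOn_minor₀ (hm : MomentFlow Ω v v₀ γ m) (r s : ι → ℕ) :
    LieOn Ω v₀ (fun z => minor (m z) r s) fun z =>
      ((∑ i, ((r i : ℝ) + 1)) + γ z ^ 2 * ∑ j, ((s j : ℝ) + 1)) * minor (m z) r s
      - 2 * ∑ i, minor (m z) (Function.update r i (r i + 2)) s := by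
  have key : ∀ z, ∀ M X : Matrix ι ι ℝ, M = Matrix.of (fun i j => m z (r i) (s j)) →
      X = Matrix.of (fun i j => ((r i : ℝ) + 1) * m z (r i) (s j))
        + γ z ^ 2 • Matrix.of (fun i j => ((s j : ℝ) + 1) * m z (r i) (s j))
        - (2 : ℝ) • Matrix.of (fun i j => 1 * m z (r i + 2) (s j)) →
      (M.adjugate * X).trace =
        ((∑ i, ((r i : ℝ) + 1)) + γ z ^ 2 * ∑ j, ((s j : ℝ) + 1)) * minor (m z) r s
        - 2 * ∑ i, minor (m z) (Function.update r i (r i + 2)) s := by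
    rintro z M X rfl rfl
    rw [Matrix.mul_sub, Matrix.mul_add, Matrix.mul_smul, Matrix.mul_smul, Matrix.trace_sub,
      Matrix.trace_add, Matrix.trace_smul, Matrix.trace_smul, trace_adjugate_mul_rows,
      trace_adjugate_mul_cols, trace_adjugate_mul_rows]
    simp only [Function.update_eq_self, ← Finset.sum_mul, one_mul, smul_eq_mul]
    ring
  refine (LieOn.det fun i j => hm.second (r i) (s j)).congr fun z _ => key z _ _ rfl ?_
  ext i j
  simp
  ring

lemma lieOn_leadingMinor (hm : MomentFlow Ω v v₀ γ m) (n : ℕ) :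
    LieOn Ω v (fun z => leadingMinor (m z) n) fun z => -2 * raise₁ (m z) n := by
  refine (hm.lieOn_minor Fin.val Fin.val).congr fun z _ => ?_
  rw [sum_mul_minor_lower_rows, sum_mul_minor_lower_cols]
  cases n with
  | zero => simp [raise₁]
  | succ k => rw [sum_minor_raise_rows, raise₁]; ring

/-- The term `n * leadingMinor` is the lowering of the one raised row back to its place. -/
lemma lieOn_raise₁ (hm : MomentFlow Ω v v₀ γ m) (n : ℕ) :
    LieOn Ω v (fun z => raise₁ (m z) n) fun z =>
      n * leadingMinor (m z) n - 2 * raise₁₁ (m z) n := by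
  cases n with
  | zero => simpa [raise₁, raise₁₁] using LieOn.const (Ω := Ω) (v := v) 0
  | succ k =>
    refine (hm.lieOn_minor (extend k (k + 1)) Fin.val).congr fun z _ => ?_
    rw [sum_minor_lower_extend_rows, sum_mul_minor_lower_cols, raise₁₁, leadingMinor]
    push_cast
    ring

lemma lieOn_leadingMinor₀ (hm : MomentFlow Ω v v₀ γ m) (n : ℕ) :
    LieOn Ω v₀ (fun z => leadingMinor (m z) n) fun z =>
      (∑ i ∈ Finset.range n, ((i : ℝ) + 1)) * (1 + γ z ^ 2) * leadingMinor (m z) n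
        - 2 * raise₂ (m z) n := by
  refine (hm.lieOn_minor₀ Fin.val Fin.val).congr fun z _ => ?_
  rw [Finset.sum_range, raise₂, leadingMinor]
  ring

/-- The mixed second derivative behind the Toda equation. Lowering the raised column gives back the
leading minor with weight `γ (k + 1)`, which becomes the constant `n / 2` in the theorem. -/
lemma lieOn_minor_raised_col (hm : MomentFlow Ω v v₀ γ m) (k : ℕ) :
    LieOn Ω v (fun z => minor (m z) (Fin.val : Fin (k + 1) → ℕ) (extend k (k + 1))) fun z =>
      γ z * ((k + 1) * leadingMinor (m z) (k + 1))
        - 2 * minor (m z) (extend k (k + 1)) (extend k (k + 1)) := by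
  refine (hm.lieOn_minor Fin.val (extend k (k + 1))).congr fun z _ => ?_
  rw [sum_mul_minor_lower_rows, sum_minor_raise_rows]
  have := sum_minor_lower_extend_rows (fun i j => m z j i) k Fin.val
  simp only [minor_transpose] at this
  rw [this, leadingMinor]
  ring

end MomentFlow

end Flow

/-! ### Total positivity of the exponential kernel -/

section TotalPositivity

open Filter Topology

/-- An exponential sum with `m` distinct frequencies and `m` real zeros vanishes identically. -/
lemma eq_zero_of_exp_sum_eq_zero {m : ℕ} (y : Fin m → ℝ) (hy : Function.Injective y)
    (w : Fin m → ℝ) (x : Fin m → ℝ) (hx : StrictMono x)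
    (h : ∀ i, ∑ j, w j * Real.exp (y j * x i) = 0) : w = 0 := by
  induction m with
  | zero => exact Subsingleton.elim _ _
  | succ m ih =>
    -- Dividing by `exp (y 0 * t)` makes one term constant. Differentiating removes it, and Rolle's
    -- theorem costs only one zero, so the induction closes.
    set g : ℝ → ℝ := fun t => w 0 + ∑ j : Fin m, w j.succ * Real.exp ((y j.succ - y 0) * t)
      with hg
    have hgx : ∀ i, g (x i) = 0 := fun i => by
      have h1 := congrArg (fun r => r * Real.exp (-(y 0 * x i))) (h i)
      simp only [zero_mul, Fin.sum_univ_succ, add_mul, Finset.sum_mul, mul_assoc,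
        ← Real.exp_add] at h1
      rw [← h1, hg]
      simp only [add_neg_cancel, Real.exp_zero, mul_one]
      congr 1
      refine Finset.sum_congr rfl fun j _ => ?_
      congr 2
      ring
    have hgd : ∀ t, HasDerivAt g
        (∑ j : Fin m, w j.succ * (y j.succ - y 0) * Real.exp ((y j.succ - y 0) * t)) t := by
      intro t
      refine (HasDerivAt.fun_sum fun j _ => ?_).const_add _
      have := (((hasDerivAt_id t).const_mul (y j.succ - y 0)).exp).const_mul (w j.succ)
      refine this.congr_deriv ?_
      simp only [id]
      ring
    have hroll : ∀ i : Fin m, ∃ t, x i.castSucc < t ∧ t < x i.succ ∧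
        ∑ j : Fin m, w j.succ * (y j.succ - y 0) * Real.exp ((y j.succ - y 0) * t) = 0 := by
      intro i
      obtain ⟨t, ht, h0⟩ := exists_hasDerivAt_eq_zero (hx (Fin.castSucc_lt_succ (i := i)))
        (fun t _ => (hgd t).continuousAt.continuousWithinAt) ((hgx _).trans (hgx _).symm)
        (fun t _ => hgd t)
      exact ⟨t, ht.1, ht.2, h0⟩
    choose t ht1 ht2 ht0 using hroll
    have htm : StrictMono t := by
      intro i j hij
      refine (ht2 i).trans_le (le_trans (hx.monotone ?_) (ht1 j).le)
      exact Fin.succ_le_castSucc_iff.2 hij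
    have hw := ih (fun j => y j.succ - y 0)
      (fun i j hij => Fin.succ_injective _ (hy (by simpa using hij)))
      (fun j => w j.succ * (y j.succ - y 0)) t htm ht0
    have hws : ∀ j : Fin m, w j.succ = 0 := fun j => by
      have h1 := congrFun hw j
      simp only [Pi.zero_apply, mul_eq_zero, sub_eq_zero] at h1
      exact h1.resolve_right fun h2 => (Fin.succ_ne_zero j) (hy h2)
    have hw0 : w 0 = 0 := by
      have := hgx 0
      simpa [hg, hws] using this
    ext j
    refine Fin.cases hw0 (fun j => hws j) j

lemma det_exp_ne_zero {m : ℕ} (x y : Fin m → ℝ) (hx : StrictMono x) (hy : StrictMono y) :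
    (Matrix.of fun i j => Real.exp (x i * y j)).det ≠ 0 := by
  intro h
  obtain ⟨w, hw, h0⟩ := Matrix.exists_mulVec_eq_zero_iff.2 h
  refine hw (eq_zero_of_exp_sum_eq_zero y hy.injective w x hx fun i => ?_)
  have := congrFun h0 i
  simp only [Matrix.mulVec, dotProduct, Matrix.of_apply, Pi.zero_apply] at this
  rw [← this]
  exact Finset.sum_congr rfl fun j _ => by rw [mul_comm (y j), mul_comm (w j)]

lemma strictMono_update_last {m : ℕ} {x : Fin (m + 1) → ℝ} (hx : StrictMono x) {t : ℝ}
    (ht : x (Fin.last m) ≤ t) : StrictMono (Function.update x (Fin.last m) t) := by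
  intro i j hij
  have hi : i ≠ Fin.last m := (hij.trans_le (Fin.le_last j)).ne
  rw [Function.update_of_ne hi]
  by_cases hj : j = Fin.last m
  · subst hj
    rw [Function.update_self]
    exact (hx hij).trans_le ht
  · rw [Function.update_of_ne hj]
    exact hx hij

/-- The exponential kernel is strictly totally positive. -/
theorem det_exp_pos {m : ℕ} (x y : Fin m → ℝ) (hx : StrictMono x) (hy : StrictMono y) :
    0 < (Matrix.of fun i j => Real.exp (x i * y j)).det := by
  induction m with
  | zero => simp
  | succ m ih =>
    set f : ℝ → ℝ := fun t =>
      (Matrix.of fun i j => Real.exp (Function.update x (Fin.last m) t i * y j)).det with hf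
    -- As a function of the last node `t`, the determinant is an exponential sum whose coefficients
    -- are the cofactors of the last row. The top cofactor is positive by induction and governs `t →
    -- ∞`; the sum has no zero for `t ≥ x (Fin.last m)`, so its sign at infinity persists down to
    -- that point.
    set μ : Fin (m + 1) → ℝ := fun j => (-1) ^ (m + j.val) *
      (Matrix.of fun (i l : Fin m) =>
        Real.exp (x i.castSucc * y (j.succAbove l))).det with hμ
    have hexp : ∀ t, f t = ∑ j, μ j * Real.exp (t * y j) := by
      intro t
      rw [hf]
      simp only
      rw [Matrix.det_succ_row _ (Fin.last m)]
      refine Finset.sum_congr rfl fun j _ => ?_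
      have : (Matrix.submatrix (Matrix.of fun i j =>
          Real.exp (Function.update x (Fin.last m) t i * y j)) (Fin.last m).succAbove j.succAbove)
          = Matrix.of fun (i l : Fin m) => Real.exp (x i.castSucc * y (j.succAbove l)) := by
        ext i l
        simp [Fin.castSucc_lt_last i |>.ne]
      rw [this, hμ]
      simp
      ring
    have hμl : 0 < μ (Fin.last m) := by
      have h1 := ih (fun i => x i.castSucc) (fun i => y i.castSucc)
        (fun i j hij => hx (by simpa using hij)) (fun i j hij => hy (by simpa using hij))
      have h2 : (-1 : ℝ) ^ (m + m) = 1 := Even.neg_one_pow ⟨m, rfl⟩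
      simpa [hμ, h2] using h1
    have hlim : Tendsto (fun t => f t * Real.exp (-(t * y (Fin.last m)))) atTop
        (𝓝 (μ (Fin.last m))) := by
      have h1 : ∀ t, f t * Real.exp (-(t * y (Fin.last m))) =
          ∑ j : Fin m, μ j.castSucc * Real.exp (t * (y j.castSucc - y (Fin.last m)))
            + μ (Fin.last m) := by
        intro t
        rw [hexp, Fin.sum_univ_castSucc, add_mul, Finset.sum_mul]
        congr 1
        · refine Finset.sum_congr rfl fun j _ => ?_
          rw [mul_assoc, ← Real.exp_add]
          congr 2
          ring
        · rw [mul_assoc, ← Real.exp_add, add_neg_cancel, Real.exp_zero, mul_one]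
      simp only [h1]
      have h2 : Tendsto (fun t : ℝ =>
          ∑ j : Fin m, μ j.castSucc * Real.exp (t * (y j.castSucc - y (Fin.last m)))) atTop
          (𝓝 (∑ j : Fin m, μ j.castSucc * 0)) := by
        refine tendsto_finsetSum _ fun j _ => Tendsto.const_mul _ ?_
        refine Real.tendsto_exp_atBot.comp ?_
        exact tendsto_id.atTop_mul_const_of_neg (sub_neg.2 (hy (Fin.castSucc_lt_last j)))
      simpa using h2.add_const (μ (Fin.last m))
    have hne : ∀ t, x (Fin.last m) ≤ t → f t ≠ 0 := fun t ht =>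
      det_exp_ne_zero _ y (strictMono_update_last hx ht) hy
    have hcont : Continuous f := by
      simp only [funext hexp]
      fun_prop
    obtain ⟨T, hT1, hT2⟩ := ((hlim.eventually (lt_mem_nhds hμl)).and
      (eventually_ge_atTop (x (Fin.last m)))).exists
    have hfT : 0 < f T := by
      rcases pos_and_pos_or_neg_and_neg_of_mul_pos hT1 with h | h
      · exact h.1
      · exact absurd h.2 (not_lt.2 (Real.exp_pos _).le)
    have hfx : 0 < f (x (Fin.last m)) := by
      by_contra hneg
      obtain ⟨s, hs, hs0⟩ := intermediate_value_Icc hT2 hcont.continuousOn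
        (show (0 : ℝ) ∈ Set.Icc (f (x (Fin.last m))) (f T) from ⟨not_lt.1 hneg, hfT.le⟩)
      exact hne s hs.1 hs0
    simpa [hf] using hfx

/-- The Vandermonde product in terms of the Vandermonde determinant. -/
lemma exists_vandermonde_eq (n : ℕ) : ∃ ε : ℝ, ε * ε = 1 ∧
    ∀ x : Fin n → ℝ, vandermonde x = ε * (Matrix.vandermonde x).det := by
  refine ⟨∏ i : Fin n, ∏ j ∈ Finset.Ioi i, (-1), ?_, fun x => ?_⟩
  · simp only [← Finset.prod_mul_distrib]
    simp
  · rw [Matrix.det_vandermonde, vandermonde]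
    simp only [← Finset.prod_mul_distrib]
    exact Finset.prod_congr rfl fun i _ => Finset.prod_congr rfl fun j _ => by ring

lemma exists_perm_strictMono {n : ℕ} {x : Fin n → ℝ} (hx : Function.Injective x) :
    ∃ σ : Equiv.Perm (Fin n), StrictMono (x ∘ σ) :=
  ⟨Tuple.sort x, (Tuple.monotone_sort x).strictMono_of_injective
    (hx.comp (Tuple.sort x).injective)⟩

lemma det_vandermonde_pos {n : ℕ} {x : Fin n → ℝ} (hx : StrictMono x) :
    0 < (Matrix.vandermonde x).det := by
  rw [Matrix.det_vandermonde]
  exact Finset.prod_pos fun i _ => Finset.prod_pos fun j hj => sub_pos.2 (hx (Finset.mem_Ioi.1 hj))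

lemma sign_mul_self (n : ℕ) (σ : Equiv.Perm (Fin n)) :
    ((Equiv.Perm.sign σ : ℤ) : ℝ) * ((Equiv.Perm.sign σ : ℤ) : ℝ) = 1 := by
  norm_cast
  simp

/-- Sorting `x` multiplies the kernel determinant and `vandermonde x` by the same sign, and likewise
for `y`. So both points may be taken increasing, where every factor is positive up to the common
sign `ε`, which occurs squared. -/
theorem det_exp_mul_vandermonde_pos {n : ℕ} {κ : ℝ} (hκ : 0 < κ) {x y : Fin n → ℝ}
    (hx : Function.Injective x) (hy : Function.Injective y) :
    0 < (Matrix.of fun i j => Real.exp (κ * (x i * y j))).det * vandermonde x * vandermonde y := by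
  obtain ⟨ε, hε, hv⟩ := exists_vandermonde_eq n
  obtain ⟨σ, hσ⟩ := exists_perm_strictMono hx
  obtain ⟨ρ, hρ⟩ := exists_perm_strictMono hy
  have h1 := det_exp_pos (x ∘ σ) (fun i => κ * (y ∘ ρ) i) hσ
    (fun i j hij => mul_lt_mul_of_pos_left (hρ hij) hκ)
  have h2 : (Matrix.of fun i j => Real.exp ((x ∘ σ) i * (κ * (y ∘ ρ) j))).det =
      ((Equiv.Perm.sign σ : ℤ) : ℝ) * (((Equiv.Perm.sign ρ : ℤ) : ℝ) *
        (Matrix.of fun i j => Real.exp (κ * (x i * y j))).det) := by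
    rw [← Matrix.det_permute', ← Matrix.det_permute]
    congr 1
    ext i j
    simp only [Matrix.submatrix_apply, Matrix.of_apply, Function.comp, id]
    ring_nf
  have h3 : ∀ (z : Fin n → ℝ) (τ : Equiv.Perm (Fin n)), (Matrix.vandermonde (z ∘ τ)).det =
      ((Equiv.Perm.sign τ : ℤ) : ℝ) * (Matrix.vandermonde z).det := fun z τ => by
    rw [← Matrix.det_permute]
    rfl
  have h4 := mul_pos (mul_pos h1 (det_vandermonde_pos hσ)) (det_vandermonde_pos hρ)
  rw [h2, h3, h3] at h4
  rw [hv, hv]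
  have hs := sign_mul_self n σ
  have hr := sign_mul_self n ρ
  refine lt_of_lt_of_eq h4 ?_
  linear_combination ((Matrix.of fun i j => Real.exp (κ * (x i * y j))).det *
    (Matrix.vandermonde x).det * (Matrix.vandermonde y).det) * (hs +
      ((Equiv.Perm.sign σ : ℤ) : ℝ) * ((Equiv.Perm.sign σ : ℤ) : ℝ) * hr - hε)

end TotalPositivity

/-! ### Integrals of products of Vandermonde determinants -/

section Andreief

open MeasureTheory

lemma det_vandermonde_eq_sum {n : ℕ} (x : Fin n → ℝ) : (Matrix.vandermonde x).det =
    ∑ σ : Equiv.Perm (Fin n), ((Equiv.Perm.sign σ : ℤ) : ℝ) * ∏ i, x i ^ (σ i).val := by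
  rw [← Matrix.det_transpose, Matrix.det_apply']
  rfl

lemma vandermonde_mul_vandermonde {n : ℕ} (x y : Fin n → ℝ) :
    vandermonde x * vandermonde y =
      (Matrix.vandermonde x).det * (Matrix.vandermonde y).det := by
  obtain ⟨ε, hε, hv⟩ := exists_vandermonde_eq n
  rw [hv, hv]
  linear_combination (Matrix.vandermonde x).det * (Matrix.vandermonde y).det * hε

lemma prod_weight_mul_vandermonde {n : ℕ} (w : ℝ → ℝ → ℝ) (x y : Fin n → ℝ) :
    (∏ i, w (x i) (y i)) * vandermonde x * vandermonde y =
      ∑ σ : Equiv.Perm (Fin n), ∑ ρ : Equiv.Perm (Fin n),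
        (((Equiv.Perm.sign σ : ℤ) : ℝ) * ((Equiv.Perm.sign ρ : ℤ) : ℝ)) *
          ∏ i, x i ^ (σ i).val * (y i ^ (ρ i).val * w (x i) (y i)) := by
  rw [mul_assoc, vandermonde_mul_vandermonde, det_vandermonde_eq_sum, det_vandermonde_eq_sum,
    Finset.sum_mul_sum, Finset.mul_sum]
  refine Finset.sum_congr rfl fun σ _ => ?_
  rw [Finset.mul_sum]
  refine Finset.sum_congr rfl fun ρ _ => ?_
  simp only [Finset.prod_mul_distrib]
  ring

/-- For each fixed `σ` the inner sum is the determinant with rows permuted by `σ`, and the remaining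
sign undoes the permutation. -/
lemma sum_sign_mul_prod {n : ℕ} (M : Matrix (Fin n) (Fin n) ℝ) :
    ∑ σ : Equiv.Perm (Fin n), ∑ ρ : Equiv.Perm (Fin n),
      (((Equiv.Perm.sign σ : ℤ) : ℝ) * ((Equiv.Perm.sign ρ : ℤ) : ℝ)) *
        ∏ i, M (σ i) (ρ i) = n ! * M.det := by
  have h : ∀ σ : Equiv.Perm (Fin n), ∑ ρ : Equiv.Perm (Fin n),
      (((Equiv.Perm.sign σ : ℤ) : ℝ) * ((Equiv.Perm.sign ρ : ℤ) : ℝ)) *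
        ∏ i, M (σ i) (ρ i) = M.det := fun σ => by
    have h1 := Matrix.det_permute σ M
    rw [← Matrix.det_transpose, Matrix.det_apply'] at h1
    simp only [mul_assoc]
    rw [← Finset.mul_sum]
    simp only [Matrix.transpose_apply, Matrix.submatrix_apply, id] at h1
    rw [h1, ← mul_assoc, sign_mul_self, one_mul]
  rw [Finset.sum_congr rfl fun σ _ => h σ]
  simp [Fintype.card_perm]

variable {n : ℕ} {μ ν : Measure ℝ} [SigmaFinite μ] [SigmaFinite ν] {w : ℝ → ℝ → ℝ}

lemma integrable_prod_weight_mul_vandermonde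
    (h₁ : ∀ x j, Integrable (fun y => y ^ j * w x y) ν) (x : Fin n → ℝ) :
    Integrable (fun y : Fin n → ℝ => (∏ i, w (x i) (y i)) * vandermonde x * vandermonde y)
      (Measure.pi fun _ => ν) := by
  simp only [prod_weight_mul_vandermonde]
  refine integrable_finsetSum _ fun σ _ => integrable_finsetSum _ fun ρ _ =>
    Integrable.const_mul ?_ _
  exact Integrable.fintype_prod (f := fun i y => x i ^ (σ i).val * (y ^ (ρ i).val * w (x i) y))
    fun i => (h₁ (x i) _).const_mul _

lemma integral_prod_weight_mul_vandermonde
    (h₁ : ∀ x j, Integrable (fun y => y ^ j * w x y) ν) (x : Fin n → ℝ) :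
    ∫ y : Fin n → ℝ, (∏ i, w (x i) (y i)) * vandermonde x * vandermonde y
      ∂(Measure.pi fun _ => ν) =
      ∑ σ : Equiv.Perm (Fin n), ∑ ρ : Equiv.Perm (Fin n),
        (((Equiv.Perm.sign σ : ℤ) : ℝ) * ((Equiv.Perm.sign ρ : ℤ) : ℝ)) *
          ∏ i, ∫ y, x i ^ (σ i).val * (y ^ (ρ i).val * w (x i) y) ∂ν := by
  have h : ∀ σ ρ : Equiv.Perm (Fin n), Integrable (fun y : Fin n → ℝ =>
      (((Equiv.Perm.sign σ : ℤ) : ℝ) * ((Equiv.Perm.sign ρ : ℤ) : ℝ)) *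
        ∏ i, x i ^ (σ i).val * (y i ^ (ρ i).val * w (x i) (y i))) (Measure.pi fun _ => ν) :=
    fun σ ρ => Integrable.const_mul (Integrable.fintype_prod
      (f := fun i y => x i ^ (σ i).val * (y ^ (ρ i).val * w (x i) y))
      fun i => (h₁ (x i) _).const_mul _) _
  simp only [prod_weight_mul_vandermonde]
  rw [integral_finsetSum _ fun σ _ => integrable_finsetSum _ fun ρ _ => h σ ρ]
  refine Finset.sum_congr rfl fun σ _ => ?_
  rw [integral_finsetSum _ fun ρ _ => h σ ρ]
  refine Finset.sum_congr rfl fun ρ _ => ?_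
  rw [integral_const_mul, integral_fintype_prod_eq_prod
    (f := fun i y => x i ^ (σ i).val * (y ^ (ρ i).val * w (x i) y))]

lemma integrable_integral_prod_weight
    (h₁ : ∀ x j, Integrable (fun y => y ^ j * w x y) ν)
    (h₂ : ∀ i j : ℕ, Integrable (fun x => ∫ y, x ^ i * (y ^ j * w x y) ∂ν) μ) :
    Integrable (fun x : Fin n → ℝ => ∫ y : Fin n → ℝ,
      (∏ i, w (x i) (y i)) * vandermonde x * vandermonde y ∂(Measure.pi fun _ => ν))
      (Measure.pi fun _ => μ) := by
  simp only [integral_prod_weight_mul_vandermonde h₁]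
  refine integrable_finsetSum _ fun σ _ => integrable_finsetSum _ fun ρ _ =>
    Integrable.const_mul ?_ _
  exact Integrable.fintype_prod
    (f := fun i x => ∫ y, x ^ (σ i).val * (y ^ (ρ i).val * w x y) ∂ν) fun i => h₂ _ _

/-- Andréief's identity: the integral of two Vandermonde products against a product weight is a
determinant of moments. -/
theorem integral_integral_prod_weight
    (h₁ : ∀ x j, Integrable (fun y => y ^ j * w x y) ν)
    (h₂ : ∀ i j : ℕ, Integrable (fun x => ∫ y, x ^ i * (y ^ j * w x y) ∂ν) μ) :
    ∫ x : Fin n → ℝ, ∫ y : Fin n → ℝ, (∏ i, w (x i) (y i)) * vandermonde x * vandermonde y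
      ∂(Measure.pi fun _ => ν) ∂(Measure.pi fun _ => μ) =
      n ! * leadingMinor (fun i j => ∫ x, ∫ y, x ^ i * (y ^ j * w x y) ∂ν ∂μ) n := by
  have h : ∀ σ ρ : Equiv.Perm (Fin n), Integrable (fun x : Fin n → ℝ =>
      (((Equiv.Perm.sign σ : ℤ) : ℝ) * ((Equiv.Perm.sign ρ : ℤ) : ℝ)) *
        ∏ i, ∫ y, x i ^ (σ i).val * (y ^ (ρ i).val * w (x i) y) ∂ν) (Measure.pi fun _ => μ) :=
    fun σ ρ => Integrable.const_mul (Integrable.fintype_prod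
      (f := fun i x => ∫ y, x ^ (σ i).val * (y ^ (ρ i).val * w x y) ∂ν) fun i => h₂ _ _) _
  simp only [integral_prod_weight_mul_vandermonde h₁]
  rw [integral_finsetSum _ fun σ _ => integrable_finsetSum _ fun ρ _ => h σ ρ, leadingMinor,
    minor, ← sum_sign_mul_prod]
  refine Finset.sum_congr rfl fun σ _ => ?_
  rw [integral_finsetSum _ fun ρ _ => h σ ρ]
  refine Finset.sum_congr rfl fun ρ _ => ?_
  rw [integral_const_mul, integral_fintype_prod_eq_prod
    (f := fun i x => ∫ y, x ^ (σ i).val * (y ^ (ρ i).val * w x y) ∂ν)]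
  rfl

lemma vandermonde_comp_perm (y : Fin n → ℝ) (σ : Equiv.Perm (Fin n)) :
    vandermonde (y ∘ σ) = ((Equiv.Perm.sign σ : ℤ) : ℝ) * vandermonde y := by
  obtain ⟨ε, -, hv⟩ := exists_vandermonde_eq n
  rw [hv, hv, mul_left_comm, ← Matrix.det_permute]
  rfl

lemma vandermonde_eq_zero {y : Fin n → ℝ} (hy : ¬ Function.Injective y) : vandermonde y = 0 := by
  obtain ⟨ε, -, hv⟩ := exists_vandermonde_eq n
  rw [hv, not_not.1 (mt Matrix.det_vandermonde_ne_zero_iff.1 hy), mul_zero]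

lemma measurePreserving_comp_perm (σ : Equiv.Perm (Fin n)) :
    MeasurePreserving (MeasurableEquiv.piCongrLeft (fun _ => ℝ) σ.symm)
      (Measure.pi fun _ => ν) (Measure.pi fun _ => ν) :=
  measurePreserving_piCongrLeft (fun _ => ν) σ.symm

lemma piCongrLeft_symm_apply (σ : Equiv.Perm (Fin n)) (y : Fin n → ℝ) :
    MeasurableEquiv.piCongrLeft (fun _ => ℝ) σ.symm y = y ∘ σ := by
  ext i
  obtain ⟨j, rfl⟩ := σ.symm.surjective i
  rw [MeasurableEquiv.coe_piCongrLeft, Equiv.piCongrLeft_apply_apply]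
  simp

lemma isOpen_setOf_injective : IsOpen {y : Fin n → ℝ | Function.Injective y} := by
  have : {y : Fin n → ℝ | Function.Injective y} = ⋂ i, ⋂ j, {y | y i = y j → i = j} := by
    ext y
    simp [Function.Injective]
  rw [this]
  refine isOpen_iInter_of_finite fun i => isOpen_iInter_of_finite fun j => ?_
  by_cases h : i = j
  · simp [h]
  · simp only [h, imp_false]
    exact isOpen_ne_fun (continuous_apply i) (continuous_apply j)

/-- The set contains a nonempty open one: an open subset of the line with a point is infinite, so it
supplies `n` distinct coordinates. -/
lemma pi_restrict_setOf_injective_pos {J : Set ℝ} (hJ : (interior J).Nonempty) :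
    0 < (Measure.pi fun _ : Fin n => (volume : Measure ℝ).restrict J)
      {y : Fin n → ℝ | Function.Injective y} := by
  rw [← Measure.restrict_pi_pi, Measure.restrict_apply isOpen_setOf_injective.measurableSet]
  have hinf : (interior J).Infinite := by
    obtain ⟨x, hx⟩ := hJ
    exact infinite_of_mem_nhds x (isOpen_interior.mem_nhds hx)
  have hopen : IsOpen ({y : Fin n → ℝ | Function.Injective y} ∩
      Set.univ.pi fun _ => interior J) :=
    isOpen_setOf_injective.inter (isOpen_set_pi Set.finite_univ fun _ _ => isOpen_interior)
  have hne : ({y : Fin n → ℝ | Function.Injective y} ∩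
      Set.univ.pi fun _ => interior J).Nonempty := by
    refine ⟨fun i => (hinf.natEmbedding _ i.val : ℝ), fun i j hij => ?_, fun i _ => ?_⟩
    · exact Fin.ext ((hinf.natEmbedding _).injective (Subtype.ext hij))
    · exact (hinf.natEmbedding _ i.val).2
  refine (hopen.measure_pos volume hne).trans_le (measure_mono ?_)
  exact Set.inter_subset_inter_right _ (Set.pi_mono fun _ _ => interior_subset)

/-- The integrand itself has no definite sign. Its sum over permutations of `y` does, since the
signs from `vandermonde (y ∘ σ)` assemble the exponentials into a determinant. -/
lemma prod_weight_symm {p q : ℝ → ℝ} {κ : ℝ} (x y : Fin n → ℝ) :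
    ∑ σ : Equiv.Perm (Fin n), (∏ i, p (x i) * q ((y ∘ σ) i) *
        Real.exp (κ * (x i * (y ∘ σ) i))) * vandermonde x * vandermonde (y ∘ σ) =
      (∏ i, p (x i)) * (∏ i, q (y i)) *
        ((Matrix.of fun i j => Real.exp (κ * (x i * y j))).det * vandermonde x *
          vandermonde y) := by
  rw [← Matrix.det_transpose, Matrix.det_apply', Finset.sum_mul, Finset.sum_mul, Finset.mul_sum]
  refine Finset.sum_congr rfl fun σ _ => ?_
  have hq : ∏ i, q (y i) = ∏ i, q ((y ∘ σ) i) := (Equiv.prod_comp σ fun i => q (y i)).symm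
  rw [vandermonde_comp_perm, hq]
  simp only [Finset.prod_mul_distrib, Matrix.transpose_apply, Matrix.of_apply, Function.comp]
  ring

/-- The eigenvalue integral of two coupled positive weights is positive. -/
theorem integral_vandermonde_pos {J₁ J₂ : Set ℝ} (hJ₁ : (interior J₁).Nonempty)
    (hJ₂ : (interior J₂).Nonempty) {p q : ℝ → ℝ} (hp : ∀ x, 0 < p x) (hq : ∀ y, 0 < q y)
    {κ : ℝ} (hκ : 0 < κ) (hw : ∀ x y, w x y = p x * q y * Real.exp (κ * (x * y)))
    (h₁ : ∀ x j, Integrable (fun y => y ^ j * w x y) ((volume : Measure ℝ).restrict J₂))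
    (h₂ : ∀ i j : ℕ, Integrable (fun x => ∫ y, x ^ i * (y ^ j * w x y)
      ∂((volume : Measure ℝ).restrict J₂)) ((volume : Measure ℝ).restrict J₁)) :
    0 < ∫ x : Fin n → ℝ, ∫ y : Fin n → ℝ,
      (∏ i, w (x i) (y i)) * vandermonde x * vandermonde y
        ∂(Measure.pi fun _ => (volume : Measure ℝ).restrict J₂)
        ∂(Measure.pi fun _ => (volume : Measure ℝ).restrict J₁) := by
  set ν : Measure ℝ := volume.restrict J₂
  set G : (Fin n → ℝ) → (Fin n → ℝ) → ℝ := fun x y =>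
    (∏ i, w (x i) (y i)) * vandermonde x * vandermonde y with hG
  set h : (Fin n → ℝ) → ℝ := fun x => ∫ y, G x y ∂(Measure.pi fun _ => ν) with hh
  have hsum : ∀ x y, ∑ σ : Equiv.Perm (Fin n), G x (y ∘ σ) = (∏ i, p (x i)) * (∏ i, q (y i)) *
      ((Matrix.of fun i j => Real.exp (κ * (x i * y j))).det * vandermonde x *
        vandermonde y) := fun x y => by
    rw [← prod_weight_symm]
    simp only [hG, hw]
  have hint : ∀ x, Integrable (G x) (Measure.pi fun _ => ν) :=
    integrable_prod_weight_mul_vandermonde h₁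
  have hintσ : ∀ x (σ : Equiv.Perm (Fin n)),
      Integrable (fun y => G x (y ∘ σ)) (Measure.pi fun _ => ν) := fun x σ => by
    have := (measurePreserving_comp_perm (ν := ν) σ).integrable_comp_of_integrable (hint x)
    simpa only [Function.comp_def, piCongrLeft_symm_apply] using this
  have hsymm : ∀ x, (n ! : ℝ) * h x =
      ∫ y, ∑ σ : Equiv.Perm (Fin n), G x (y ∘ σ) ∂(Measure.pi fun _ => ν) := fun x => by
    rw [integral_finsetSum _ fun σ _ => hintσ x σ]
    have : ∀ σ : Equiv.Perm (Fin n), ∫ y, G x (y ∘ σ) ∂(Measure.pi fun _ => ν) = h x := fun σ => by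
      have := (measurePreserving_comp_perm (ν := ν) σ).integral_comp' (G x)
      simpa only [piCongrLeft_symm_apply] using this
    simp [this, Fintype.card_perm]
  have hpos : ∀ x y, Function.Injective x → Function.Injective y →
      0 < ∑ σ : Equiv.Perm (Fin n), G x (y ∘ σ) := fun x y hx hy => by
    rw [hsum]
    exact mul_pos (mul_pos (Finset.prod_pos fun i _ => hp _) (Finset.prod_pos fun i _ => hq _))
      (det_exp_mul_vandermonde_pos hκ hx hy)
  have hzero : ∀ x y, ¬ (Function.Injective x ∧ Function.Injective y) →
      ∑ σ : Equiv.Perm (Fin n), G x (y ∘ σ) = 0 := fun x y hxy => by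
    rw [hsum]
    rcases not_and_or.1 hxy with hx | hy
    · simp [vandermonde_eq_zero hx]
    · simp [vandermonde_eq_zero hy]
  have hnn : ∀ x y, 0 ≤ ∑ σ : Equiv.Perm (Fin n), G x (y ∘ σ) := fun x y => by
    by_cases hxy : Function.Injective x ∧ Function.Injective y
    · exact (hpos x y hxy.1 hxy.2).le
    · exact (hzero x y hxy).ge
  have hfac : (0 : ℝ) < n ! := by exact_mod_cast Nat.factorial_pos n
  -- By `hsymm`, `n ! * h x` is the integral of the symmetrized integrand, which is nonnegative
  -- everywhere and positive on a set of positive measure.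
  have hhpos : ∀ x, Function.Injective x → 0 < h x := fun x hx => by
    refine pos_of_mul_pos_right (a := (n ! : ℝ)) ?_ hfac.le
    rw [hsymm, integral_pos_iff_support_of_nonneg (fun y => hnn x y)
      (integrable_finsetSum _ fun σ _ => hintσ x σ)]
    exact (pi_restrict_setOf_injective_pos hJ₂).trans_le
      (measure_mono fun y hy => (hpos x y hx hy).ne')
  have hhnn : ∀ x, 0 ≤ h x := fun x => by
    refine nonneg_of_mul_nonneg_right (a := (n ! : ℝ)) ?_ hfac
    rw [hsymm]
    exact integral_nonneg fun y => hnn x y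
  rw [integral_pos_iff_support_of_nonneg hhnn (integrable_integral_prod_weight h₁ h₂)]
  exact (pi_restrict_setOf_injective_pos hJ₁).trans_le (measure_mono fun x hx => (hhpos x hx).ne')

end Andreief

/-! ### Gaussian moments over quadrants, half planes and the plane -/

section Gaussian

open MeasureTheory Set

/-- The integrand of the Gaussian moments in the variables of the Dyson process. -/
def gaussTerm (i j : ℕ) (c x y : ℝ) : ℝ :=
  x ^ i * y ^ j * Real.exp (-((x ^ 2 + y ^ 2 - 2 * c * (x * y)) / (1 - c ^ 2)))

/-- Uniform Gaussian domination for `c` in `S`. -/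
def GaussDominated (S : Set ℝ) (f : ℝ → ℝ → ℝ → ℝ) : Prop :=
  ∃ C, ∀ c ∈ S, ∀ x y, |f c x y| ≤ C * Real.exp (-((x ^ 2 + y ^ 2) / 4))

lemma GaussDominated.add {S : Set ℝ} {f g : ℝ → ℝ → ℝ → ℝ} (hf : GaussDominated S f)
    (hg : GaussDominated S g) : GaussDominated S fun c x y => f c x y + g c x y := by
  obtain ⟨C, hC⟩ := hf
  obtain ⟨K, hK⟩ := hg
  refine ⟨C + K, fun c hc x y => (abs_add_le _ _).trans ?_⟩
  rw [add_mul]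
  exact add_le_add (hC c hc x y) (hK c hc x y)

lemma GaussDominated.mul_left {S : Set ℝ} {f : ℝ → ℝ → ℝ → ℝ} (hf : GaussDominated S f)
    {k : ℝ → ℝ} {K : ℝ} (hk : ∀ c ∈ S, |k c| ≤ K) :
    GaussDominated S fun c x y => k c * f c x y := by
  obtain ⟨C, hC⟩ := hf
  refine ⟨K * C, fun c hc x y => ?_⟩
  rw [abs_mul, mul_assoc]
  exact mul_le_mul (hk c hc) (hC c hc x y) (abs_nonneg _) ((abs_nonneg _).trans (hk c hc))

lemma GaussDominated.sub {S : Set ℝ} {f g : ℝ → ℝ → ℝ → ℝ} (hf : GaussDominated S f)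
    (hg : GaussDominated S g) : GaussDominated S fun c x y => f c x y - g c x y := by
  have := hf.add (hg.mul_left (k := fun _ => -1) (K := 1) (by simp))
  simpa [sub_eq_add_neg] using this

/-- The power is absorbed by `|x| ^ i ≤ i ! * exp |x|`, and completing the square bounds `|x| - δ
x²` by `1 / (4δ)`. -/
lemma pow_mul_exp_neg_le (i : ℕ) {δ : ℝ} (hδ : 0 < δ) (x : ℝ) :
    |x| ^ i * Real.exp (-(δ * x ^ 2)) ≤ i ! * Real.exp (1 / (4 * δ)) := by
  have h1 : |x| ^ i ≤ i ! * Real.exp |x| := by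
    have := Real.pow_div_factorial_le_exp |x| (abs_nonneg x) i
    rwa [div_le_iff₀' (by positivity)] at this
  calc |x| ^ i * Real.exp (-(δ * x ^ 2))
      ≤ i ! * Real.exp |x| * Real.exp (-(δ * x ^ 2)) := by gcongr
    _ = i ! * Real.exp (|x| - δ * x ^ 2) := by rw [mul_assoc, ← Real.exp_add]; ring_nf
    _ ≤ i ! * Real.exp (1 / (4 * δ)) := by
      gcongr
      rw [← sq_abs x, le_div_iff₀ (by positivity)]
      nlinarith [sq_nonneg (2 * δ * |x| - 1)]

/-- One half of the Gaussian decay pays for the monomial; the other half remains. -/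
lemma pow_mul_pow_mul_exp_neg_le (i j : ℕ) {δ : ℝ} (hδ : 0 < δ) (x y : ℝ) {Q : ℝ}
    (hQ : 2 * δ * (x ^ 2 + y ^ 2) ≤ Q) :
    |x ^ i * y ^ j * Real.exp (-Q)| ≤ (i ! * Real.exp (1 / (4 * δ))) *
      (j ! * Real.exp (1 / (4 * δ))) * Real.exp (-(δ * (x ^ 2 + y ^ 2))) := by
  rw [abs_mul, abs_mul, Real.abs_exp, abs_pow, abs_pow]
  calc |x| ^ i * |y| ^ j * Real.exp (-Q)
      ≤ |x| ^ i * |y| ^ j * Real.exp (-(2 * δ * (x ^ 2 + y ^ 2))) := by gcongr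
    _ = (|x| ^ i * Real.exp (-(δ * x ^ 2))) * (|y| ^ j * Real.exp (-(δ * y ^ 2))) *
        Real.exp (-(δ * (x ^ 2 + y ^ 2))) := by
      have : Real.exp (-(2 * δ * (x ^ 2 + y ^ 2))) = Real.exp (-(δ * x ^ 2)) *
          Real.exp (-(δ * y ^ 2)) * Real.exp (-(δ * (x ^ 2 + y ^ 2))) := by
        rw [← Real.exp_add, ← Real.exp_add]
        ring_nf
      rw [this]
      ring
    _ ≤ _ := mul_le_mul_of_nonneg_right (mul_le_mul (pow_mul_exp_neg_le i hδ x)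
        (pow_mul_exp_neg_le j hδ y) (by positivity) (by positivity)) (Real.exp_pos _).le

/-- The form has eigenvalues `1 / (1 + c)` and `1 / (1 - c)`, both at least `1 / 2`, uniformly in
`c`. The constant is written `2 * (1 / 4)` to leave decay `1 / 4` after the monomial is absorbed. -/
lemma quadForm_ge {c : ℝ} (hc : c ∈ Ioo (0 : ℝ) 1) (x y : ℝ) :
    2 * (1 / 4) * (x ^ 2 + y ^ 2) ≤ (x ^ 2 + y ^ 2 - 2 * c * (x * y)) / (1 - c ^ 2) := by
  obtain ⟨h0, h1⟩ := hc
  have : 0 < 1 - c ^ 2 := by nlinarith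
  rw [le_div_iff₀ this]
  nlinarith [mul_nonneg h0.le (sq_nonneg (x - y)), mul_nonneg (sq_nonneg (1 - c)) (sq_nonneg x),
    mul_nonneg (sq_nonneg (1 - c)) (sq_nonneg y)]

lemma gaussDominated_gaussTerm {S : Set ℝ} (hS : S ⊆ Ioo 0 1) (i j : ℕ) :
    GaussDominated S (gaussTerm i j) := by
  refine ⟨(i ! * Real.exp (1 / (4 * (1 / 4)))) * (j ! * Real.exp (1 / (4 * (1 / 4)))),
    fun c hc x y => ?_⟩
  rw [div_eq_inv_mul (x ^ 2 + y ^ 2), ← one_div]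
  exact pow_mul_pow_mul_exp_neg_le i j (by norm_num) x y (quadForm_ge (hS hc) x y)

/-- `∂/∂x` of `gaussTerm`. -/
def gaussTermX (i j : ℕ) (c x y : ℝ) : ℝ :=
  i * gaussTerm (i - 1) j c x y
    - 2 / (1 - c ^ 2) * (gaussTerm (i + 1) j c x y - c * gaussTerm i (j + 1) c x y)

/-- `∂/∂y` of `gaussTerm`. -/
def gaussTermY (i j : ℕ) (c x y : ℝ) : ℝ :=
  j * gaussTerm i (j - 1) c x y
    - 2 / (1 - c ^ 2) * (gaussTerm i (j + 1) c x y - c * gaussTerm (i + 1) j c x y)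

/-- `∂/∂c` of `gaussTerm`. -/
def gaussTermC (i j : ℕ) (c x y : ℝ) : ℝ :=
  2 / (1 - c ^ 2) * gaussTerm (i + 1) (j + 1) c x y
    - 2 * c / (1 - c ^ 2) ^ 2 * (gaussTerm (i + 2) j c x y + gaussTerm i (j + 2) c x y
      - 2 * c * gaussTerm (i + 1) (j + 1) c x y)

lemma abs_two_div_le {c c₁ : ℝ} (hc₁ : c₁ < 1) (hc : c ∈ Ioo 0 c₁) :
    |2 / (1 - c ^ 2)| ≤ 2 / (1 - c₁) := by
  obtain ⟨h0, h1⟩ := hc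
  have h2 : 0 < 1 - c₁ := by linarith
  have h3 : 1 - c₁ ≤ 1 - c ^ 2 := by nlinarith
  rw [abs_of_nonneg (div_nonneg (by norm_num) (h2.le.trans h3))]
  gcongr

lemma abs_two_mul_div_sq_le {c c₁ : ℝ} (hc₁ : c₁ < 1) (hc : c ∈ Ioo 0 c₁) :
    |2 * c / (1 - c ^ 2) ^ 2| ≤ 2 / (1 - c₁) ^ 2 := by
  obtain ⟨h0, h1⟩ := hc
  have h2 : 0 < 1 - c₁ := by linarith
  have h3 : 1 - c₁ ≤ 1 - c ^ 2 := by nlinarith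
  rw [abs_of_nonneg (by positivity)]
  have : 2 * c ≤ 2 := by linarith
  gcongr

lemma gaussDominated_gaussTermX {c₁ : ℝ} (hc₁ : c₁ < 1) (i j : ℕ) :
    GaussDominated (Ioo 0 c₁) (gaussTermX i j) := by
  have hS : Ioo 0 c₁ ⊆ Ioo 0 1 := Ioo_subset_Ioo_right hc₁.le
  have hg := gaussDominated_gaussTerm hS
  refine ((hg _ _).mul_left (k := fun _ => (i : ℝ)) fun c _ => le_rfl).sub
    ((((hg _ _)).sub ((hg _ _).mul_left (k := fun c => c) (K := 1) ?_)).mul_left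
      fun c hc => abs_two_div_le hc₁ hc)
  intro c hc
  rw [abs_of_pos hc.1]
  exact (hS hc).2.le

lemma gaussTerm_swap (i j : ℕ) (c x y : ℝ) : gaussTerm i j c x y = gaussTerm j i c y x := by
  simp only [gaussTerm]
  ring_nf

lemma gaussTermY_eq (i j : ℕ) (c x y : ℝ) : gaussTermY i j c x y = gaussTermX j i c y x := by
  simp only [gaussTermX, gaussTermY, gaussTerm_swap _ _ c y x]

lemma gaussDominated_gaussTermY {c₁ : ℝ} (hc₁ : c₁ < 1) (i j : ℕ) :
    GaussDominated (Ioo 0 c₁) (gaussTermY i j) := by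
  obtain ⟨C, hC⟩ := gaussDominated_gaussTermX hc₁ j i
  refine ⟨C, fun c hc x y => ?_⟩
  rw [gaussTermY_eq, add_comm]
  exact hC c hc y x

lemma gaussDominated_gaussTermC {c₁ : ℝ} (hc₁ : c₁ < 1) (i j : ℕ) :
    GaussDominated (Ioo 0 c₁) (gaussTermC i j) := by
  have hS : Ioo 0 c₁ ⊆ Ioo 0 1 := Ioo_subset_Ioo_right hc₁.le
  have hg := gaussDominated_gaussTerm hS
  refine ((hg _ _).mul_left fun c hc => abs_two_div_le hc₁ hc).sub
    ((((hg _ _).add (hg _ _)).sub ((hg _ _).mul_left (k := fun c => 2 * c) (K := 2) ?_)).mul_left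
      fun c hc => abs_two_mul_div_sq_le hc₁ hc)
  intro c hc
  rw [abs_of_pos (by linarith [hc.1])]
  linarith [(hS hc).2]

/-- From `(u + s)² ≥ u² / 2 - s²`: a bounded shift costs a constant and half of the decay. This
gives one integrable bound for all shifts up to `R`. -/
lemma exp_shift_le {R s t : ℝ} (hs : |s| ≤ R) (ht : |t| ≤ R) (u v : ℝ) :
    Real.exp (-(((u + s) ^ 2 + (v + t) ^ 2) / 4)) ≤
      Real.exp (R ^ 2 / 2) * (Real.exp (-(1 / 8) * u ^ 2) * Real.exp (-(1 / 8) * v ^ 2)) := by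
  rw [← Real.exp_add, ← Real.exp_add]
  gcongr
  have h1 : s ^ 2 ≤ R ^ 2 := by rw [← sq_abs s]; gcongr
  have h2 : t ^ 2 ≤ R ^ 2 := by rw [← sq_abs t]; gcongr
  nlinarith [sq_nonneg (u + 2 * s), sq_nonneg (v + 2 * t)]

lemma integrable_exp_prod : Integrable fun w : ℝ × ℝ =>
    Real.exp (-(1 / 8) * w.1 ^ 2) * Real.exp (-(1 / 8) * w.2 ^ 2) :=
  Integrable.mul_prod (integrable_exp_neg_mul_sq (by norm_num))
    (integrable_exp_neg_mul_sq (by norm_num))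

lemma GaussDominated.integrable {S : Set ℝ} {f : ℝ → ℝ → ℝ → ℝ} (hf : GaussDominated S f)
    {c : ℝ} (hc : c ∈ S) (hm : Continuous fun w : ℝ × ℝ => f c w.1 w.2) (s t : ℝ) :
    Integrable fun w : ℝ × ℝ => f c (w.1 + s) (w.2 + t) := by
  obtain ⟨C, hC⟩ := hf
  have hC0 : 0 ≤ C := by
    have := (abs_nonneg _).trans (hC c hc 0 0)
    simpa using this
  have hcont : Continuous fun w : ℝ × ℝ => f c (w.1 + s) (w.2 + t) :=
    hm.comp (f := fun w : ℝ × ℝ => (w.1 + s, w.2 + t)) (by fun_prop)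
  refine ((integrable_exp_prod.const_mul (Real.exp (max |s| |t| ^ 2 / 2))).const_mul C).mono'
    hcont.aestronglyMeasurable (Filter.Eventually.of_forall fun w => ?_)
  exact (hC c hc _ _).trans (mul_le_mul_of_nonneg_left
    (exp_shift_le (le_max_left _ _) (le_max_right _ _) _ _) hC0)

lemma GaussDominated.integrable_fst {S : Set ℝ} {f : ℝ → ℝ → ℝ → ℝ} (hf : GaussDominated S f)
    {c : ℝ} (hc : c ∈ S) (hm : Continuous fun w : ℝ × ℝ => f c w.1 w.2) (s y : ℝ) :
    Integrable fun u : ℝ => f c (u + s) y := by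
  obtain ⟨C, hC⟩ := hf
  have hC0 : 0 ≤ C := by
    have := (abs_nonneg _).trans (hC c hc 0 0)
    simpa using this
  have hcont : Continuous fun u : ℝ => f c (u + s) y :=
    hm.comp (f := fun u : ℝ => (u + s, y)) (by fun_prop)
  refine (((integrable_exp_neg_mul_sq (by norm_num : (0 : ℝ) < 1 / 8)).const_mul
    (Real.exp (max |s| |y| ^ 2 / 2))).const_mul C).mono'
    hcont.aestronglyMeasurable (Filter.Eventually.of_forall fun u => ?_)
  refine (hC c hc _ _).trans (mul_le_mul_of_nonneg_left ?_ hC0)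
  have := exp_shift_le (le_max_left |s| |y|) (le_max_right _ _) u 0
  simpa using this

lemma continuous_gaussTerm (i j : ℕ) (c : ℝ) :
    Continuous fun w : ℝ × ℝ => gaussTerm i j c w.1 w.2 := by
  unfold gaussTerm
  fun_prop

lemma continuous_gaussTermX (i j : ℕ) (c : ℝ) :
    Continuous fun w : ℝ × ℝ => gaussTermX i j c w.1 w.2 := by
  unfold gaussTermX gaussTerm
  fun_prop

lemma continuous_gaussTermY (i j : ℕ) (c : ℝ) :
    Continuous fun w : ℝ × ℝ => gaussTermY i j c w.1 w.2 := by
  unfold gaussTermY gaussTerm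
  fun_prop

lemma continuous_gaussTermC (i j : ℕ) (c : ℝ) :
    Continuous fun w : ℝ × ℝ => gaussTermC i j c w.1 w.2 := by
  unfold gaussTermC gaussTerm
  fun_prop

/-- The projections of `(c, s, t)`. -/
abbrev projC : ℝ × ℝ × ℝ →L[ℝ] ℝ := ContinuousLinearMap.fst ℝ ℝ (ℝ × ℝ)
/-- The projection to the second of three variables. -/
abbrev projS : ℝ × ℝ × ℝ →L[ℝ] ℝ :=
  (ContinuousLinearMap.fst ℝ ℝ ℝ).comp (ContinuousLinearMap.snd ℝ ℝ (ℝ × ℝ))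
/-- The projection to the third of three variables. -/
abbrev projT : ℝ × ℝ × ℝ →L[ℝ] ℝ :=
  (ContinuousLinearMap.snd ℝ ℝ ℝ).comp (ContinuousLinearMap.snd ℝ ℝ (ℝ × ℝ))

/-- The derivative of the shifted `gaussTerm` in `(c, s, t)`. -/
def gaussDeriv (i j : ℕ) (θ : ℝ × ℝ × ℝ) (w : ℝ × ℝ) : ℝ × ℝ × ℝ →L[ℝ] ℝ :=
  gaussTermC i j θ.1 (w.1 + θ.2.1) (w.2 + θ.2.2) • projC
    + gaussTermX i j θ.1 (w.1 + θ.2.1) (w.2 + θ.2.2) • projS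
    + gaussTermY i j θ.1 (w.1 + θ.2.1) (w.2 + θ.2.2) • projT

lemma hasFDerivAt_gaussTerm (i j : ℕ) {θ : ℝ × ℝ × ℝ} (hθ : θ.1 ∈ Ioo (0 : ℝ) 1) (w : ℝ × ℝ) :
    HasFDerivAt (fun θ : ℝ × ℝ × ℝ => gaussTerm i j θ.1 (w.1 + θ.2.1) (w.2 + θ.2.2))
      (gaussDeriv i j θ w) θ := by
  have hc : HasFDerivAt (fun θ : ℝ × ℝ × ℝ => θ.1) projC θ := projC.hasFDerivAt
  have hs : HasFDerivAt (fun θ : ℝ × ℝ × ℝ => w.1 + θ.2.1) projS θ :=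
    projS.hasFDerivAt.const_add _
  have ht : HasFDerivAt (fun θ : ℝ × ℝ × ℝ => w.2 + θ.2.2) projT θ :=
    projT.hasFDerivAt.const_add _
  have hne : 1 - θ.1 ^ 2 ≠ 0 := by nlinarith [hθ.1, hθ.2]
  have hden : HasFDerivAt (fun θ : ℝ × ℝ × ℝ => 1 - θ.1 ^ 2) _ θ := (hc.pow 2).const_sub 1
  have hnum : HasFDerivAt (fun θ : ℝ × ℝ × ℝ => (w.1 + θ.2.1) ^ 2 + (w.2 + θ.2.2) ^ 2
      - 2 * θ.1 * ((w.1 + θ.2.1) * (w.2 + θ.2.2))) _ θ :=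
    ((hs.pow 2).add (ht.pow 2)).sub ((hc.const_mul 2).mul (hs.mul ht))
  have h := ((hs.pow i).mul (ht.pow j)).mul
    (((hnum.mul ((hasDerivAt_inv hne).comp_hasFDerivAt θ hden)).neg).exp)
  refine h.congr_fderiv ?_
  ext
  all_goals
    simp [gaussDeriv, gaussTermC, gaussTermX, gaussTermY, gaussTerm]
    field_simp
    ring

end Gaussian

/-! ### Smoothness of the Gaussian moments and their boundary terms -/

section GaussianMoments

open MeasureTheory Set

/-- The Gaussian moment over the translate of `D × D'` by `(s, t)`, with `θ = (c, s, t)`. -/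
def gaussMoment (D D' : Set ℝ) (i j : ℕ) (θ : ℝ × ℝ × ℝ) : ℝ :=
  ∫ w in D ×ˢ D', gaussTerm i j θ.1 (w.1 + θ.2.1) (w.2 + θ.2.2)

/-- The domain of the parameters of `gaussMoment`. -/
def gaussDomain : Set (ℝ × ℝ × ℝ) := {θ | θ.1 ∈ Ioo (0 : ℝ) 1}

lemma isOpen_gaussDomain : IsOpen gaussDomain := isOpen_Ioo.preimage continuous_fst

lemma integrable_gaussTerm (i j : ℕ) {c : ℝ} (hc : c ∈ Ioo (0 : ℝ) 1) (s t : ℝ) :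
    Integrable fun w : ℝ × ℝ => gaussTerm i j c (w.1 + s) (w.2 + t) :=
  (gaussDominated_gaussTerm subset_rfl i j).integrable hc (continuous_gaussTerm i j c) s t

lemma mem_Ioo_midpoint {c : ℝ} (hc : c ∈ Ioo (0 : ℝ) 1) : c ∈ Ioo 0 ((1 + c) / 2) :=
  ⟨hc.1, by linarith [hc.2]⟩

lemma midpoint_lt_one {c : ℝ} (hc : c ∈ Ioo (0 : ℝ) 1) : (1 + c) / 2 < 1 := by linarith [hc.2]

lemma integrable_gaussTermX (i j : ℕ) {c : ℝ} (hc : c ∈ Ioo (0 : ℝ) 1) (s t : ℝ) :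
    Integrable fun w : ℝ × ℝ => gaussTermX i j c (w.1 + s) (w.2 + t) :=
  (gaussDominated_gaussTermX (midpoint_lt_one hc) i j).integrable (mem_Ioo_midpoint hc)
    (continuous_gaussTermX i j c) s t

lemma integrable_gaussTerm_fst (i j : ℕ) {c : ℝ} (hc : c ∈ Ioo (0 : ℝ) 1) (s y : ℝ) :
    Integrable fun u : ℝ => gaussTerm i j c (u + s) y :=
  (gaussDominated_gaussTerm subset_rfl i j).integrable_fst hc (continuous_gaussTerm i j c) s y

lemma integrable_gaussTermX_fst (i j : ℕ) {c : ℝ} (hc : c ∈ Ioo (0 : ℝ) 1) (s y : ℝ) :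
    Integrable fun u : ℝ => gaussTermX i j c (u + s) y :=
  (gaussDominated_gaussTermX (midpoint_lt_one hc) i j).integrable_fst (mem_Ioo_midpoint hc)
    (continuous_gaussTermX i j c) s y

lemma integrable_gaussTermY (i j : ℕ) {c : ℝ} (hc : c ∈ Ioo (0 : ℝ) 1) (s t : ℝ) :
    Integrable fun w : ℝ × ℝ => gaussTermY i j c (w.1 + s) (w.2 + t) :=
  (gaussDominated_gaussTermY (midpoint_lt_one hc) i j).integrable (mem_Ioo_midpoint hc)
    (continuous_gaussTermY i j c) s t

lemma integrable_gaussTermC (i j : ℕ) {c : ℝ} (hc : c ∈ Ioo (0 : ℝ) 1) (s t : ℝ) :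
    Integrable fun w : ℝ × ℝ => gaussTermC i j c (w.1 + s) (w.2 + t) :=
  (gaussDominated_gaussTermC (midpoint_lt_one hc) i j).integrable (mem_Ioo_midpoint hc)
    (continuous_gaussTermC i j c) s t

/-- `∂/∂s` of `gaussMoment`. -/
def gaussMomentS (D D' : Set ℝ) (i j : ℕ) (θ : ℝ × ℝ × ℝ) : ℝ :=
  i * gaussMoment D D' (i - 1) j θ
    - 2 / (1 - θ.1 ^ 2) * (gaussMoment D D' (i + 1) j θ - θ.1 * gaussMoment D D' i (j + 1) θ)

/-- `∂/∂t` of `gaussMoment`. -/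
def gaussMomentT (D D' : Set ℝ) (i j : ℕ) (θ : ℝ × ℝ × ℝ) : ℝ :=
  j * gaussMoment D D' i (j - 1) θ
    - 2 / (1 - θ.1 ^ 2) * (gaussMoment D D' i (j + 1) θ - θ.1 * gaussMoment D D' (i + 1) j θ)

/-- `∂/∂c` of `gaussMoment`. -/
def gaussMomentC (D D' : Set ℝ) (i j : ℕ) (θ : ℝ × ℝ × ℝ) : ℝ :=
  2 / (1 - θ.1 ^ 2) * gaussMoment D D' (i + 1) (j + 1) θ
    - 2 * θ.1 / (1 - θ.1 ^ 2) ^ 2 * (gaussMoment D D' (i + 2) j θ + gaussMoment D D' i (j + 2) θ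
      - 2 * θ.1 * gaussMoment D D' (i + 1) (j + 1) θ)

variable {D D' : Set ℝ}

lemma integral_gaussTermX (i j : ℕ) {θ : ℝ × ℝ × ℝ} (hθ : θ ∈ gaussDomain) :
    ∫ w in D ×ˢ D', gaussTermX i j θ.1 (w.1 + θ.2.1) (w.2 + θ.2.2) = gaussMomentS D D' i j θ := by
  have h := fun i j => (integrable_gaussTerm i j hθ θ.2.1 θ.2.2).restrict (s := D ×ˢ D')
  simp only [gaussTermX, gaussMomentS, gaussMoment]
  rw [integral_sub ((h _ _).const_mul _) (((h _ _).sub' ((h _ _).const_mul _)).const_mul _),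
    integral_const_mul, integral_const_mul, integral_sub (h _ _) ((h _ _).const_mul _),
    integral_const_mul]

lemma integral_gaussTermY (i j : ℕ) {θ : ℝ × ℝ × ℝ} (hθ : θ ∈ gaussDomain) :
    ∫ w in D ×ˢ D', gaussTermY i j θ.1 (w.1 + θ.2.1) (w.2 + θ.2.2) = gaussMomentT D D' i j θ := by
  have h := fun i j => (integrable_gaussTerm i j hθ θ.2.1 θ.2.2).restrict (s := D ×ˢ D')
  simp only [gaussTermY, gaussMomentT, gaussMoment]
  rw [integral_sub ((h _ _).const_mul _) (((h _ _).sub' ((h _ _).const_mul _)).const_mul _),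
    integral_const_mul, integral_const_mul, integral_sub (h _ _) ((h _ _).const_mul _),
    integral_const_mul]

lemma integral_gaussTermC (i j : ℕ) {θ : ℝ × ℝ × ℝ} (hθ : θ ∈ gaussDomain) :
    ∫ w in D ×ˢ D', gaussTermC i j θ.1 (w.1 + θ.2.1) (w.2 + θ.2.2) = gaussMomentC D D' i j θ := by
  have h := fun i j => (integrable_gaussTerm i j hθ θ.2.1 θ.2.2).restrict (s := D ×ˢ D')
  simp only [gaussTermC, gaussMomentC, gaussMoment]
  rw [integral_sub ((h _ _).const_mul _)
      ((((h _ _).fun_add (h _ _)).sub' ((h _ _).const_mul _)).const_mul _),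
    integral_const_mul, integral_const_mul, integral_sub ((h _ _).fun_add (h _ _))
      ((h _ _).const_mul _), integral_add (h _ _) (h _ _), integral_const_mul]

/-- The derivative of `gaussMoment` as a linear map. -/
def gaussMomentDeriv (D D' : Set ℝ) (i j : ℕ) (θ : ℝ × ℝ × ℝ) : ℝ × ℝ × ℝ →L[ℝ] ℝ :=
  gaussMomentC D D' i j θ • projC + gaussMomentS D D' i j θ • projS
    + gaussMomentT D D' i j θ • projT

lemma norm_gaussDeriv_le (i j : ℕ) (θ : ℝ × ℝ × ℝ) (w : ℝ × ℝ) : ‖gaussDeriv i j θ w‖ ≤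
    |gaussTermC i j θ.1 (w.1 + θ.2.1) (w.2 + θ.2.2)|
      + |gaussTermX i j θ.1 (w.1 + θ.2.1) (w.2 + θ.2.2)|
      + |gaussTermY i j θ.1 (w.1 + θ.2.1) (w.2 + θ.2.2)| := by
  refine ContinuousLinearMap.opNorm_le_bound _ (by positivity) fun v => ?_
  have h1 : |v.1| ≤ ‖v‖ := norm_fst_le v
  have h2 : |v.2.1| ≤ ‖v‖ := (norm_fst_le v.2).trans (norm_snd_le v)
  have h3 : |v.2.2| ≤ ‖v‖ := (norm_snd_le v.2).trans (norm_snd_le v)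
  simp only [gaussDeriv, add_apply, smul_apply, smul_eq_mul,
    ContinuousLinearMap.coe_comp, Function.comp, ContinuousLinearMap.coe_fst',
    ContinuousLinearMap.coe_snd', Real.norm_eq_abs, add_mul]
  refine (abs_add_three _ _ _).trans ?_
  simp only [abs_mul]
  gcongr

lemma integrable_gaussDeriv (i j : ℕ) {θ : ℝ × ℝ × ℝ} (hθ : θ ∈ gaussDomain) :
    Integrable (gaussDeriv i j θ) :=
  (((integrable_gaussTermC i j hθ θ.2.1 θ.2.2).smul_const projC).fun_add
    ((integrable_gaussTermX i j hθ θ.2.1 θ.2.2).smul_const projS)).fun_add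
    ((integrable_gaussTermY i j hθ θ.2.1 θ.2.2).smul_const projT)

lemma integral_gaussDeriv (i j : ℕ) {θ : ℝ × ℝ × ℝ} (hθ : θ ∈ gaussDomain) :
    ∫ w in D ×ˢ D', gaussDeriv i j θ w = gaussMomentDeriv D D' i j θ := by
  have h1 := ((integrable_gaussTermC i j hθ θ.2.1 θ.2.2).smul_const projC).restrict (s := D ×ˢ D')
  have h2 := ((integrable_gaussTermX i j hθ θ.2.1 θ.2.2).smul_const projS).restrict (s := D ×ˢ D')
  have h3 := ((integrable_gaussTermY i j hθ θ.2.1 θ.2.2).smul_const projT).restrict (s := D ×ˢ D')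
  simp only [gaussDeriv]
  rw [integral_add (h1.fun_add h2) h3, integral_add h1 h2, integral_smul_const, integral_smul_const,
    integral_smul_const, integral_gaussTermC i j hθ, integral_gaussTermX i j hθ,
    integral_gaussTermY i j hθ]
  rfl

/-- The shift sits in the integrand while the domain is fixed, so differentiation in an endpoint is
differentiation under the integral sign, with no moving boundary. -/
theorem hasFDerivAt_gaussMoment (D D' : Set ℝ) (i j : ℕ) {θ : ℝ × ℝ × ℝ} (hθ : θ ∈ gaussDomain) :
    HasFDerivAt (gaussMoment D D' i j) (gaussMomentDeriv D D' i j θ) θ := by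
  -- The coefficients `2 / (1 - c²)` of the derivatives blow up at `c = 1`, so uniform bounds
  -- require `c` to stay below some `c₁ < 1`.
  obtain ⟨c₁, hcc₁, hc₁⟩ := exists_between (show θ.1 < 1 from hθ.2)
  obtain ⟨K, hK⟩ := gaussDominated_gaussTermC hc₁ i j
  obtain ⟨L, hL⟩ := gaussDominated_gaussTermX hc₁ i j
  obtain ⟨M, hM⟩ := gaussDominated_gaussTermY hc₁ i j
  set R := max |θ.2.1| |θ.2.2| + 1
  set N : Set (ℝ × ℝ × ℝ) := {η | η.1 ∈ Ioo 0 c₁ ∧ |η.2.1| < R ∧ |η.2.2| < R} with hN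
  have hNo : IsOpen N := by
    have h1 : IsOpen {η : ℝ × ℝ × ℝ | |η.2.1| < R} := isOpen_lt (by fun_prop) continuous_const
    have h2 : IsOpen {η : ℝ × ℝ × ℝ | |η.2.2| < R} := isOpen_lt (by fun_prop) continuous_const
    exact (isOpen_Ioo.preimage continuous_fst).inter (h1.inter h2)
  have hθN : θ ∈ N := ⟨⟨hθ.1, hcc₁⟩, (le_max_left _ _).trans_lt (lt_add_one _),
    (le_max_right _ _).trans_lt (lt_add_one _)⟩
  have hsub : ∀ η ∈ N, η ∈ gaussDomain := fun η hη => ⟨hη.1.1, hη.1.2.trans hc₁⟩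
  have hpos : 0 ≤ K + L + M := by
    have h1 := (abs_nonneg _).trans (hK θ.1 hθN.1 0 0)
    have h2 := (abs_nonneg _).trans (hL θ.1 hθN.1 0 0)
    have h3 := (abs_nonneg _).trans (hM θ.1 hθN.1 0 0)
    simp only [ne_eq, OfNat.ofNat_ne_zero, not_false_eq_true, zero_pow, add_zero, zero_div,
      neg_zero, Real.exp_zero, mul_one] at h1 h2 h3
    positivity
  refine HasFDerivAt.congr_fderiv (f' := ∫ w in D ×ˢ D', gaussDeriv i j θ w) ?_
    (integral_gaussDeriv i j hθ)
  refine hasFDerivAt_integral_of_dominated_of_fderiv_le (hNo.mem_nhds hθN)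
    (F := fun η w => gaussTerm i j η.1 (w.1 + η.2.1) (w.2 + η.2.2)) (F' := gaussDeriv i j)
    (bound := fun w => (K + L + M) * (Real.exp (R ^ 2 / 2) *
      (Real.exp (-(1 / 8) * w.1 ^ 2) * Real.exp (-(1 / 8) * w.2 ^ 2))))
    ?_ (integrable_gaussTerm i j hθ _ _).restrict (integrable_gaussDeriv i j hθ).1.restrict
    (Filter.Eventually.of_forall fun w η hη => ?_)
    ((integrable_exp_prod.const_mul (Real.exp (R ^ 2 / 2))).const_mul (K + L + M)).restrict
    (Filter.Eventually.of_forall fun w η hη => hasFDerivAt_gaussTerm i j (hsub η hη) w)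
  · filter_upwards [hNo.mem_nhds hθN] with η hη
    exact (integrable_gaussTerm i j (hsub η hη) _ _).1.restrict
  · refine (norm_gaussDeriv_le i j η w).trans ?_
    refine le_trans (add_le_add (add_le_add (hK _ hη.1 _ _) (hL _ hη.1 _ _)) (hM _ hη.1 _ _)) ?_
    rw [← add_mul, ← add_mul]
    exact mul_le_mul_of_nonneg_left (exp_shift_le hη.2.1.le hη.2.2.le _ _) hpos

/-- The derivative of a moment is a combination of moments with coefficients smooth in `c`, so
smoothness bootstraps by induction over all indices at once. -/
theorem contDiffOn_gaussMoment (D D' : Set ℝ) (k : ℕ) (i j : ℕ) :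
    ContDiffOn ℝ k (gaussMoment D D' i j) gaussDomain := by
  have hdiff : ∀ i j, DifferentiableOn ℝ (gaussMoment D D' i j) gaussDomain := fun i j θ hθ =>
    (hasFDerivAt_gaussMoment D D' i j hθ).differentiableAt.differentiableWithinAt
  induction k generalizing i j with
  | zero => exact_mod_cast contDiffOn_zero.2 (hdiff i j).continuousOn
  | succ k ih =>
    push_cast
    rw [contDiffOn_succ_iff_fderiv_of_isOpen isOpen_gaussDomain]
    refine ⟨hdiff i j, fun h => absurd h (by simp), ?_⟩
    have h1 : ContDiffOn ℝ k (gaussMomentDeriv D D' i j) gaussDomain := by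
      have hne : ∀ θ ∈ gaussDomain, 1 - θ.1 ^ 2 ≠ 0 := fun θ hθ => by nlinarith [hθ.1, hθ.2]
      have hne2 : ∀ θ ∈ gaussDomain, (1 - θ.1 ^ 2) ^ 2 ≠ 0 := fun θ hθ => pow_ne_zero _ (hne θ hθ)
      have hfst : ContDiffOn ℝ k (fun θ : ℝ × ℝ × ℝ => θ.1) gaussDomain := contDiff_fst.contDiffOn
      have hden : ContDiffOn ℝ k (fun θ : ℝ × ℝ × ℝ => 2 / (1 - θ.1 ^ 2)) gaussDomain :=
        contDiffOn_const.div (contDiffOn_const.sub (hfst.pow 2)) hne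
      have hden2 : ContDiffOn ℝ k (fun θ : ℝ × ℝ × ℝ => 2 * θ.1 / (1 - θ.1 ^ 2) ^ 2)
          gaussDomain :=
        (contDiffOn_const.mul hfst).div ((contDiffOn_const.sub (hfst.pow 2)).pow 2) hne2
      unfold gaussMomentDeriv gaussMomentC gaussMomentS gaussMomentT
      refine ContDiffOn.add (ContDiffOn.add (ContDiffOn.smul_const ?_ _)
        (ContDiffOn.smul_const ?_ _)) (ContDiffOn.smul_const ?_ _)
      · exact (hden.mul (ih _ _)).sub (hden2.mul (((ih _ _).add (ih _ _)).sub
          ((contDiffOn_const.mul hfst).mul (ih _ _))))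
      · exact (contDiffOn_const.mul (ih _ _)).sub (hden.mul ((ih _ _).sub (hfst.mul (ih _ _))))
      · exact (contDiffOn_const.mul (ih _ _)).sub (hden.mul ((ih _ _).sub (hfst.mul (ih _ _))))
    exact h1.congr fun θ hθ => (hasFDerivAt_gaussMoment D D' i j hθ).fderiv

/-! ### Integration by parts -/

/-- The vanishing of the integral of a derivative over the line or a half line. -/
lemma integral_deriv_eq_zero {f f' : ℝ → ℝ} (hD : D = univ ∨ D = Ici 0 ∧ f 0 = 0)
    (h : ∀ x, HasDerivAt f (f' x) x) (hf : Integrable f) (hf' : Integrable f') :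
    ∫ x in D, f' x = 0 := by
  rcases hD with rfl | ⟨rfl, h0⟩
  · rw [setIntegral_univ]
    exact integral_eq_zero_of_hasDerivAt_of_integrable h hf' hf
  · rw [integral_Ici_eq_integral_Ioi, integral_Ioi_of_hasDerivAt_of_tendsto
      (h 0).continuousAt.continuousWithinAt (fun x _ => h x) hf'.integrableOn
      (tendsto_zero_of_hasDerivAt_of_integrableOn_Ioi (a := 0) (fun x _ => h x) hf'.integrableOn
        hf.integrableOn), h0, sub_zero]

lemma setIntegral_prod_symm_eq_zero {f : ℝ × ℝ → ℝ} (hf : Integrable f)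
    (h : ∀ y, ∫ x in D, f (x, y) = 0) : ∫ w in D ×ˢ D', f w = 0 := by
  rw [Measure.volume_eq_prod, ← Measure.prod_restrict, integral_prod_symm]
  · simp [h]
  · rw [Measure.prod_restrict]
    exact hf.restrict

lemma hasDerivAt_gaussTerm (i j : ℕ) {c : ℝ} (hc : c ∈ Ioo (0 : ℝ) 1) (s y u : ℝ) :
    HasDerivAt (fun u => gaussTerm i j c (u + s) y) (gaussTermX i j c (u + s) y) u := by
  have h := hasFDerivAt_gaussTerm i j (θ := (c, u, 0)) hc (s, y)
  have h2 : HasDerivAt (fun u : ℝ => ((c, u, 0) : ℝ × ℝ × ℝ)) (0, 1, 0) u :=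
    (hasDerivAt_const u c).prodMk ((hasDerivAt_id u).prodMk (hasDerivAt_const u 0))
  have h3 := h.comp_hasDerivAt u h2
  simp only [Function.comp_def, add_zero] at h3
  simp only [add_comm _ s]
  refine h3.congr_deriv ?_
  simp [gaussDeriv]

lemma gaussMomentS_univ (i j : ℕ) {θ : ℝ × ℝ × ℝ} (hθ : θ ∈ gaussDomain) :
    gaussMomentS univ D' i j θ = 0 := by
  refine (integral_gaussTermX i j hθ).symm.trans ?_
  have h : ∀ y, ∫ u in univ, gaussTermX i j θ.1 (u + θ.2.1) (y + θ.2.2) = 0 := fun y =>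
    integral_deriv_eq_zero (Or.inl rfl) (hasDerivAt_gaussTerm i j hθ θ.2.1 (y + θ.2.2))
      (integrable_gaussTerm_fst i j hθ _ _) (integrable_gaussTermX_fst i j hθ _ _)
  exact setIntegral_prod_symm_eq_zero (integrable_gaussTermX i j hθ θ.2.1 θ.2.2) h

lemma mul_gaussTerm (i j : ℕ) (c x y : ℝ) :
    x * gaussTerm i j c x y = gaussTerm (i + 1) j c x y := by
  simp only [gaussTerm]
  ring

lemma mul_gaussTermX (i j : ℕ) (c x y : ℝ) : x * gaussTermX i j c x y =
    gaussTermX (i + 1) j c x y - gaussTerm i j c x y := by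
  have h : (i : ℝ) * (x * gaussTerm (i - 1) j c x y) = i * gaussTerm i j c x y := by
    cases i with
    | zero => simp
    | succ i => rw [mul_gaussTerm, Nat.add_sub_cancel]
  simp only [gaussTermX, Nat.add_sub_cancel, ← mul_gaussTerm (i + 1), ← mul_gaussTerm i]
  push_cast
  linear_combination h

/-- The moving boundary: multiplying the integrand by `x` multiplies the boundary term by `s`. -/
lemma mul_gaussMomentS (hD : D = univ ∨ D = Ici 0) (i j : ℕ) {θ : ℝ × ℝ × ℝ}
    (hθ : θ ∈ gaussDomain) :
    θ.2.1 * gaussMomentS D D' i j θ = gaussMomentS D D' (i + 1) j θ := by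
  set s := θ.2.1
  set t := θ.2.2
  have hX := fun i j => integrable_gaussTermX i j hθ s t
  have hT := integrable_gaussTerm i j hθ s t
  have key : ∀ u y, u * gaussTermX i j θ.1 (u + s) y + gaussTerm i j θ.1 (u + s) y =
      gaussTermX (i + 1) j θ.1 (u + s) y - s * gaussTermX i j θ.1 (u + s) y := fun u y => by
    linear_combination mul_gaussTermX i j θ.1 (u + s) y
  -- The integrand is the `u`-derivative of `u * gaussTerm`, whose boundary value at `u = 0`
  -- vanishes.
  have hzero : ∫ w in D ×ˢ D', (gaussTermX (i + 1) j θ.1 (w.1 + s) (w.2 + t)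
      - s * gaussTermX i j θ.1 (w.1 + s) (w.2 + t)) = 0 := by
    refine setIntegral_prod_symm_eq_zero ((hX _ _).sub ((hX _ _).const_mul _)) fun y => ?_
    have h1 := fun i => integrable_gaussTermX_fst i j hθ s (y + t)
    have h2 := fun i => integrable_gaussTerm_fst i j hθ s (y + t)
    refine integral_deriv_eq_zero (f := fun u => u * gaussTerm i j θ.1 (u + s) (y + t))
      (hD.imp id fun h => ⟨h, by simp⟩) (fun u => ?_) ?_ ((h1 _).sub ((h1 _).const_mul _))
    · refine ((hasDerivAt_id u).mul (hasDerivAt_gaussTerm i j hθ s (y + t) u)).congr_deriv ?_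
      rw [← key]
      simp only [id]
      ring
    · refine ((h2 (i + 1)).sub ((h2 i).const_mul s)).congr (Filter.Eventually.of_forall fun u => ?_)
      simp only [Pi.sub_apply, ← mul_gaussTerm i]
      ring
  rw [integral_sub (hX _ _).restrict ((hX _ _).const_mul _).restrict, integral_const_mul,
    integral_gaussTermX _ _ hθ, integral_gaussTermX _ _ hθ] at hzero
  linarith

lemma gaussMoment_swap (D D' : Set ℝ) (i j : ℕ) (θ : ℝ × ℝ × ℝ) :
    gaussMoment D D' i j θ = gaussMoment D' D j i (θ.1, θ.2.2, θ.2.1) := by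
  simp only [gaussMoment, Measure.volume_eq_prod]
  rw [← setIntegral_prod_swap]
  refine integral_congr_ae (Filter.Eventually.of_forall fun w => ?_)
  exact gaussTerm_swap _ _ _ _ _

lemma gaussMomentT_eq (D D' : Set ℝ) (i j : ℕ) (θ : ℝ × ℝ × ℝ) :
    gaussMomentT D D' i j θ = gaussMomentS D' D j i (θ.1, θ.2.2, θ.2.1) := by
  simp only [gaussMomentT, gaussMomentS, gaussMoment_swap D D']

lemma gaussMomentT_univ (i j : ℕ) {θ : ℝ × ℝ × ℝ} (hθ : θ ∈ gaussDomain) :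
    gaussMomentT D univ i j θ = 0 := by
  rw [gaussMomentT_eq]
  exact gaussMomentS_univ j i hθ

lemma mul_gaussMomentT (hD' : D' = univ ∨ D' = Ici 0) (i j : ℕ) {θ : ℝ × ℝ × ℝ}
    (hθ : θ ∈ gaussDomain) :
    θ.2.2 * gaussMomentT D D' i j θ = gaussMomentT D D' i (j + 1) θ := by
  rw [gaussMomentT_eq, gaussMomentT_eq]
  exact mul_gaussMomentS hD' j i (θ := (θ.1, θ.2.2, θ.2.1)) hθ

end GaussianMoments

/-! ### Integrals over finite unions of intervals -/

section SpectralSet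

open MeasureTheory Set

variable {p q : ℕ}

/-- The weight with which the half line beginning at an endpoint (or, for `none`, the whole line)
enters the indicator function of a spectral set. -/
def edgeCoeff (e : Bool) : Option (Fin p) → ℝ
  | none => if e = true then 1 else 0
  | some i => if e = true then -(-1) ^ i.val else (-1) ^ i.val

/-- The line or the half line. -/
def edgeDomain : Option (Fin p) → Set ℝ
  | none => univ
  | some _ => Ici 0

/-- Evaluation at an endpoint, and `0` for `none`. -/
def edgePoint : Option (Fin p) → (Fin p → ℝ) →L[ℝ] ℝ
  | none => 0
  | some i => ContinuousLinearMap.proj i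

lemma edgeDomain_eq (α : Option (Fin p)) : edgeDomain α = univ ∨ edgeDomain α = Ici 0 := by
  cases α <;> simp [edgeDomain]

lemma measurableSet_edgeDomain (α : Option (Fin p)) : MeasurableSet (edgeDomain α) := by
  cases α <;> simp [edgeDomain]

/-- For ordered endpoints those not exceeding `x` form an initial segment, so the sum is an
alternating geometric one that detects the parity. -/
lemma sum_alternating_eq {p : ℕ} {a : Fin p → ℝ} (ha : Monotone a) (x : ℝ) :
    (∑ i : Fin p, if a i ≤ x then (-1 : ℝ) ^ i.val else 0) =
      if Even (Finset.univ.filter fun i => a i ≤ x).card then 0 else 1 := by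
  induction p with
  | zero => simp
  | succ p ih =>
    by_cases h : a (Fin.last p) ≤ x
    · have h1 : ∀ i, a i ≤ x := fun i => (ha (Fin.le_last i)).trans h
      simp only [h1, if_true, Finset.filter_true, Finset.card_univ, Fintype.card_fin]
      rw [← Finset.sum_range fun i => (-1 : ℝ) ^ i, neg_one_geom_sum]
    · have h2 := ih (a := fun i => a i.castSucc) fun i j hij => ha (by simpa using hij)
      rw [Finset.card_filter] at h2 ⊢
      rw [Fin.sum_univ_castSucc, Fin.sum_univ_castSucc]
      simpa [h] using h2

lemma measurableSet_spectralSet (e : Bool) (a : Fin p → ℝ) : MeasurableSet (spectralSet e a) := by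
  have h : Measurable fun x : ℝ => (Finset.univ.filter fun i => a i ≤ x).card := by
    simp only [Finset.card_filter]
    exact Finset.measurable_sum _ fun i _ =>
      Measurable.ite measurableSet_Ici measurable_const measurable_const
  exact h (MeasurableSet.of_discrete (s := {k | Even k ↔ e = true}))

/-- A spectral set is a signed sum of half lines, plus the whole line if `e` is true. Moving each
half line to the origin puts the endpoint into the integrand, where it can be differentiated. -/
lemma indicator_spectralSet {a : Fin p → ℝ} (ha : Monotone a) (e : Bool) (f : ℝ → ℝ) (x : ℝ) :
    (spectralSet e a).indicator f x =
      ∑ α : Option (Fin p), edgeCoeff e α *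
        (edgeDomain α).indicator (fun u => f (u + edgePoint α a)) (x - edgePoint α a) := by
  have h := sum_alternating_eq ha x
  have h1 : ∀ i : Fin p, (Ici (0 : ℝ)).indicator (fun u => f (u + a i)) (x - a i) =
      if a i ≤ x then f x else 0 := fun i => by
    simp [indicator_apply]
  rw [Fintype.sum_option]
  simp only [edgeCoeff, edgeDomain, edgePoint, indicator_univ, zero_apply,
    ContinuousLinearMap.proj_apply, h1, sub_zero, add_zero]
  have h2 : ∑ i : Fin p, (-1 : ℝ) ^ i.val * (if a i ≤ x then f x else 0) =
      (if Even (Finset.univ.filter fun i => a i ≤ x).card then 0 else 1) * f x := by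
    rw [← h, Finset.sum_mul]
    exact Finset.sum_congr rfl fun i _ => by split_ifs <;> simp
  cases e
  · simp only [Bool.false_eq_true, if_false, zero_mul, zero_add, h2]
    simp only [indicator_apply, spectralSet, mem_ofPred_eq, Bool.false_eq_true, iff_false]
    split_ifs <;> simp
  · simp only [if_true, neg_mul, Finset.sum_neg_distrib, h2]
    simp only [indicator_apply, spectralSet, mem_ofPred_eq, iff_true]
    split_ifs <;> simp

lemma setIntegral_spectralSet {a : Fin p → ℝ} (ha : Monotone a) (e : Bool) {f : ℝ → ℝ}
    (hf : Integrable f) :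
    ∫ x in spectralSet e a, f x =
      ∑ α : Option (Fin p), edgeCoeff e α * ∫ u in edgeDomain α, f (u + edgePoint α a) := by
  rw [← integral_indicator (measurableSet_spectralSet e a)]
  simp only [indicator_spectralSet ha]
  rw [integral_finsetSum]
  · refine Finset.sum_congr rfl fun α _ => ?_
    rw [integral_const_mul, ← integral_indicator (measurableSet_edgeDomain α),
      integral_sub_right_eq_self (fun u => (edgeDomain α).indicator
        (fun u => f (u + edgePoint α a)) u)]
  · intro α _
    refine Integrable.const_mul ?_ _
    exact ((hf.comp_add_right (edgePoint α a)).indicator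
      (measurableSet_edgeDomain α)).comp_sub_right (edgePoint α a)

/-- The mixed moments of the coupled Gaussian weight over two spectral sets, in the variables of
the Dyson process, decomposed over the endpoints. -/
def moment (e₁ e₂ : Bool) (z : Vars p q) (i j : ℕ) : ℝ :=
  ∑ α : Option (Fin p), ∑ β : Option (Fin q), (edgeCoeff e₁ α * edgeCoeff e₂ β) *
    gaussMoment (edgeDomain α) (edgeDomain β) i j (z.1, edgePoint α z.2.1, edgePoint β z.2.2)

lemma integrable_gaussTerm_snd (i j : ℕ) {c : ℝ} (hc : c ∈ Ioo (0 : ℝ) 1) (x : ℝ) :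
    Integrable fun v : ℝ => gaussTerm i j c x v := by
  have := integrable_gaussTerm_fst j i hc 0 x
  simp only [add_zero] at this
  exact this.congr (Filter.Eventually.of_forall fun v => gaussTerm_swap _ _ _ _ _)

lemma setIntegral_gaussTerm_eq_moment (e₁ e₂ : Bool) {z : Vars p q}
    (hc : z.1 ∈ Ioo (0 : ℝ) 1) (ha : Monotone z.2.1) (hb : Monotone z.2.2) (i j : ℕ) :
    ∫ u in spectralSet e₁ z.2.1, ∫ v in spectralSet e₂ z.2.2, gaussTerm i j z.1 u v =
      moment e₁ e₂ z i j := by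
  have hint : ∀ (s : ℝ) (β : Option (Fin q)), Integrable fun u : ℝ =>
      edgeCoeff e₂ β * ∫ v in edgeDomain β, gaussTerm i j z.1 (u + s) (v + edgePoint β z.2.2) := by
    intro s β
    refine Integrable.const_mul ?_ _
    have := (integrable_gaussTerm i j hc s (edgePoint β z.2.2)).restrict
      (s := univ ×ˢ edgeDomain β)
    rw [Measure.volume_eq_prod, ← Measure.prod_restrict, Measure.restrict_univ] at this
    exact this.integral_prod_left
  simp only [setIntegral_spectralSet hb e₂ (integrable_gaussTerm_snd i j hc _)]
  rw [setIntegral_spectralSet ha e₁]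
  · refine Finset.sum_congr rfl fun α _ => ?_
    rw [integral_finsetSum _ fun β _ => (hint _ β).restrict, Finset.mul_sum]
    refine Finset.sum_congr rfl fun β _ => ?_
    rw [integral_const_mul, mul_assoc, gaussMoment, Measure.volume_eq_prod, setIntegral_prod]
    rw [← Measure.volume_eq_prod]
    exact (integrable_gaussTerm i j hc _ _).integrableOn
  · refine integrable_finsetSum _ fun β _ => ?_
    simpa using hint 0 β

/-! ### The flows of the moments -/

/-- The parameters with `0 < c < 1`. -/
def couplingDomain (p q : ℕ) : Set (Vars p q) := {z | z.1 ∈ Ioo (0 : ℝ) 1}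

lemma isOpen_couplingDomain : IsOpen (couplingDomain p q) := isOpen_Ioo.preimage continuous_fst

/-- The map from the variables to the parameters of the moments of one pair of endpoints. -/
def edgeMap (α : Option (Fin p)) (β : Option (Fin q)) : Vars p q →L[ℝ] ℝ × ℝ × ℝ :=
  (ContinuousLinearMap.fst ℝ _ _).prod
    (((edgePoint α).comp ((ContinuousLinearMap.fst ℝ _ _).comp
      (ContinuousLinearMap.snd ℝ _ _))).prod
      ((edgePoint β).comp ((ContinuousLinearMap.snd ℝ _ _).comp (ContinuousLinearMap.snd ℝ _ _))))

lemma edgeMap_apply (α : Option (Fin p)) (β : Option (Fin q)) (z : Vars p q) :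
    edgeMap α β z = (z.1, edgePoint α z.2.1, edgePoint β z.2.2) := rfl

lemma moment_eq (e₁ e₂ : Bool) (z : Vars p q) (i j : ℕ) : moment e₁ e₂ z i j =
    ∑ α : Option (Fin p), ∑ β : Option (Fin q), (edgeCoeff e₁ α * edgeCoeff e₂ β) *
      gaussMoment (edgeDomain α) (edgeDomain β) i j (edgeMap α β z) := rfl

lemma contDiffOn_moment (e₁ e₂ : Bool) (i j k : ℕ) :
    ContDiffOn ℝ k (fun z : Vars p q => moment e₁ e₂ z i j) (couplingDomain p q) := by
  simp only [moment_eq]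
  refine ContDiffOn.sum fun α _ => ContDiffOn.sum fun β _ => contDiffOn_const.mul ?_
  exact (contDiffOn_gaussMoment _ _ k i j).comp (edgeMap α β).contDiff.contDiffOn fun z hz => hz

/-- The derivative of the moments along a vector field, endpoint by endpoint. -/
lemma lieOn_moment (e₁ e₂ : Bool) (v : Vars p q → Vars p q) (i j : ℕ) {F : Vars p q → ℝ}
    {G : Option (Fin p) → Option (Fin q) → Vars p q → ℝ}
    (hG : ∀ α β, ∀ z ∈ couplingDomain p q,
      gaussMomentC (edgeDomain α) (edgeDomain β) i j (edgeMap α β z) * (v z).1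
        + gaussMomentS (edgeDomain α) (edgeDomain β) i j (edgeMap α β z) * edgePoint α (v z).2.1
        + gaussMomentT (edgeDomain α) (edgeDomain β) i j (edgeMap α β z) * edgePoint β (v z).2.2
        = G α β z)
    (hF : ∀ z ∈ couplingDomain p q, ∑ α : Option (Fin p), ∑ β : Option (Fin q),
      (edgeCoeff e₁ α * edgeCoeff e₂ β) * G α β z = F z) :
    LieOn (couplingDomain p q) v (fun z => moment e₁ e₂ z i j) F := by
  simp only [moment_eq]
  refine LieOn.congr (LieOn.sum _ fun α _ => LieOn.sum _ fun β _ =>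
    LieOn.const_mul (f' := G α β) _ fun z hz => ?_) hF
  refine ⟨_, (hasFDerivAt_gaussMoment (edgeDomain α) (edgeDomain β) i j
    (θ := edgeMap α β z) hz).comp z (edgeMap α β).hasFDerivAt, ?_⟩
  rw [← hG α β z hz]
  simp [gaussMomentDeriv, edgeMap_apply]

end SpectralSet

/-! ### The differential operators as vector fields acting on the moments -/

section MomentFlows

open MeasureTheory Set

variable {p q : ℕ}

/-- The vector field of `𝒜`. -/
def fieldA (z : Vars p q) : Vars p q := (0, fun _ => 1, fun _ => z.1)
/-- The vector field of `𝒜̃`. -/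
def fieldAt (z : Vars p q) : Vars p q := (0, fun _ => z.1, fun _ => 1)
/-- The vector field of `𝒜₀`. -/
def fieldA₀ (z : Vars p q) : Vars p q := (-((1 - z.1 ^ 2) * z.1), z.2.1, z.1 ^ 2 • z.2.2)
/-- The vector field of `𝒜̃₀`. -/
def fieldAt₀ (z : Vars p q) : Vars p q := (-((1 - z.1 ^ 2) * z.1), z.1 ^ 2 • z.2.1, z.2.2)

/-- For `none` the point is `0` instead of `k`, but the derivative over the whole line vanishes too.
So the term without an endpoint obeys the same formula as the others. -/
lemma gaussMomentS_mul_edgePoint_const (α : Option (Fin p)) (D' : Set ℝ) (i j : ℕ) (k : ℝ)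
    {θ : ℝ × ℝ × ℝ} (hθ : θ ∈ gaussDomain) :
    gaussMomentS (edgeDomain α) D' i j θ * edgePoint α (fun _ => k) =
      gaussMomentS (edgeDomain α) D' i j θ * k := by
  cases α with
  | none => simp [edgeDomain, gaussMomentS_univ i j hθ]
  | some i => simp [edgePoint]

lemma gaussMomentT_mul_edgePoint_const (β : Option (Fin q)) (D : Set ℝ) (i j : ℕ) (k : ℝ)
    {θ : ℝ × ℝ × ℝ} (hθ : θ ∈ gaussDomain) :
    gaussMomentT D (edgeDomain β) i j θ * edgePoint β (fun _ => k) =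
      gaussMomentT D (edgeDomain β) i j θ * k := by
  cases β with
  | none => simp [edgeDomain, gaussMomentT_univ i j hθ]
  | some i => simp [edgePoint]

lemma one_sub_sq_ne_zero {c : ℝ} (hc : c ∈ Ioo (0 : ℝ) 1) : 1 - c ^ 2 ≠ 0 := by
  nlinarith [hc.1, hc.2]

/-- For `first`, the `y`-terms of the exponent cancel in `∂_x + c ∂_y` and leave `-2x`. For
`second`, an endpoint factor `a` or `b` becomes multiplication of the integrand by `x` or `y`
(`mul_gaussMomentS`, `mul_gaussMomentT`). The field then acts as `∂_x x + c² ∂_y y - (1 - c²) c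
∂_c`, whose effect on the exponent is `-2x²`. -/
lemma momentFlow (e₁ e₂ : Bool) : MomentFlow (couplingDomain p q) fieldA fieldA₀ (fun z => z.1)
    (moment e₁ e₂) where
  first i j := by
    refine lieOn_moment e₁ e₂ fieldA i j (G := fun α β z =>
      i * gaussMoment (edgeDomain α) (edgeDomain β) (i - 1) j (edgeMap α β z)
      + z.1 * (j * gaussMoment (edgeDomain α) (edgeDomain β) i (j - 1) (edgeMap α β z))
      - 2 * gaussMoment (edgeDomain α) (edgeDomain β) (i + 1) j (edgeMap α β z)) ?_ ?_
    · intro α β z hz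
      simp only [fieldA]
      rw [gaussMomentS_mul_edgePoint_const α _ i j 1 hz,
        gaussMomentT_mul_edgePoint_const β _ i j z.1 hz]
      have hne : 1 - z.1 ^ 2 ≠ 0 := one_sub_sq_ne_zero hz
      simp only [gaussMomentS, gaussMomentT, edgeMap_apply]
      field_simp
      ring
    · intro z _
      simp only [moment_eq, Finset.mul_sum, ← Finset.sum_add_distrib, ← Finset.sum_sub_distrib]
      exact Finset.sum_congr rfl fun α _ => Finset.sum_congr rfl fun β _ => by ring
  second i j := by
    refine lieOn_moment e₁ e₂ fieldA₀ i j (G := fun α β z =>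
      ((i + 1) + z.1 ^ 2 * (j + 1)) *
        gaussMoment (edgeDomain α) (edgeDomain β) i j (edgeMap α β z)
      - 2 * gaussMoment (edgeDomain α) (edgeDomain β) (i + 2) j (edgeMap α β z)) ?_ ?_
    · intro α β z hz
      have hS := mul_gaussMomentS (D' := edgeDomain β) (edgeDomain_eq α) i j
        (θ := edgeMap α β z) hz
      have hT := mul_gaussMomentT (D := edgeDomain α) (edgeDomain_eq β) i j
        (θ := edgeMap α β z) hz
      simp only [edgeMap_apply] at hS hT
      simp only [fieldA₀, map_smul, smul_eq_mul, edgeMap_apply]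
      have hne : 1 - z.1 ^ 2 ≠ 0 := one_sub_sq_ne_zero hz
      have h1 : ∀ C S T s t k : ℝ, C * -((1 - z.1 ^ 2) * z.1) + S * s + T * (k * t) =
          C * -((1 - z.1 ^ 2) * z.1) + s * S + k * (t * T) := fun C S T s t k => by ring
      rw [h1, hS, hT]
      simp only [gaussMomentS, gaussMomentT, gaussMomentC, Nat.add_sub_cancel]
      push_cast
      field_simp
      ring
    · intro z _
      simp only [moment_eq, Finset.mul_sum, ← Finset.sum_sub_distrib]
      exact Finset.sum_congr rfl fun α _ => Finset.sum_congr rfl fun β _ => by ring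

lemma momentFlow_transpose (e₁ e₂ : Bool) : MomentFlow (couplingDomain p q) fieldAt fieldAt₀
    (fun z => z.1) (fun z i j => moment e₁ e₂ z j i) where
  first j i := by
    refine lieOn_moment e₁ e₂ fieldAt i j (G := fun α β z =>
      j * gaussMoment (edgeDomain α) (edgeDomain β) i (j - 1) (edgeMap α β z)
      + z.1 * (i * gaussMoment (edgeDomain α) (edgeDomain β) (i - 1) j (edgeMap α β z))
      - 2 * gaussMoment (edgeDomain α) (edgeDomain β) i (j + 1) (edgeMap α β z)) ?_ ?_
    · intro α β z hz
      simp only [fieldAt]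
      rw [gaussMomentS_mul_edgePoint_const α _ i j z.1 hz,
        gaussMomentT_mul_edgePoint_const β _ i j 1 hz]
      have hne : 1 - z.1 ^ 2 ≠ 0 := one_sub_sq_ne_zero hz
      simp only [gaussMomentS, gaussMomentT, edgeMap_apply]
      field_simp
      ring
    · intro z _
      simp only [moment_eq, Finset.mul_sum, ← Finset.sum_add_distrib, ← Finset.sum_sub_distrib]
      exact Finset.sum_congr rfl fun α _ => Finset.sum_congr rfl fun β _ => by ring
  second j i := by
    refine lieOn_moment e₁ e₂ fieldAt₀ i j (G := fun α β z =>
      ((j + 1) + z.1 ^ 2 * (i + 1)) *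
        gaussMoment (edgeDomain α) (edgeDomain β) i j (edgeMap α β z)
      - 2 * gaussMoment (edgeDomain α) (edgeDomain β) i (j + 2) (edgeMap α β z)) ?_ ?_
    · intro α β z hz
      have hS := mul_gaussMomentS (D' := edgeDomain β) (edgeDomain_eq α) i j
        (θ := edgeMap α β z) hz
      have hT := mul_gaussMomentT (D := edgeDomain α) (edgeDomain_eq β) i j
        (θ := edgeMap α β z) hz
      simp only [edgeMap_apply] at hS hT
      simp only [fieldAt₀, map_smul, smul_eq_mul, edgeMap_apply]
      have hne : 1 - z.1 ^ 2 ≠ 0 := one_sub_sq_ne_zero hz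
      have h1 : ∀ C S T s t k : ℝ, C * -((1 - z.1 ^ 2) * z.1) + S * (k * s) + T * t =
          C * -((1 - z.1 ^ 2) * z.1) + k * (s * S) + t * T := fun C S T s t k => by ring
      rw [h1, hS, hT]
      simp only [gaussMomentS, gaussMomentT, gaussMomentC, Nat.add_sub_cancel]
      push_cast
      field_simp
      ring
    · intro z _
      simp only [moment_eq, Finset.mul_sum, ← Finset.sum_sub_distrib]
      exact Finset.sum_congr rfl fun α _ => Finset.sum_congr rfl fun β _ => by ring

lemma sum_mul_apply_left (L : Vars p q →L[ℝ] ℝ) (w : Fin p → ℝ) :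
    ∑ i, w i * L (0, Pi.single i 1, 0) = L (0, w, 0) := by
  have h : ((0, w, 0) : Vars p q) = ∑ i, w i • ((0, Pi.single i 1, 0) : Vars p q) := by
    refine Prod.ext (by simp [Prod.fst_sum]) (Prod.ext ?_ (by simp [Prod.snd_sum]))
    simp only [Prod.snd_sum, Prod.fst_sum, Prod.smul_mk]
    ext j
    simp [Finset.sum_apply, Pi.single_apply]
  rw [h, map_sum]
  simp only [map_smul, smul_eq_mul]

lemma sum_mul_apply_right (L : Vars p q →L[ℝ] ℝ) (w : Fin q → ℝ) :
    ∑ i, w i * L (0, 0, Pi.single i 1) = L (0, 0, w) := by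
  have h : ((0, 0, w) : Vars p q) = ∑ i, w i • ((0, 0, Pi.single i 1) : Vars p q) := by
    refine Prod.ext (by simp [Prod.fst_sum]) (Prod.ext (by simp [Prod.snd_sum, Prod.fst_sum]) ?_)
    simp only [Prod.snd_sum, Prod.smul_mk]
    ext j
    simp [Finset.sum_apply, Pi.single_apply]
  rw [h, map_sum]
  simp only [map_smul, smul_eq_mul]

lemma B_neg_one (f : Vars p q → ℝ) (z : Vars p q) :
    B (-1) f z = fderiv ℝ f z (0, fun _ => 1, 0) := by
  rw [← sum_mul_apply_left]
  simp [B]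

lemma Bt_neg_one (f : Vars p q → ℝ) (z : Vars p q) :
    Bt (-1) f z = fderiv ℝ f z (0, 0, fun _ => 1) := by
  rw [← sum_mul_apply_right]
  simp [Bt]

lemma B_zero (f : Vars p q → ℝ) (z : Vars p q) :
    B 0 f z = fderiv ℝ f z (0, z.2.1, 0) := by
  rw [← sum_mul_apply_left]
  simp [B]

lemma Bt_zero (f : Vars p q → ℝ) (z : Vars p q) :
    Bt 0 f z = fderiv ℝ f z (0, 0, z.2.2) := by
  rw [← sum_mul_apply_right]
  simp [Bt]

/-- Each operator is a directional derivative along a field depending on the point. In iterates the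
coefficient `c` is therefore carried inside the inner derivative. -/
lemma A_eq (f : Vars p q → ℝ) (z : Vars p q) : A f z = fderiv ℝ f z (fieldA z) := by
  rw [A, B_neg_one, Bt_neg_one, ← smul_eq_mul, ← map_smul, ← map_add]
  congr 1
  refine Prod.ext (by simp [fieldA]) (Prod.ext ?_ ?_) <;> ext <;> simp [fieldA]

lemma At_eq (f : Vars p q → ℝ) (z : Vars p q) : At f z = fderiv ℝ f z (fieldAt z) := by
  rw [At, B_neg_one, Bt_neg_one, ← smul_eq_mul, ← map_smul, ← map_add]
  congr 1
  refine Prod.ext (by simp [fieldAt]) (Prod.ext ?_ ?_) <;> ext <;> simp [fieldAt]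

lemma A₀_eq (f : Vars p q → ℝ) (z : Vars p q) : A₀ f z = fderiv ℝ f z (fieldA₀ z) := by
  rw [A₀, B_zero, Bt_zero, Dc, ← smul_eq_mul, ← smul_eq_mul, ← map_smul, ← map_smul, ← map_add,
    ← map_sub]
  congr 1
  refine Prod.ext (by simp [fieldA₀]) (Prod.ext ?_ ?_) <;> ext <;> simp [fieldA₀]

lemma At₀_eq (f : Vars p q → ℝ) (z : Vars p q) : At₀ f z = fderiv ℝ f z (fieldAt₀ z) := by
  rw [At₀, B_zero, Bt_zero, Dc, ← smul_eq_mul, ← smul_eq_mul, ← map_smul, ← map_smul, ← map_add,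
    ← map_sub]
  congr 1
  refine Prod.ext (by simp [fieldAt₀]) (Prod.ext ?_ ?_) <;> ext <;> simp [fieldAt₀]

end MomentFlows

/-! ### The matrix integral as a determinant of moments -/

section MatrixIntegral

open MeasureTheory Set

variable {p q : ℕ}

/-- The weight of the two-matrix integral. -/
def coupledWeight (c x y : ℝ) : ℝ := Real.exp (-x ^ 2 - y ^ 2 + 2 * c * (x * y))

lemma coupledWeight_bound {c : ℝ} (hc : c ∈ Ioo (0 : ℝ) 1) (i j : ℕ) : ∃ C, ∀ x y,
    |x ^ i * (y ^ j * coupledWeight c x y)| ≤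
      C * (Real.exp (-((1 - c) / 2) * x ^ 2) * Real.exp (-((1 - c) / 2) * y ^ 2)) := by
  have hδ : 0 < (1 - c) / 2 := by linarith [hc.2]
  refine ⟨(i ! * Real.exp (1 / (4 * ((1 - c) / 2)))) * (j ! * Real.exp (1 / (4 * ((1 - c) / 2)))),
    fun x y => ?_⟩
  have h := pow_mul_pow_mul_exp_neg_le i j hδ x y (Q := x ^ 2 + y ^ 2 - 2 * c * (x * y)) (by
    nlinarith [mul_nonneg hc.1.le (sq_nonneg (x - y))])
  rw [← Real.exp_add]
  have h1 : x ^ i * (y ^ j * coupledWeight c x y) =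
      x ^ i * y ^ j * Real.exp (-(x ^ 2 + y ^ 2 - 2 * c * (x * y))) := by
    rw [coupledWeight, mul_assoc]
    ring_nf
  have h2 : -((1 - c) / 2) * x ^ 2 + -((1 - c) / 2) * y ^ 2 = -((1 - c) / 2 * (x ^ 2 + y ^ 2)) := by
    ring
  rw [h1, h2]
  exact h

lemma continuous_pow_mul_coupledWeight (c : ℝ) (i j : ℕ) :
    Continuous fun w : ℝ × ℝ => w.1 ^ i * (w.2 ^ j * coupledWeight c w.1 w.2) := by
  unfold coupledWeight
  fun_prop

lemma integrable_coupledWeight_snd {c : ℝ} (hc : c ∈ Ioo (0 : ℝ) 1) (J : Set ℝ) (x : ℝ) (j : ℕ) :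
    Integrable (fun y => y ^ j * coupledWeight c x y) (volume.restrict J) := by
  obtain ⟨C, hC⟩ := coupledWeight_bound hc 0 j
  have hδ : 0 < (1 - c) / 2 := by linarith [hc.2]
  have hcont : Continuous fun y => y ^ j * coupledWeight c x y := by
    unfold coupledWeight
    fun_prop
  refine Integrable.restrict (Integrable.mono' (((integrable_exp_neg_mul_sq hδ).const_mul
    (Real.exp (-((1 - c) / 2) * x ^ 2))).const_mul C) hcont.aestronglyMeasurable
    (Filter.Eventually.of_forall fun y => ?_))
  simpa using hC x y

lemma integrable_coupledWeight_fst {c : ℝ} (hc : c ∈ Ioo (0 : ℝ) 1) (J₁ J₂ : Set ℝ) (i j : ℕ) :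
    Integrable (fun x => ∫ y, x ^ i * (y ^ j * coupledWeight c x y) ∂(volume.restrict J₂))
      (volume.restrict J₁) := by
  obtain ⟨C, hC⟩ := coupledWeight_bound hc i j
  have hδ : 0 < (1 - c) / 2 := by linarith [hc.2]
  have h : Integrable fun w : ℝ × ℝ => w.1 ^ i * (w.2 ^ j * coupledWeight c w.1 w.2) :=
    Integrable.mono' ((Integrable.mul_prod (integrable_exp_neg_mul_sq hδ)
      (integrable_exp_neg_mul_sq hδ)).const_mul C)
      (continuous_pow_mul_coupledWeight c i j).aestronglyMeasurable
      (Filter.Eventually.of_forall fun w => hC w.1 w.2)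
  have h2 := h.restrict (s := J₁ ×ˢ J₂)
  rw [Measure.volume_eq_prod, ← Measure.prod_restrict] at h2
  exact h2.integral_prod_left

lemma matrixIntegral_integrand {n : ℕ} (c : ℝ) (x y : Fin n → ℝ) :
    Real.exp (-∑ i, x i ^ 2 - ∑ i, y i ^ 2 + 2 * c * ∑ i, x i * y i) =
      ∏ i, coupledWeight c (x i) (y i) := by
  simp only [coupledWeight]
  rw [← Real.exp_sum]
  simp only [Finset.sum_add_distrib, Finset.sum_sub_distrib, Finset.sum_neg_distrib,
    Finset.mul_sum]

lemma restrict_setOf_forall_mem (n : ℕ) (J : Set ℝ) :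
    (volume : Measure (Fin n → ℝ)).restrict {x | ∀ i, x i ∈ J} =
      Measure.pi fun _ => volume.restrict J := by
  rw [← Measure.restrict_pi_pi]
  congr 1
  ext x
  simp

lemma matrixIntegral_eq (n : ℕ) {c : ℝ} (hc : c ∈ Ioo (0 : ℝ) 1) (J₁ J₂ : Set ℝ) :
    matrixIntegral n c J₁ J₂ = 1 / √Real.pi ^ n * (1 / c) ^ (n * (n - 1) / 2) *
      leadingMinor (fun i j => ∫ x in J₁, ∫ y in J₂, x ^ i * (y ^ j * coupledWeight c x y)) n := by
  simp only [matrixIntegral, matrixIntegral_integrand, restrict_setOf_forall_mem]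
  rw [integral_integral_prod_weight (integrable_coupledWeight_snd hc J₂)
    (integrable_coupledWeight_fst hc J₁ J₂)]
  have : (n ! : ℝ) ≠ 0 := by exact_mod_cast Nat.factorial_ne_zero n
  have : √Real.pi ≠ 0 := by positivity
  field_simp

lemma matrixIntegral_pos (n : ℕ) {c : ℝ} (hc : c ∈ Ioo (0 : ℝ) 1) {J₁ J₂ : Set ℝ}
    (hJ₁ : (interior J₁).Nonempty) (hJ₂ : (interior J₂).Nonempty) :
    0 < matrixIntegral n c J₁ J₂ := by
  simp only [matrixIntegral, matrixIntegral_integrand, restrict_setOf_forall_mem]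
  have hc0 : 0 < c := hc.1
  refine mul_pos (by positivity) ?_
  refine integral_vandermonde_pos hJ₁ hJ₂ (p := fun x => Real.exp (-x ^ 2))
    (q := fun y => Real.exp (-y ^ 2)) (fun x => Real.exp_pos _) (fun y => Real.exp_pos _)
    (κ := 2 * c) (by positivity) (fun x y => ?_)
    (integrable_coupledWeight_snd hc J₂) (integrable_coupledWeight_fst hc J₁ J₂)
  rw [coupledWeight, ← Real.exp_add, ← Real.exp_add]
  ring_nf

/-- The intervals are closed on the left and open on the right: just to the right of any point the
same endpoints have been passed, so the set contains an interval there. -/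
lemma interior_spectralSet_nonempty (e : Bool) (a : Fin p → ℝ) (h : (spectralSet e a).Nonempty) :
    (interior (spectralSet e a)).Nonempty := by
  obtain ⟨x, hx⟩ := h
  have hev : ∀ᶠ y in nhdsWithin x (Ioi x), ∀ i, (a i ≤ y ↔ a i ≤ x) := by
    rw [Filter.eventually_all]
    intro i
    by_cases hi : a i ≤ x
    · filter_upwards [self_mem_nhdsWithin] with y hy
      exact ⟨fun _ => hi, fun _ => hi.trans (le_of_lt hy)⟩
    · filter_upwards [Ioo_mem_nhdsGT (not_le.1 hi)] with y hy
      exact ⟨fun h => absurd h (not_le.2 hy.2), fun h => absurd h hi⟩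
  obtain ⟨u, hu, hsub⟩ := (mem_nhdsGT_iff_exists_Ioo_subset).1 hev
  have hsub2 : Ioo x u ⊆ spectralSet e a := fun y hy => by
    have h1 : ∀ i, (a i ≤ y ↔ a i ≤ x) := hsub hy
    simp only [spectralSet, mem_ofPred_eq, h1]
    exact hx
  obtain ⟨y, hy⟩ := exists_between (show x < u from hu)
  exact ⟨y, interior_maximal hsub2 isOpen_Ioo hy⟩

lemma mem_spectralSet_div (e : Bool) (a : Fin p → ℝ) {r : ℝ} (hr : 0 < r) (x : ℝ) :
    x / r ∈ spectralSet e (fun i => a i / r) ↔ x ∈ spectralSet e a := by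
  simp only [spectralSet, mem_ofPred_eq, div_le_div_iff_of_pos_right hr]

lemma setIntegral_spectralSet_div (e : Bool) (a : Fin p → ℝ) {r : ℝ} (hr : 0 < r) (f : ℝ → ℝ) :
    ∫ x in spectralSet e (fun i => a i / r), f x = r⁻¹ * ∫ u in spectralSet e a, f (u / r) := by
  rw [← integral_indicator (measurableSet_spectralSet _ _),
    ← integral_indicator (measurableSet_spectralSet _ _)]
  have h : ∀ u, (spectralSet e a).indicator (fun u => f (u / r)) u =
      (spectralSet e (fun i => a i / r)).indicator f (u / r) := fun u => by
    classical
    rw [indicator_apply, indicator_apply]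
    exact if_congr (mem_spectralSet_div e a hr u).symm rfl rfl
  simp only [h]
  rw [Measure.integral_comp_div, abs_of_pos hr, smul_eq_mul, inv_mul_cancel_left₀ hr.ne']

lemma leadingMinor_scale (m : ℕ → ℕ → ℝ) (x : ℕ → ℝ) (n : ℕ) :
    leadingMinor (fun i j => x i * (x j * m i j)) n =
      (∏ i : Fin n, x i) ^ 2 * leadingMinor m n := by
  rw [leadingMinor, minor]
  have h1 := Matrix.det_mul_column (fun i : Fin n => x i)
    (Matrix.of fun i j : Fin n => x j * m i j)
  have h2 := Matrix.det_mul_row (fun i : Fin n => x i) (Matrix.of fun i j : Fin n => m i j)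
  simp only [Matrix.of_apply] at h1 h2
  rw [h1, h2, sq, mul_assoc]
  rfl

/-- The ratio of `τ_n^J` to the determinant of moments. -/
def tauFactor (n : ℕ) (c : ℝ) : ℝ :=
  1 / √Real.pi ^ n * (1 / c) ^ (n * (n - 1) / 2) *
    (∏ i : Fin n, (√(1 - c ^ 2))⁻¹ ^ (i.val + 1)) ^ 2

lemma coupledWeight_div {c r : ℝ} (hr : r ^ 2 = 1 - c ^ 2) (i j : ℕ) (u v : ℝ) :
    (u / r) ^ i * ((v / r) ^ j * coupledWeight c (u / r) (v / r)) =
      r⁻¹ ^ i * (r⁻¹ ^ j * gaussTerm i j c u v) := by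
  have h : -(u / r) ^ 2 - (v / r) ^ 2 + 2 * c * (u / r * (v / r)) =
      -((u ^ 2 + v ^ 2 - 2 * c * (u * v)) / (1 - c ^ 2)) := by
    rw [← hr]
    ring
  rw [coupledWeight, gaussTerm, h]
  ring

/-- `τ_n^J` as a determinant of moments. -/
theorem tau_eq (e₁ e₂ : Bool) (n : ℕ) {z : Vars p q} (hc : z.1 ∈ Ioo (0 : ℝ) 1)
    (ha : Monotone z.2.1) (hb : Monotone z.2.2) :
    tau e₁ e₂ n z = tauFactor n z.1 * leadingMinor (moment e₁ e₂ z) n := by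
  have hpos : 0 < 1 - z.1 ^ 2 := by nlinarith [hc.1, hc.2]
  set r := √(1 - z.1 ^ 2) with hr
  have hr0 : 0 < r := Real.sqrt_pos.2 hpos
  have hr2 : r ^ 2 = 1 - z.1 ^ 2 := Real.sq_sqrt hpos.le
  rw [tau, matrixIntegral_eq n hc, tauFactor, mul_assoc _ (_ ^ 2)]
  congr 1
  -- After rescaling by `r`, the power `x ^ i` contributes `r⁻¹ ^ i` and `dx` one more `r⁻¹`; hence
  -- the exponent `i + 1`.
  rw [← hr, ← leadingMinor_scale (moment e₁ e₂ z) (fun i => r⁻¹ ^ (i + 1))]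
  congr 1
  ext i j
  rw [setIntegral_spectralSet_div _ _ hr0, ← setIntegral_gaussTerm_eq_moment e₁ e₂ hc ha hb]
  simp only [setIntegral_spectralSet_div _ _ hr0, coupledWeight_div hr2, integral_const_mul]
  ring

lemma tau_pos (e₁ e₂ : Bool) (n : ℕ) {z : Vars p q} (hc : z.1 ∈ Ioo (0 : ℝ) 1)
    (hJ₁ : (spectralSet e₁ z.2.1).Nonempty) (hJ₂ : (spectralSet e₂ z.2.2).Nonempty) :
    0 < tau e₁ e₂ n z := by
  have hpos : 0 < 1 - z.1 ^ 2 := by nlinarith [hc.1, hc.2]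
  have hr0 : 0 < √(1 - z.1 ^ 2) := Real.sqrt_pos.2 hpos
  obtain ⟨x, hx⟩ := hJ₁
  obtain ⟨y, hy⟩ := hJ₂
  exact matrixIntegral_pos n hc
    (interior_spectralSet_nonempty _ _ ⟨_, (mem_spectralSet_div _ _ hr0 x).2 hx⟩)
    (interior_spectralSet_nonempty _ _ ⟨_, (mem_spectralSet_div _ _ hr0 y).2 hy⟩)

end MatrixIntegral

/-! ### The differential equations -/

section Equations

variable {E : Type*} [NormedAddCommGroup E] [NormedSpace ℝ E] {Ω : Set E} {v v₀ : E → E}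
  {γ : E → ℝ} {m : E → ℕ → ℕ → ℝ}

lemma LieOn.sub {f g f' g' : E → ℝ} (hf : LieOn Ω v f f') (hg : LieOn Ω v g g') :
    LieOn Ω v (fun z => f z - g z) (fun z => f' z - g' z) := by
  have := hf.add (hg.const_mul (-1))
  simpa [sub_eq_add_neg] using this

/-- The outer derivative sees the inner one in a neighbourhood of the point, hence the openness of
`Ω`. -/
lemma LieOn.fderiv_fderiv (hΩ : IsOpen Ω) {w : E → E} {f f₁ f₂ : E → ℝ} (h₁ : LieOn Ω v f f₁)
    (h₂ : LieOn Ω w f₁ f₂) {z : E} (hz : z ∈ Ω) :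
    fderiv ℝ (fun y => fderiv ℝ f y (v y)) z (w z) = f₂ z :=
  (h₂.congr_left hΩ fun _ hy => h₁.fderiv_eq hy).fderiv_eq hz

/-- Logarithmic first derivative of a ratio of leading minors. -/
def ratioLie (m : ℕ → ℕ → ℝ) (k l : ℕ) : ℝ :=
  -2 * raise₁ m k / leadingMinor m l
    - leadingMinor m k / leadingMinor m l * (-2 * raise₁ m l / leadingMinor m l)

/-- Second derivative of a ratio of leading minors. -/
def ratioLie₂ (m : ℕ → ℕ → ℝ) (k l : ℕ) : ℝ :=
  (-2 * (k * leadingMinor m k - 2 * raise₁₁ m k) * leadingMinor m l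
      - -2 * raise₁ m k * (-2 * raise₁ m l)) / leadingMinor m l ^ 2
    - (ratioLie m k l * (-2 * raise₁ m l / leadingMinor m l)
      + leadingMinor m k / leadingMinor m l *
        ((-2 * (l * leadingMinor m l - 2 * raise₁₁ m l) * leadingMinor m l
          - -2 * raise₁ m l * (-2 * raise₁ m l)) / leadingMinor m l ^ 2))

/-- Second logarithmic derivative of a leading minor. -/
def logLie₂ (m : ℕ → ℕ → ℝ) (l : ℕ) : ℝ :=
  (-2 * (l * leadingMinor m l - 2 * raise₁₁ m l) * leadingMinor m l
    - -2 * raise₁ m l * (-2 * raise₁ m l)) / leadingMinor m l ^ 2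

/-- Derivative of a ratio of leading minors along the second flow. -/
def ratioLie₀ (m : ℕ → ℕ → ℝ) (g : ℝ) (k l : ℕ) : ℝ :=
  (((∑ i ∈ Finset.range k, ((i : ℝ) + 1)) * (1 + g ^ 2) * leadingMinor m k - 2 * raise₂ m k)
      * leadingMinor m l
    - leadingMinor m k * ((∑ i ∈ Finset.range l, ((i : ℝ) + 1)) * (1 + g ^ 2) * leadingMinor m l
      - 2 * raise₂ m l)) / leadingMinor m l ^ 2

namespace MomentFlow

lemma lieOn_log (hm : MomentFlow Ω v v₀ γ m) (l : ℕ) (hl : ∀ z ∈ Ω, leadingMinor (m z) l ≠ 0) :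
    LieOn Ω v (fun z => Real.log (leadingMinor (m z) l))
      (fun z => -2 * raise₁ (m z) l / leadingMinor (m z) l) :=
  (hm.lieOn_leadingMinor l).log hl

lemma lieOn_log₂ (hm : MomentFlow Ω v v₀ γ m) (l : ℕ) (hl : ∀ z ∈ Ω, leadingMinor (m z) l ≠ 0) :
    LieOn Ω v (fun z => -2 * raise₁ (m z) l / leadingMinor (m z) l)
      (fun z => logLie₂ (m z) l) :=
  ((hm.lieOn_raise₁ l).const_mul (-2)).div (hm.lieOn_leadingMinor l) hl

lemma lieOn_ratio (hm : MomentFlow Ω v v₀ γ m) (k l : ℕ)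
    (hl : ∀ z ∈ Ω, leadingMinor (m z) l ≠ 0) :
    LieOn Ω v (fun z => leadingMinor (m z) k / leadingMinor (m z) l)
      (fun z => ratioLie (m z) k l) :=
  ((hm.lieOn_leadingMinor k).div (hm.lieOn_leadingMinor l) hl).congr fun z hz => by
    have := hl z hz
    simp only [ratioLie]
    field_simp

lemma lieOn_ratio₂ (hm : MomentFlow Ω v v₀ γ m) (k l : ℕ)
    (hl : ∀ z ∈ Ω, leadingMinor (m z) l ≠ 0) :
    LieOn Ω v (fun z => ratioLie (m z) k l) (fun z => ratioLie₂ (m z) k l) :=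
  ((((hm.lieOn_raise₁ k).const_mul (-2)).div (hm.lieOn_leadingMinor l) hl).sub
    ((hm.lieOn_ratio k l hl).mul (hm.lieOn_log₂ l hl)))

lemma lieOn_ratio₀ (hm : MomentFlow Ω v v₀ γ m) (k l : ℕ)
    (hl : ∀ z ∈ Ω, leadingMinor (m z) l ≠ 0) :
    LieOn Ω v₀ (fun z => leadingMinor (m z) k / leadingMinor (m z) l)
      (fun z => ratioLie₀ (m z) (γ z) k l) :=
  (hm.lieOn_leadingMinor₀ k).div (hm.lieOn_leadingMinor₀ l) hl

end MomentFlow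

/-- The equation for `τ_{n+1} / τ_n`. -/
lemma ratioLie₂_succ (m : ℕ → ℕ → ℝ) (g : ℝ) (n : ℕ) (h0 : ∀ k, leadingMinor m k ≠ 0) :
    ratioLie₂ m (n + 1) n = -2 * (ratioLie₀ m g (n + 1) n
      + (n * (1 - g ^ 2) - g ^ 2) * (leadingMinor m (n + 1) / leadingMinor m n))
      - 2 * logLie₂ m n * (leadingMinor m (n + 1) / leadingMinor m n) := by
  have hir := hirota m n h0
  have hn := h0 n
  simp only [ratioLie₂, ratioLie₀, ratioLie, logLie₂, Finset.sum_range_succ]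
  push_cast
  field_simp
  -- The products of first derivatives combine into `hirota`. The scalars balance as well, and every
  -- occurrence of `g` cancels thanks to the term `n (1 - g²) - g²`.
  linear_combination 2 * leadingMinor m n * hir

/-- The equation for `τ_{n-1} / τ_n`. -/
lemma ratioLie₂_pred (m : ℕ → ℕ → ℝ) (g : ℝ) (k : ℕ) (h0 : ∀ k, leadingMinor m k ≠ 0) :
    ratioLie₂ m k (k + 1) = 2 * (ratioLie₀ m g k (k + 1)
      - (k * (1 - g ^ 2) - g ^ 2) * (leadingMinor m k / leadingMinor m (k + 1)))
      - 2 * logLie₂ m (k + 1) * (leadingMinor m k / leadingMinor m (k + 1)) := by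
  have hir := hirota m k h0
  have hn := h0 (k + 1)
  simp only [ratioLie₂, ratioLie₀, ratioLie, logLie₂, Finset.sum_range_succ]
  push_cast
  field_simp
  linear_combination 2 * leadingMinor m (k + 1) * hir

end Equations

/-! ### The factors of `U` and `W` depending on `c` alone -/

section Prefactors

open Set

/-- The dependence of `U⁻¹` and `W` on `c` alone. -/
def cFactor (k : ℕ) (c : ℝ) : ℝ := c ^ k * √(1 - c ^ 2)

lemma one_sub_sq_pos {c : ℝ} (hc : c ∈ Ioo (0 : ℝ) 1) : 0 < 1 - c ^ 2 := by
  nlinarith [hc.1, hc.2]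

lemma sqrt_one_sub_sq_pos {c : ℝ} (hc : c ∈ Ioo (0 : ℝ) 1) : 0 < √(1 - c ^ 2) :=
  Real.sqrt_pos.2 (one_sub_sq_pos hc)

lemma cFactor_pos (k : ℕ) {c : ℝ} (hc : c ∈ Ioo (0 : ℝ) 1) : 0 < cFactor k c :=
  mul_pos (pow_pos hc.1 k) (sqrt_one_sub_sq_pos hc)

/-- The logarithmic derivative times `-(1 - c²) c` is `-(k (1 - c²) - c²)`, the negative of the
scalar in `ratioLie₂_succ` and `ratioLie₂_pred`. -/
lemma hasDerivAt_cFactor (k : ℕ) {c : ℝ} (hc : c ∈ Ioo (0 : ℝ) 1) :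
    HasDerivAt (cFactor k) (cFactor k c * (k / c - c / (1 - c ^ 2))) c := by
  have hpos := one_sub_sq_pos hc
  have h1 : HasDerivAt (fun c : ℝ => 1 - c ^ 2) (-(2 * c)) c := by
    simpa using ((hasDerivAt_id c).pow 2).const_sub 1
  have h2 := (hasDerivAt_pow k c).mul (h1.sqrt hpos.ne')
  refine h2.congr_deriv ?_
  have hr := sqrt_one_sub_sq_pos hc
  have hc0 : c ≠ 0 := hc.1.ne'
  have hsq : √(1 - c ^ 2) ^ 2 = 1 - c ^ 2 := Real.sq_sqrt hpos.le
  rw [cFactor]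
  have hk : (k : ℝ) * c ^ (k - 1) = k * c ^ k / c := by
    cases k with
    | zero => simp
    | succ k => rw [Nat.add_sub_cancel, pow_succ]; field_simp
  rw [hk]
  set r := √(1 - c ^ 2)
  rw [← hsq]
  field_simp
  ring

lemma contDiffAt_cFactor (k : ℕ) {c : ℝ} (hc : c ∈ Ioo (0 : ℝ) 1) :
    ContDiffAt ℝ 2 (cFactor k) c := by
  unfold cFactor
  refine (contDiffAt_id.pow k).mul (ContDiffAt.sqrt ?_ (one_sub_sq_pos hc).ne')
  exact contDiffAt_const.sub (contDiffAt_id.pow 2)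

lemma tauFactor_pos (n : ℕ) {c : ℝ} (hc : c ∈ Ioo (0 : ℝ) 1) : 0 < tauFactor n c := by
  have h1 := sqrt_one_sub_sq_pos hc
  have h2 := hc.1
  unfold tauFactor
  have h3 : 0 < ∏ i : Fin n, (√(1 - c ^ 2))⁻¹ ^ (i.val + 1) :=
    Finset.prod_pos fun i _ => by positivity
  positivity

lemma contDiffAt_tauFactor (n : ℕ) {c : ℝ} (hc : c ∈ Ioo (0 : ℝ) 1) :
    ContDiffAt ℝ 2 (tauFactor n) c := by
  have h1 : ContDiffAt ℝ 2 (fun c : ℝ => √(1 - c ^ 2)) c :=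
    (contDiffAt_const.sub (contDiffAt_id.pow 2)).sqrt (one_sub_sq_pos hc).ne'
  have h2 := h1.inv (sqrt_one_sub_sq_pos hc).ne'
  unfold tauFactor
  refine (contDiffAt_const.mul ((contDiffAt_const.div contDiffAt_id hc.1.ne').pow _)).mul
    (ContDiffAt.pow (contDiffAt_prod fun i _ => h2.pow _) 2)

lemma tauFactor_succ (n : ℕ) (c : ℝ) : tauFactor (n + 1) c =
    tauFactor n c * ((√Real.pi)⁻¹ * (c ^ n)⁻¹ * ((√(1 - c ^ 2))⁻¹ ^ (n + 1)) ^ 2) := by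
  simp only [tauFactor, Fin.prod_univ_castSucc, Nat.triangle_succ, Fin.val_castSucc, Fin.val_last,
    pow_add]
  ring

lemma rpow_add_half (n : ℕ) {c : ℝ} (hc : c ∈ Ioo (0 : ℝ) 1) :
    (1 - c ^ 2) ^ ((n : ℝ) + 1 / 2) = √(1 - c ^ 2) ^ (2 * n + 1) := by
  have hpos := one_sub_sq_pos hc
  rw [Real.rpow_add hpos, Real.rpow_natCast, ← Real.sqrt_eq_rpow,
    pow_succ (√(1 - c ^ 2)), pow_mul (√(1 - c ^ 2)), Real.sq_sqrt hpos.le]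

variable {p q : ℕ}

/-- With `r = √(1 - c²)`, the normalization `r ^ (2n + 1)` meets `r ^ (-2(n + 1))` from
`tauFactor_succ`, leaving a single `r⁻¹`. -/
lemma U_eq (e₁ e₂ : Bool) (n : ℕ) {z : Vars p q} (hc : z.1 ∈ Ioo (0 : ℝ) 1)
    (ha : Monotone z.2.1) (hb : Monotone z.2.2) : U e₁ e₂ n z = (√Real.pi)⁻¹ *
      (cFactor n z.1)⁻¹ *
        (leadingMinor (moment e₁ e₂ z) (n + 1) / leadingMinor (moment e₁ e₂ z) n) := by
  have hr := sqrt_one_sub_sq_pos hc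
  have ht := tauFactor_pos n hc
  have hc0 : 0 < z.1 := hc.1
  rw [U, tau_eq e₁ e₂ _ hc ha hb, tau_eq e₁ e₂ _ hc ha hb, rpow_add_half n hc, tauFactor_succ,
    cFactor, mul_assoc (tauFactor n z.1), mul_div_mul_left _ _ ht.ne']
  set r := √(1 - z.1 ^ 2)
  have hp : r⁻¹ ^ (n + 1) = (r ^ (n + 1))⁻¹ := by rw [inv_pow]
  rw [hp]
  have h2 : r ^ (2 * n + 1) * r = (r ^ (n + 1)) ^ 2 := by ring
  field_simp
  rw [← h2]
  ring

lemma W_eq (e₁ e₂ : Bool) (k : ℕ) {z : Vars p q} (hc : z.1 ∈ Ioo (0 : ℝ) 1)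
    (ha : Monotone z.2.1) (hb : Monotone z.2.2) : W e₁ e₂ (k + 1) z = √Real.pi *
      cFactor k z.1 *
        (leadingMinor (moment e₁ e₂ z) k / leadingMinor (moment e₁ e₂ z) (k + 1)) := by
  have hr := sqrt_one_sub_sq_pos hc
  have ht := tauFactor_pos k hc
  have hc0 : 0 < z.1 := hc.1
  have he : -(((k + 1 : ℕ) : ℝ) - 1 / 2) = -((k : ℝ) + 1 / 2) := by push_cast; ring
  rw [W, Nat.add_sub_cancel, tau_eq e₁ e₂ _ hc ha hb, tau_eq e₁ e₂ _ hc ha hb, he,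
    Real.rpow_neg (one_sub_sq_pos hc).le, rpow_add_half k hc, tauFactor_succ,
    cFactor, mul_assoc (tauFactor k z.1), mul_div_mul_left _ _ ht.ne']
  set r := √(1 - z.1 ^ 2)
  have hp : r⁻¹ ^ (k + 1) = (r ^ (k + 1))⁻¹ := by rw [inv_pow]
  rw [hp]
  have h2 : r ^ (2 * k + 1) * r = (r ^ (k + 1)) ^ 2 := by ring
  have hpi : √Real.pi ≠ 0 := by positivity
  field_simp
  rw [← h2]
  ring

end Prefactors

/-! ### Second-order equations along an abstract moment flow -/

section AbstractEquations

variable {E : Type*} [NormedAddCommGroup E] [NormedSpace ℝ E] {Ω : Set E} {v v₀ : E → E}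
  {γ : E → ℝ} {m : E → ℕ → ℕ → ℝ}

namespace MomentFlow

lemma mono (hm : MomentFlow Ω v v₀ γ m) {Ω' : Set E} (h : Ω' ⊆ Ω) : MomentFlow Ω' v v₀ γ m where
  first i j := (hm.first i j).mono h
  second i j := (hm.second i j).mono h

variable {n : ℕ} {T : E → ℝ}

lemma lieOn_log_add (hm : MomentFlow Ω v v₀ γ m) (hΩ : IsOpen Ω)
    (hl : ∀ z ∈ Ω, leadingMinor (m z) n ≠ 0) {β : E → ℝ} (hβ : LieOn Ω v β fun _ => 0)
    (hT : ∀ z ∈ Ω, T z = Real.log (leadingMinor (m z) n) + β z) :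
    LieOn Ω v T fun z => -2 * raise₁ (m z) n / leadingMinor (m z) n :=
  (((hm.lieOn_log n hl).add hβ).congr fun _ _ => add_zero _).congr_left hΩ hT

/-- The second-order equation for `τ_{n+1} / τ_n` along a moment flow. -/
lemma ratio_succ_equation (hm : MomentFlow Ω v v₀ γ m) (hΩ : IsOpen Ω)
    (hl : ∀ z ∈ Ω, leadingMinor (m z) n ≠ 0)
    (hT : LieOn Ω v T fun z => -2 * raise₁ (m z) n / leadingMinor (m z) n)
    {α f : E → ℝ} (hα : LieOn Ω v α fun _ => 0)
    (hα₀ : LieOn Ω v₀ α fun z => α z * (n * (1 - γ z ^ 2) - γ z ^ 2))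
    (hf : ∀ z ∈ Ω, f z = α z * (leadingMinor (m z) (n + 1) / leadingMinor (m z) n))
    {z : E} (hz : z ∈ Ω) (h0 : ∀ k, leadingMinor (m z) k ≠ 0) :
    fderiv ℝ (fun y => fderiv ℝ f y (v y)) z (v z) = -2 * fderiv ℝ f z (v₀ z)
      - 2 * fderiv ℝ (fun y => fderiv ℝ T y (v y)) z (v z) * f z := by
  have h1 := (((hα.mul (hm.lieOn_ratio (n + 1) n hl))).congr_left hΩ hf).congr
    (g' := fun z => α z * ratioLie (m z) (n + 1) n) fun z _ => by ring
  have h2 := hα.mul (hm.lieOn_ratio₂ (n + 1) n hl)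
  have h3 := ((hα₀.mul (hm.lieOn_ratio₀ (n + 1) n hl))).congr_left hΩ hf
  rw [h1.fderiv_fderiv hΩ h2 hz, h3.fderiv_eq hz, hT.fderiv_fderiv hΩ (hm.lieOn_log₂ n hl) hz,
    hf z hz, ratioLie₂_succ (m z) (γ z) n h0]
  ring

/-- The second-order equation for `τ_{n-1} / τ_n` along a moment flow. -/
lemma ratio_pred_equation {k : ℕ} (hm : MomentFlow Ω v v₀ γ m) (hΩ : IsOpen Ω)
    (hl : ∀ z ∈ Ω, leadingMinor (m z) (k + 1) ≠ 0)
    (hT : LieOn Ω v T fun z => -2 * raise₁ (m z) (k + 1) / leadingMinor (m z) (k + 1))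
    {α f : E → ℝ} (hα : LieOn Ω v α fun _ => 0)
    (hα₀ : LieOn Ω v₀ α fun z => α z * -(k * (1 - γ z ^ 2) - γ z ^ 2))
    (hf : ∀ z ∈ Ω, f z = α z * (leadingMinor (m z) k / leadingMinor (m z) (k + 1)))
    {z : E} (hz : z ∈ Ω) (h0 : ∀ k, leadingMinor (m z) k ≠ 0) :
    fderiv ℝ (fun y => fderiv ℝ f y (v y)) z (v z) = 2 * fderiv ℝ f z (v₀ z)
      - 2 * fderiv ℝ (fun y => fderiv ℝ T y (v y)) z (v z) * f z := by
  have h1 := (((hα.mul (hm.lieOn_ratio k (k + 1) hl))).congr_left hΩ hf).congr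
    (g' := fun z => α z * ratioLie (m z) k (k + 1)) fun z _ => by ring
  have h2 := hα.mul (hm.lieOn_ratio₂ k (k + 1) hl)
  have h3 := ((hα₀.mul (hm.lieOn_ratio₀ k (k + 1) hl))).congr_left hΩ hf
  rw [h1.fderiv_fderiv hΩ h2 hz, h3.fderiv_eq hz,
    hT.fderiv_fderiv hΩ (hm.lieOn_log₂ (k + 1) hl) hz, hf z hz, ratioLie₂_pred (m z) (γ z) k h0]
  ring

/-- The Toda equation for a pair of moment flows. -/
lemma toda_equation {k : ℕ} {w : E → E} (hm : MomentFlow Ω v v₀ γ m)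
    (hΩ : IsOpen Ω) (hl : ∀ z ∈ Ω, leadingMinor (m z) (k + 1) ≠ 0)
    (hT : LieOn Ω w T fun z => -2 * raise₁ (fun i j => m z j i) (k + 1) /
      leadingMinor (fun i j => m z j i) (k + 1))
    {z : E} (hz : z ∈ Ω) (h0 : ∀ k, leadingMinor (m z) k ≠ 0) :
    fderiv ℝ (fun y => fderiv ℝ T y (w y)) z (v z) =
      4 * (leadingMinor (m z) (k + 2) * leadingMinor (m z) k / leadingMinor (m z) (k + 1) ^ 2)
        - 2 * γ z * (k + 1) := by
  -- In terms of `m`, the derivative of `T` along `w` is a minor with its last column raised; `v`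
  -- then raises the last row.
  simp only [raise₁, minor_transpose, leadingMinor_transpose] at hT
  have h2 := ((hm.lieOn_minor_raised_col k).const_mul (-2)).div (hm.lieOn_leadingMinor (k + 1)) hl
  rw [hT.fderiv_fderiv hΩ h2 hz]
  have ht := toda (m z) k h0
  have := hl z hz
  simp only [raise₁]
  rw [← ht]
  field_simp
  ring

end MomentFlow

end AbstractEquations

/-! ### Passage from moment determinants to `T`, `U` and `W` -/

section Main

open Set

variable {p q : ℕ}

lemma contDiffOn_leadingMinor (e₁ e₂ : Bool) (n : ℕ) :
    ContDiffOn ℝ 2 (fun z : Vars p q => leadingMinor (moment e₁ e₂ z) n) (couplingDomain p q) := by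
  simp only [leadingMinor, minor, Matrix.det_apply', Matrix.of_apply]
  exact ContDiffOn.sum fun σ _ => contDiffOn_const.mul
    (contDiffOn_prod fun i _ => contDiffOn_moment e₁ e₂ _ _ 2)

/-- The points near which the tau function `τ_n^J` is a nonzero multiple of a moment determinant. -/
def regularDomain (p q : ℕ) (e₁ e₂ : Bool) (n : ℕ) : Set (Vars p q) :=
  {z ∈ couplingDomain p q | StrictMono z.2.1 ∧ StrictMono z.2.2 ∧
    0 < leadingMinor (moment e₁ e₂ z) n}

lemma isOpen_setOf_strictMono : IsOpen {a : Fin p → ℝ | StrictMono a} := by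
  have : {a : Fin p → ℝ | StrictMono a} = ⋂ (i) (j) (_ : i < j), {a | a i < a j} := by
    ext a
    simp [StrictMono]
  rw [this]
  exact isOpen_iInter_of_finite fun i => isOpen_iInter_of_finite fun j =>
    isOpen_iInter_of_finite fun _ => isOpen_lt (continuous_apply i) (continuous_apply j)

lemma isOpen_regularDomain (e₁ e₂ : Bool) (n : ℕ) : IsOpen (regularDomain p q e₁ e₂ n) := by
  have h1 := (contDiffOn_leadingMinor (p := p) (q := q) e₁ e₂ n).continuousOn.isOpen_inter_preimage
    isOpen_couplingDomain isOpen_Ioi (t := Ioi 0)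
  have h2 : IsOpen {z : Vars p q | StrictMono z.2.1} :=
    isOpen_setOf_strictMono.preimage (continuous_fst.comp continuous_snd)
  have h3 : IsOpen {z : Vars p q | StrictMono z.2.2} :=
    isOpen_setOf_strictMono.preimage (continuous_snd.comp continuous_snd)
  have h : regularDomain p q e₁ e₂ n = (couplingDomain p q ∩
      (fun z => leadingMinor (moment e₁ e₂ z) n) ⁻¹' Ioi 0) ∩ {z | StrictMono z.2.1} ∩
      {z | StrictMono z.2.2} := by
    ext z
    simp only [regularDomain, mem_ofPred_eq, mem_inter_iff, mem_preimage, mem_Ioi]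
    tauto
  rw [h]
  exact (h1.inter h2).inter h3

lemma lieOn_fst_zero {Ω : Set (Vars p q)} {v : Vars p q → Vars p q} (hv : ∀ z, (v z).1 = 0)
    {θ : ℝ → ℝ} (hθ : ∀ z ∈ Ω, DifferentiableAt ℝ θ z.1) :
    LieOn Ω v (fun z => θ z.1) fun _ => 0 := fun z hz =>
  ⟨_, (hθ z hz).hasDerivAt.comp_hasFDerivAt z hasFDerivAt_fst, by simp [hv]⟩

lemma lieOn_cFactor {Ω : Set (Vars p q)} (hΩ : Ω ⊆ couplingDomain p q) {v : Vars p q → Vars p q}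
    (hv : ∀ z, (v z).1 = -((1 - z.1 ^ 2) * z.1)) (k : ℕ) :
    LieOn Ω v (fun z => cFactor k z.1)
      fun z => cFactor k z.1 * -(k * (1 - z.1 ^ 2) - z.1 ^ 2) := fun z hz => by
  refine ⟨_, (hasDerivAt_cFactor k (hΩ hz)).comp_hasFDerivAt z hasFDerivAt_fst, ?_⟩
  have h1 : z.1 ≠ 0 := (hΩ hz).1.ne'
  have h2 := one_sub_sq_ne_zero (hΩ hz)
  simp only [smul_apply, ContinuousLinearMap.coe_fst', smul_eq_mul, hv]
  field_simp

lemma matrixIntegral_univ (n : ℕ) (c : ℝ) : matrixIntegral n c univ univ =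
    tau true true n ((c, Fin.elim0, Fin.elim0) : Vars 0 0) := by
  have h (a : Fin 0 → ℝ) : spectralSet true a = univ := by
    ext x
    simp [spectralSet]
  simp [tau, h]

lemma contDiffAt_matrixIntegral_univ (n : ℕ) {c : ℝ} (hc : c ∈ Ioo (0 : ℝ) 1) :
    ContDiffAt ℝ 2 (fun c => matrixIntegral n c univ univ) c := by
  have h1 : ContDiffAt ℝ 2 (fun c : ℝ => tauFactor n c *
      leadingMinor (moment true true ((c, Fin.elim0, Fin.elim0) : Vars 0 0)) n) c := by
    refine (contDiffAt_tauFactor n hc).mul (ContDiffAt.comp c (g := fun z : Vars 0 0 =>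
      leadingMinor (moment true true z) n) (f := fun c : ℝ => (c, Fin.elim0, Fin.elim0)) ?_ ?_)
    · exact (contDiffOn_leadingMinor true true n).contDiffAt (isOpen_couplingDomain.mem_nhds hc)
    · exact contDiffAt_id.prodMk contDiffAt_const
  refine h1.congr_of_eventuallyEq ?_
  filter_upwards [isOpen_Ioo.mem_nhds hc] with x hx
  rw [matrixIntegral_univ]
  exact tau_eq true true n (z := ((x, Fin.elim0, Fin.elim0) : Vars 0 0)) hx
    (Subsingleton.monotone _) (Subsingleton.monotone _)

section

variable {e₁ e₂ : Bool} {n : ℕ}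

lemma regularDomain_subset : regularDomain p q e₁ e₂ n ⊆ couplingDomain p q := fun _ hz => hz.1

lemma leadingMinor_moment_pos {z : Vars p q} (hz : z ∈ couplingDomain p q)
    (ha : StrictMono z.2.1) (hb : StrictMono z.2.2) (hJ₁ : (spectralSet e₁ z.2.1).Nonempty)
    (hJ₂ : (spectralSet e₂ z.2.2).Nonempty) (k : ℕ) : 0 < leadingMinor (moment e₁ e₂ z) k := by
  have h := tau_pos e₁ e₂ k hz hJ₁ hJ₂
  rw [tau_eq e₁ e₂ k hz ha.monotone hb.monotone] at h
  exact (mul_pos_iff_of_pos_left (tauFactor_pos k hz)).1 h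

lemma contDiffAt_leadingMinor {z : Vars p q} (hz : z ∈ couplingDomain p q) (k : ℕ) :
    ContDiffAt ℝ 2 (fun z => leadingMinor (moment e₁ e₂ z) k) z :=
  (contDiffOn_leadingMinor e₁ e₂ k).contDiffAt (isOpen_couplingDomain.mem_nhds hz)

lemma contDiffAt_comp_coupling {θ : ℝ → ℝ} {z : Vars p q} (h : ContDiffAt ℝ 2 θ z.1) :
    ContDiffAt ℝ 2 (fun y : Vars p q => θ y.1) z :=
  ContDiffAt.comp z (g := θ) (f := fun y : Vars p q => y.1) h contDiffAt_fst

lemma contDiffAt_U {z : Vars p q} (hz : z ∈ regularDomain p q e₁ e₂ n) :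
    ContDiffAt ℝ 2 (U e₁ e₂ n) z := by
  have hc := hz.1
  have h := ((contDiffAt_const (c := (√Real.pi)⁻¹)).mul
    ((contDiffAt_comp_coupling (contDiffAt_cFactor n hc)).inv
    (cFactor_pos n hc).ne')).mul ((contDiffAt_leadingMinor (e₁ := e₁) (e₂ := e₂) hc (n + 1)).div
    (contDiffAt_leadingMinor hc n) hz.2.2.2.ne')
  refine h.congr_of_eventuallyEq ?_
  filter_upwards [(isOpen_regularDomain e₁ e₂ n).mem_nhds hz] with y hy
  exact U_eq e₁ e₂ n hy.1 hy.2.1.monotone hy.2.2.1.monotone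

lemma contDiffAt_W {k : ℕ} {z : Vars p q} (hz : z ∈ regularDomain p q e₁ e₂ (k + 1)) :
    ContDiffAt ℝ 2 (W e₁ e₂ (k + 1)) z := by
  have hc := hz.1
  have h := ((contDiffAt_const (c := √Real.pi)).mul
    (contDiffAt_comp_coupling (contDiffAt_cFactor k hc))).mul
    ((contDiffAt_leadingMinor (e₁ := e₁) (e₂ := e₂) hc k).div
    (contDiffAt_leadingMinor hc (k + 1)) hz.2.2.2.ne')
  refine h.congr_of_eventuallyEq ?_
  filter_upwards [(isOpen_regularDomain e₁ e₂ (k + 1)).mem_nhds hz] with y hy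
  exact W_eq e₁ e₂ k hy.1 hy.2.1.monotone hy.2.2.1.monotone

/-- Up to a function of `c`, both choices of `T` are the logarithm of the moment determinant. -/
lemma exists_eq_log_add {T : Vars p q → ℝ} (hT : T = logTau e₁ e₂ n ∨ T = logProb e₁ e₂ n) :
    ∃ β : ℝ → ℝ, (∀ c ∈ Ioo (0 : ℝ) 1, ContDiffAt ℝ 2 β c) ∧ ∀ z ∈ regularDomain p q e₁ e₂ n,
      T z = Real.log (leadingMinor (moment e₁ e₂ z) n) + β z.1 := by
  have h1 (c : ℝ) (hc : c ∈ Ioo (0 : ℝ) 1) : ContDiffAt ℝ 2 (fun c => Real.log (tauFactor n c)) c :=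
    (contDiffAt_tauFactor n hc).log (tauFactor_pos n hc).ne'
  have hpos (c : ℝ) (hc : c ∈ Ioo (0 : ℝ) 1) : 0 < matrixIntegral n c univ univ :=
    matrixIntegral_pos n hc (by simp) (by simp)
  rcases hT with rfl | rfl
  · refine ⟨fun c => Real.log (tauFactor n c), h1, fun z hz => ?_⟩
    rw [logTau, tau_eq e₁ e₂ n hz.1 hz.2.1.monotone hz.2.2.1.monotone,
      Real.log_mul (tauFactor_pos n hz.1).ne' hz.2.2.2.ne', add_comm]
  · refine ⟨fun c => Real.log (tauFactor n c) - Real.log (matrixIntegral n c univ univ),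
      fun c hc => (h1 c hc).sub ((contDiffAt_matrixIntegral_univ n hc).log (hpos c hc).ne'),
      fun z hz => ?_⟩
    rw [logProb, tau_eq e₁ e₂ n hz.1 hz.2.1.monotone hz.2.2.1.monotone,
      Real.log_div (mul_pos (tauFactor_pos n hz.1) hz.2.2.2).ne' (hpos z.1 hz.1).ne',
      Real.log_mul (tauFactor_pos n hz.1).ne' hz.2.2.2.ne']
    ring

/-- The roots and the constants cancel, and the powers of `c` leave `1 / c`. This is why the Toda
equation carries the factor `4c`. -/
lemma U_mul_W {k : ℕ} {z : Vars p q} (hz : z ∈ regularDomain p q e₁ e₂ (k + 1)) :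
    z.1 * (U e₁ e₂ (k + 1) z * W e₁ e₂ (k + 1) z) = leadingMinor (moment e₁ e₂ z) (k + 2) *
      leadingMinor (moment e₁ e₂ z) k / leadingMinor (moment e₁ e₂ z) (k + 1) ^ 2 := by
  have hc : z.1 ≠ 0 := hz.1.1.ne'
  have hpi : √Real.pi ≠ 0 := by positivity
  have hr := (sqrt_one_sub_sq_pos hz.1).ne'
  have hd := hz.2.2.2.ne'
  rw [U_eq e₁ e₂ (k + 1) hz.1 hz.2.1.monotone hz.2.2.1.monotone,
    W_eq e₁ e₂ k hz.1 hz.2.1.monotone hz.2.2.1.monotone, cFactor, cFactor]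
  field_simp
  ring

/-- The equations of `U` and `W` along one of the two flows. -/
lemma ratio_equations {k : ℕ} {v v₀ : Vars p q → Vars p q} {m : Vars p q → ℕ → ℕ → ℝ}
    (hm : MomentFlow (couplingDomain p q) v v₀ (fun z => z.1) m) (hv : ∀ z, (v z).1 = 0)
    (hv₀ : ∀ z, (v₀ z).1 = -((1 - z.1 ^ 2) * z.1))
    (hme : ∀ z n, leadingMinor (m z) n = leadingMinor (moment e₁ e₂ z) n) {T : Vars p q → ℝ}
    (hT : LieOn (regularDomain p q e₁ e₂ (k + 1)) v T fun z =>
      -2 * raise₁ (m z) (k + 1) / leadingMinor (m z) (k + 1))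
    {z : Vars p q} (hz : z ∈ regularDomain p q e₁ e₂ (k + 1))
    (h0 : ∀ n, leadingMinor (moment e₁ e₂ z) n ≠ 0) :
    fderiv ℝ (fun y => fderiv ℝ (U e₁ e₂ (k + 1)) y (v y)) z (v z) =
      -2 * fderiv ℝ (U e₁ e₂ (k + 1)) z (v₀ z)
        - 2 * fderiv ℝ (fun y => fderiv ℝ T y (v y)) z (v z) * U e₁ e₂ (k + 1) z ∧
    fderiv ℝ (fun y => fderiv ℝ (W e₁ e₂ (k + 1)) y (v y)) z (v z) =
      2 * fderiv ℝ (W e₁ e₂ (k + 1)) z (v₀ z)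
        - 2 * fderiv ℝ (fun y => fderiv ℝ T y (v y)) z (v z) * W e₁ e₂ (k + 1) z := by
  have hmΩ := hm.mono (regularDomain_subset (e₁ := e₁) (e₂ := e₂) (n := k + 1))
  have hΩ := isOpen_regularDomain (p := p) (q := q) e₁ e₂ (k + 1)
  have hl : ∀ y ∈ regularDomain p q e₁ e₂ (k + 1), leadingMinor (m y) (k + 1) ≠ 0 :=
    fun y hy => by rw [hme]; exact hy.2.2.2.ne'
  have h0' : ∀ n, leadingMinor (m z) n ≠ 0 := fun n => by rw [hme]; exact h0 n
  have hd (j : ℕ) : ∀ y ∈ regularDomain p q e₁ e₂ (k + 1), DifferentiableAt ℝ (cFactor j) y.1 :=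
    fun y hy => (hasDerivAt_cFactor j hy.1).differentiableAt
  have hne (j : ℕ) : ∀ y ∈ regularDomain p q e₁ e₂ (k + 1), cFactor j y.1 ≠ 0 :=
    fun y hy => (cFactor_pos j hy.1).ne'
  have hcF (j : ℕ) := lieOn_cFactor (regularDomain_subset (e₁ := e₁) (e₂ := e₂) (n := k + 1)) hv₀ j
  constructor
  · refine hmΩ.ratio_succ_equation hΩ hl hT
      (α := fun y => (√Real.pi)⁻¹ * (cFactor (k + 1) y.1)⁻¹) ?_ ?_ (fun y hy => ?_) hz h0'
    · exact lieOn_fst_zero hv (θ := fun c => (√Real.pi)⁻¹ * (cFactor (k + 1) c)⁻¹)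
        fun y hy => ((hd (k + 1) y hy).inv (hne (k + 1) y hy)).const_mul _
    · refine (((hcF (k + 1)).inv (hne (k + 1))).const_mul (√Real.pi)⁻¹).congr fun y hy => ?_
      have := hne (k + 1) y hy
      field_simp
    · rw [hme, hme]
      exact U_eq e₁ e₂ (k + 1) hy.1 hy.2.1.monotone hy.2.2.1.monotone
  · refine hmΩ.ratio_pred_equation hΩ hl hT
      (α := fun y => √Real.pi * cFactor k y.1) ?_ ?_ (fun y hy => ?_) hz h0'
    · exact lieOn_fst_zero hv (θ := fun c => √Real.pi * cFactor k c)
        fun y hy => (hd k y hy).const_mul _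
    · exact ((hcF k).const_mul (√Real.pi)).congr fun y _ => by ring
    · rw [hme, hme]
      exact W_eq e₁ e₂ k hy.1 hy.2.1.monotone hy.2.2.1.monotone

end

end Main

end CoupledGUE

end

theorem mainTheorem2 (n : ℕ) (hn : 1 ≤ n) (p q : ℕ) (e₁ e₂ : Bool)
    (c : ℝ) (hc₀ : 0 < c) (hc₁ : c < 1)
    (a : Fin p → ℝ) (ha : StrictMono a) (b : Fin q → ℝ) (hb : StrictMono b)
    (hJ₁ : (CoupledGUE.spectralSet e₁ a).Nonempty)
    (hJ₂ : (CoupledGUE.spectralSet e₂ b).Nonempty) :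
    let z : CoupledGUE.Vars p q := (c, a, b)
    let U : CoupledGUE.Vars p q → ℝ := CoupledGUE.U e₁ e₂ n
    let W : CoupledGUE.Vars p q → ℝ := CoupledGUE.W e₁ e₂ n
    (∀ m : ℕ, 0 < CoupledGUE.tau e₁ e₂ m z) ∧
    0 < CoupledGUE.matrixIntegral n c Set.univ Set.univ ∧
    ContDiffAt ℝ 2 U z ∧ ContDiffAt ℝ 2 W z ∧
    ∀ T : CoupledGUE.Vars p q → ℝ,
      T = CoupledGUE.logTau e₁ e₂ n ∨ T = CoupledGUE.logProb e₁ e₂ n →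
      ContDiffAt ℝ 2 T z ∧
      CoupledGUE.A (CoupledGUE.At T) z = 4 * c * (U z * W z - n / 2) ∧
      CoupledGUE.A (CoupledGUE.A U) z
        = -2 * CoupledGUE.A₀ U z - 2 * CoupledGUE.A (CoupledGUE.A T) z * U z ∧
      CoupledGUE.A (CoupledGUE.A W) z
        = 2 * CoupledGUE.A₀ W z - 2 * CoupledGUE.A (CoupledGUE.A T) z * W z ∧
      CoupledGUE.At (CoupledGUE.At U) z
        = -2 * CoupledGUE.At₀ U z - 2 * CoupledGUE.At (CoupledGUE.At T) z * U z ∧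
      CoupledGUE.At (CoupledGUE.At W) z
        = 2 * CoupledGUE.At₀ W z - 2 * CoupledGUE.At (CoupledGUE.At T) z * W z := by
  obtain ⟨k, rfl⟩ : ∃ k, n = k + 1 := ⟨n - 1, by omega⟩
  intro z U W
  have hc : c ∈ Set.Ioo (0 : ℝ) 1 := ⟨hc₀, hc₁⟩
  have hd : ∀ m, 0 < CoupledGUE.leadingMinor (CoupledGUE.moment e₁ e₂ z) m :=
    CoupledGUE.leadingMinor_moment_pos (z := z) hc ha hb hJ₁ hJ₂
  -- Near `z` only the denominator, the minor of size `n`, has to be positive, which is an open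
  -- condition. The other minors are needed at `z` alone.
  have hz : z ∈ CoupledGUE.regularDomain p q e₁ e₂ (k + 1) := ⟨hc, ha, hb, hd _⟩
  have hΩ := CoupledGUE.isOpen_regularDomain (p := p) (q := q) e₁ e₂ (k + 1)
  have hsub := CoupledGUE.regularDomain_subset (p := p) (q := q) (e₁ := e₁) (e₂ := e₂) (n := k + 1)
  refine ⟨fun m => CoupledGUE.tau_pos e₁ e₂ m hc hJ₁ hJ₂,
    CoupledGUE.matrixIntegral_pos _ hc (by simp) (by simp), CoupledGUE.contDiffAt_U hz,
    CoupledGUE.contDiffAt_W hz, fun T hT => ?_⟩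
  obtain ⟨β, hβ, hTβ⟩ := CoupledGUE.exists_eq_log_add hT
  have hm := CoupledGUE.momentFlow (p := p) (q := q) e₁ e₂
  have hmt := CoupledGUE.momentFlow_transpose (p := p) (q := q) e₁ e₂
  have hβd : ∀ y ∈ CoupledGUE.regularDomain p q e₁ e₂ (k + 1), DifferentiableAt ℝ β y.1 :=
    fun y hy => (hβ y.1 hy.1).differentiableAt (by norm_num)
  have hl : ∀ y ∈ CoupledGUE.regularDomain p q e₁ e₂ (k + 1),
      CoupledGUE.leadingMinor (CoupledGUE.moment e₁ e₂ y) (k + 1) ≠ 0 :=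
    fun y hy => hy.2.2.2.ne'
  have hTA := (hm.mono hsub).lieOn_log_add hΩ hl
    (CoupledGUE.lieOn_fst_zero (fun _ => rfl) hβd) hTβ
  -- Transposing the moments keeps the leading minors and exchanges the roles of the two matrices,
  -- so the tilded equations need no separate argument.
  have hTAt := (hmt.mono hsub).lieOn_log_add (n := k + 1) (T := T) hΩ
    (fun y hy => by rw [CoupledGUE.leadingMinor_transpose]; exact hl y hy)
    (CoupledGUE.lieOn_fst_zero (fun _ => rfl) hβd)
    (fun y hy => by rw [CoupledGUE.leadingMinor_transpose]; exact hTβ y hy)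
  have hA : ∀ f : CoupledGUE.Vars p q → ℝ,
      CoupledGUE.A f = fun y => fderiv ℝ f y (CoupledGUE.fieldA y) :=
    fun f => funext (CoupledGUE.A_eq f)
  have hAt : ∀ f : CoupledGUE.Vars p q → ℝ,
      CoupledGUE.At f = fun y => fderiv ℝ f y (CoupledGUE.fieldAt y) :=
    fun f => funext (CoupledGUE.At_eq f)
  have h := CoupledGUE.ratio_equations hm (fun _ => rfl) (fun _ => rfl) (fun _ _ => rfl) hTA hz
    fun m => (hd m).ne'
  have ht := CoupledGUE.ratio_equations hmt (fun _ => rfl) (fun _ => rfl)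
    (fun _ _ => CoupledGUE.leadingMinor_transpose _ _) hTAt hz fun m => (hd m).ne'
  have htoda := (hm.mono hsub).toda_equation hΩ hl hTAt hz fun m => (hd m).ne'
  simp only [hA, hAt, CoupledGUE.A₀_eq, CoupledGUE.At₀_eq]
  refine ⟨?_, ?_, h.1, h.2, ht.1, ht.2⟩
  · refine (((CoupledGUE.contDiffAt_leadingMinor hc (k + 1)).log (hd (k + 1)).ne').add
      (CoupledGUE.contDiffAt_comp_coupling (hβ c hc))).congr_of_eventuallyEq ?_
    filter_upwards [hΩ.mem_nhds hz] with y hy using hTβ y hy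
  · rw [htoda, ← CoupledGUE.U_mul_W hz]
    push_cast
    ring
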